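/- **Diagrams.** Let $\rho(x,y)=(-x,y)$ be the reflection of $\mathbb R^2$ in the axis $B=\{0\}\times\mathbb R$. An oriented link diagram $D\subset\mathbb R^2$ is *symmetric* if $\rho(D)$ is obtained from $D$ by reversing the orientation and switching all the crossings on $B$; it is a *symmetric union* if moreover $\rho$ maps each component to itself, reversing its orientation. Diagrams are considered up to isotopy of the plane, and symmetric diagrams up to orientation-preserving diffeomorphisms of the plane which commute with $\rho$. **Moves.** A *symmetric Reidemeister move off the axis* is an ordinary Reidemeister move performed away from $B$ together with its mirror image. The *symmetric Reidemeister moves on the axis* are: $S2(h)$, two strands crossing $B$ perpendicularly at consecutive points are pulled across each other, creating two mirror-symmetric crossings off the axis; $S2(\pm)$, the strands at a crossing on $B$ are twisted around each other mirror-symmetrically on both sides of $B$, the crossing on $B$ keeping its type; $S3(o\pm)$ and $S3(u\pm)$, a strand crossing $B$ perpendicularly passes over, respectively under, a crossing on $B$; $S4(\pm\pm)$, two consecutive crossings on $B$ change places, the strands of one passing over those of the other. The extra moves are: $S1(\pm)$, a curl whose crossing is on $B$ is added or removed; $S2(v)$, two consecutive opposite crossings on $B$ of the same two strands are added or removed.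 Two oriented symmetric diagrams are *symmetrically equivalent* if they are related by a finite sequence of symmetric Reidemeister moves and $S1$ moves, and *weakly symmetrically equivalent* if they are related by a finite sequence of symmetric Reidemeister moves, $S1$ and $S2(v)$ moves. Two oriented diagrams are *Reidemeister equivalent* if they are related by planar isotopies and Reidemeister moves. **Connected sums.** The connected sum $D\# D'$ of two unoriented symmetric union diagrams is obtained by putting $D$ above $D'$ along $B$ and joining symmetrically the lowest strand of $D$ transverse to $B$ to the highest strand of $D'$ transverse to $B$. For $k\ge1$, $\#^kD$ denotes the connected sum of $k$ copies of $D$. **The four diagrams.** A symmetric diagram is given by its right half $x\geq 0$ and its crossings on $B$, read from bottom to top; the strands of the right half are numbered $0,1,2,\dots$ outwards from $B$. Let $\cup_B$ (resp. $\cap_B$) denote a strand crossing $B$ perpendicularly in a local minimum (resp. maximum), whose right leg is strand $0$; $\cup_i$ (resp. $\cap_i$) a local minimum (resp. maximum) with legs $i,i+1$; $\sigma_i^{+}$ (resp. $\sigma_i^-$) a crossing of the strands $i,i+1$ in which the strand going from the lower left to the upper right (resp. from the lower right to the upper left) is the over-strand; $\beta^{\pm}$, with the same convention, a crossing on $B$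 of strand $0$ with its mirror image. Then $$D_{10_{42}}=\cup_B\,\cup_1\,\sigma_0^-\,\beta^-\,\sigma_0^-\,\beta^+\,\sigma_0^-\,\beta^-\,\sigma_0^-\,\beta^+\,\sigma_1^+\,\sigma_0^-\,\cap_1\,\cap_B,$$ $$D'_{10_{42}}=\cup_B\,\cup_1\,\sigma_0^-\,\sigma_0^-\,\beta^+\,\sigma_0^-\,\beta^-\,\sigma_0^-\,\sigma_1^+\,\sigma_0^-\,\cap_1\,\cap_B,$$ $$D_{8_9}=\cup_B\,\cup_1\,\sigma_0^+\,\beta^-\,\sigma_0^+\,\sigma_0^+\,\beta^+\,\sigma_0^+\,\beta^-\,\sigma_0^+\,\cap_1\,\cap_B,$$ and $D'_{8_9}$ is obtained from $D_{8_9}$ by switching all the crossings on $B$. (They represent the knots $10_{42}$, $10_{42}$, $8_9$, $8_9$.) **Statement.** For every $k\geq 1$ the diagrams $\#^kD_{10_{42}}$, $\#^kD'_{10_{42}}$, $\#^kD_{8_9}$ and $\#^kD'_{8_9}$ are symmetric unions, and for every choice of orientations of them: 1. $\#^kD_{10_{42}}$ and $\#^kD'_{10_{42}}$ are Reidemeister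 equivalent but not symmetrically equivalent; 2. $\#^kD_{8_9}$ and $\#^kD'_{8_9}$ are Reidemeister equivalent but not weakly symmetrically equivalent. -/

import Mathlib

/-!
# Link diagrams, symmetric diagrams, and their moves

A diagram in the plane is put in general position with respect to the height function and is
then read from bottom to top.  At a generic height one sees finitely many strands, numbered
`0, 1, 2, …` from left to right.  Between generic heights one of three things happens: a local
minimum is born, a local maximum closes off two neighbouring strands, or two neighbouring strands
cross.  Diagrams up to isotopy of the plane are then words in these letters, up to the elementary
isotopies listed below.

A diagram which is symmetric with respect to the vertical axis `{0} × ℝ` is determined by its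
right half together with the crossings on the axis, and is read in the same way; there the strands
of the right half are numbered `0, 1, 2, …` outwards, starting next to the axis.
-/

namespace SymUnion

/-! ### Link diagrams in the plane -/

/-- The elementary pieces of a diagram, decorated by a direction in `α` (`Bool` for oriented
diagrams, where `true` means "upwards"; `Unit` for unoriented ones).
* `cup i b`: a local minimum; its two legs become the strands `i` and `i + 1`.
* `cap i b`: a local maximum, joining the strands `i` and `i + 1`.
* `cross i o`: the strands `i` and `i + 1` cross; `o = true` iff the strand which goes from the
  lower left to the upper right is the over-strand.
For cups and caps `b` is the direction of the left leg; the right leg has the opposite one. -/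
inductive Letter (α : Type) : Type
  | cup (i : ℕ) (b : α)
  | cap (i : ℕ) (b : α)
  | cross (i : ℕ) (o : Bool)
  deriving DecidableEq

namespace Letter

/-- Change the decorations. -/
def map {α β : Type} (f : α → β) : Letter α → Letter β
  | cup i b => cup i (f b)
  | cap i b => cap i (f b)
  | cross i o => cross i o

/-- The effect of a letter on the list of directions of the strands, from left to right;
`none` if the letter cannot be placed there. -/
def step : Letter Bool → List Bool → Option (List Bool)
  | cup i b, s => if i ≤ s.length then some (s.take i ++ b :: (!b) :: s.drop i) else none
  | cap i b, s =>
    match s.drop i with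
    | x :: y :: t => if x = b ∧ y = !b then some (s.take i ++ t) else none
    | _ => none
  | cross i _, s =>
    match s.drop i with
    | x :: y :: t => some (s.take i ++ y :: x :: t)
    | _ => none

/-- The position of a letter. -/
def pos {α : Type} : Letter α → ℕ
  | cup i _ => i
  | cap i _ => i
  | cross i _ => i

/-- The number of strands which enter a letter from below. -/
def ins {α : Type} : Letter α → ℕ
  | cup _ _ => 0
  | cap _ _ => 2
  | cross _ _ => 2

/-- The number of strands which leave a letter above. -/
def outs {α : Type} : Letter α → ℕ
  | cup _ _ => 2
  | cap _ _ => 0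
  | cross _ _ => 2

/-- Move a letter by `n` positions to the right. -/
def raise {α : Type} (n : ℕ) : Letter α → Letter α
  | cup i b => cup (i + n) b
  | cap i b => cap (i + n) b
  | cross i o => cross (i + n) o

end Letter

/-- Read a word from bottom to top, starting with strands of the given directions. -/
def run : List (Letter Bool) → List Bool → Option (List Bool)
  | [], s => some s
  | l :: w, s => (l.step s).bind (run w)

/-- Oriented link diagrams in the plane: the words which start and end with no strands and whose
directions are coherent. -/
def LinkDiagram : Type := {w : List (Letter Bool) // run w [] = some []}

/-- The elementary isotopies of the plane: the events which a generic isotopy of diagrams meets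
with respect to the height function. -/
inductive Isotopy : List (Letter Bool) → List (Letter Bool) → Prop
  /-- A minimum and a maximum cancel. -/
  | zigzag_right (i : ℕ) (b : Bool) : Isotopy [.cup i b, .cap (i + 1) (!b)] []
  /-- A minimum and a maximum cancel. -/
  | zigzag_left (i : ℕ) (b : Bool) : Isotopy [.cup (i + 1) b, .cap i (!b)] []
  /-- A strand crossing one leg of a minimum is moved to the other leg. -/
  | slide_cup (i : ℕ) (b o : Bool) :
      Isotopy [.cup i b, .cross (i + 1) o] [.cup (i + 1) b, .cross i (!o)]
  /-- A strand crossing one leg of a maximum is moved to the other leg. -/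
  | slide_cap (i : ℕ) (b o : Bool) :
      Isotopy [.cross (i + 1) o, .cap i b] [.cross i (!o), .cap (i + 1) b]
  /-- The heights of two letters, the second of which is to the right of the first,
  are exchanged. -/
  | exchange (l m : Letter Bool) :
      Isotopy [l, m.raise (l.pos + l.outs)] [m.raise (l.pos + l.ins), l]

/-- The local form of the three Reidemeister moves. -/
inductive Reidemeister : List (Letter Bool) → List (Letter Bool) → Prop
  /-- A curl to the right of a strand. -/
  | r1_right (i : ℕ) (b o : Bool) :
      Reidemeister [.cup (i + 1) b, .cross i o, .cap (i + 1) b] []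
  /-- A curl to the left of a strand. -/
  | r1_left (i : ℕ) (b o : Bool) :
      Reidemeister [.cup i b, .cross (i + 1) o, .cap i b] []
  /-- Two crossings of the same two strands, one of which is over at both. -/
  | r2 (i : ℕ) (o : Bool) : Reidemeister [.cross i o, .cross i (!o)] []
  /-- The condition says that the three strands lie at three different levels. -/
  | r3 (i : ℕ) (o₁ o₂ o₃ : Bool) (h : o₂ = o₁ ∨ o₂ = o₃) :
      Reidemeister [.cross i o₁, .cross (i + 1) o₂, .cross i o₃]
        [.cross (i + 1) o₃, .cross i o₂, .cross (i + 1) o₁]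

/-- Two oriented diagrams differ by one elementary isotopy or one Reidemeister move. -/
inductive ReidemeisterMove : LinkDiagram → LinkDiagram → Prop
  | mk (D D' : LinkDiagram) (u v a b : List (Letter Bool)) (h : Isotopy a b ∨ Reidemeister a b)
      (hD : D.1 = u ++ a ++ v) (hD' : D'.1 = u ++ b ++ v) : ReidemeisterMove D D'

/-- Reidemeister equivalence of oriented link diagrams. -/
def ReidemeisterEquivalent : LinkDiagram → LinkDiagram → Prop :=
  Relation.EqvGen ReidemeisterMove

/-! ### Symmetric diagrams -/

/-- The elementary pieces of a symmetric diagram, seen in the right half plane.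
* `axisCup b`: a strand crosses the axis perpendicularly and has a minimum there; its right leg
  has direction `b` and becomes strand `0`.
* `axisCap b`: a strand crosses the axis perpendicularly and has a maximum there; its right leg is
  strand `0`, with direction `b`.
* `axisCross o`: strand `0` crosses its mirror image on the axis; `o = true` iff the strand which
  goes from the lower left to the upper right is the over-strand.
* `off l`: the piece `l` in the right half plane, together with its mirror image. -/
inductive SymLetter (α : Type) : Type
  | axisCup (b : α)
  | axisCap (b : α)
  | axisCross (o : Bool)
  | off (l : Letter α)
  deriving DecidableEq

namespace SymLetter

/-- Change the decorations. -/
def map {α β : Type} (f : α → β) : SymLetter α → SymLetter β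
  | axisCup b => axisCup (f b)
  | axisCap b => axisCap (f b)
  | axisCross o => axisCross o
  | off l => off (l.map f)

/-- The effect of a letter on the list of directions of the strands in the right half plane.
In an oriented symmetric diagram `D` the reflection takes `D` to its reverse (with the crossings
on the axis switched), so that the mirror image of an upward strand is a downward one; hence the
strand `0` and its mirror image have opposite directions, and an axis crossing reverses the
direction of strand `0`. -/
def step : SymLetter Bool → List Bool → Option (List Bool)
  | axisCup b, s => some (b :: s)
  | axisCap b, s =>
    match s with
    | x :: t => if x = b then some t else none
    | [] => none
  | axisCross _, s =>
    match s with
    | x :: t => some ((!x) :: t)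
    | [] => none
  | off l, s => l.step s

/-- Rotation of a letter by the angle `π` in the plane: the left half of a symmetric diagram
becomes its right half, upside down. -/
def turn {α : Type} : SymLetter α → SymLetter α
  | axisCup b => axisCap b
  | axisCap b => axisCup b
  | axisCross o => axisCross o
  | off (.cup i b) => off (.cap i b)
  | off (.cap i b) => off (.cup i b)
  | off (.cross i o) => off (.cross i (!o))

/-- The letters of the full diagram which make up a letter of the right half. Here `n` is the
number of strands of the right half below the letter; in the full diagram the strand `j` of the
right half is number `n + j` and its mirror image is number `n - 1 - j`. The mirror image has the
opposite direction. Off the axis reflection keeps the over-strand over, which exchanges the two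
values of `o`. -/
def unfold (n : ℕ) : SymLetter Bool → List (Letter Bool)
  | axisCup b => [.cup n (!b)]
  | axisCap b => [.cap (n - 1) (!b)]
  | axisCross o => [.cross (n - 1) o]
  | off (.cup i b) => [.cup (n + i) b, .cup (n - i) b]
  | off (.cap i b) => [.cap (n + i) b, .cap (n - 2 - i) b]
  | off (.cross i o) => [.cross (n + i) o, .cross (n - 2 - i) (!o)]

/-- The number of strands of the right half above a letter, if there are `n` below. -/
def count {α : Type} (n : ℕ) : SymLetter α → ℕ
  | axisCup _ => n + 1
  | axisCap _ => n - 1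
  | axisCross _ => n
  | off (.cup _ _) => n + 2
  | off (.cap _ _) => n - 2
  | off (.cross _ _) => n

end SymLetter

/-- Read the right half of a symmetric diagram from bottom to top. -/
def symRun : List (SymLetter Bool) → List Bool → Option (List Bool)
  | [], s => some s
  | l :: w, s => (l.step s).bind (symRun w)

/-- Oriented symmetric link diagrams. -/
def SymDiagram : Type := {w : List (SymLetter Bool) // symRun w [] = some []}

/-- The full diagram of a word in the right half plane, starting with `n` strands there. -/
def unfoldWord : ℕ → List (SymLetter Bool) → List (Letter Bool)
  | _, [] => []
  | n, l :: w => l.unfold n ++ unfoldWord (l.count n) w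

/-- The directions of all strands, given those in the right half plane. -/
def mirrorDouble (s : List Bool) : List Bool := (s.map (!·)).reverse ++ s

theorem Letter.step_cup (l r : List Bool) (b : Bool) (n : ℕ) (h : n = l.length) :
    (Letter.cup n b).step (l ++ r) = some (l ++ b :: (!b) :: r) := by
  subst h; simp [Letter.step]

theorem Letter.step_cap (l r : List Bool) (b : Bool) (n : ℕ) (h : n = l.length) :
    (Letter.cap n b).step (l ++ b :: (!b) :: r) = some (l ++ r) := by
  subst h; simp [Letter.step]

theorem Letter.step_cross (l r : List Bool) (x y o : Bool) (n : ℕ) (h : n = l.length) :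
    (Letter.cross n o).step (l ++ x :: y :: r) = some (l ++ y :: x :: r) := by
  subst h; simp [Letter.step]

theorem Letter.of_step_cap (i : ℕ) (b : Bool) (s t : List Bool)
    (h : (Letter.cap i b).step s = some t) :
    ∃ p q, s = p ++ b :: (!b) :: q ∧ i = p.length ∧ t = p ++ q := by
  simp only [Letter.step] at h
  split at h
  · rename_i x y r hr
    split_ifs at h with hc
    obtain ⟨rfl, rfl⟩ := hc
    simp only [Option.some.injEq] at h
    refine ⟨s.take i, r, by rw [← hr, List.take_append_drop], ?_, h.symm⟩
    have := congrArg List.length hr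
    simp at this ⊢
    omega
  · simp at h

theorem Letter.of_step_cross (i : ℕ) (o : Bool) (s t : List Bool)
    (h : (Letter.cross i o).step s = some t) :
    ∃ p q x y, s = p ++ x :: y :: q ∧ i = p.length ∧ t = p ++ y :: x :: q := by
  simp only [Letter.step] at h
  split at h
  · rename_i x y r hr
    simp only [Option.some.injEq] at h
    refine ⟨s.take i, r, x, y, by rw [← hr, List.take_append_drop], ?_, h.symm⟩
    have := congrArg List.length hr
    simp at this ⊢
    omega
  · simp at h

theorem run_append (u v : List (Letter Bool)) (s : List Bool) :
    run (u ++ v) s = (run u s).bind (run v) := by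
  induction u generalizing s with
  | nil => simp [run]
  | cons l u ih =>
    simp only [List.cons_append, run]
    cases l.step s with
    | none => rfl
    | some t => exact ih t

theorem SymLetter.run_unfold (l : SymLetter Bool) (s t : List Bool) (h : l.step s = some t) :
    run (l.unfold s.length) (mirrorDouble s) = some (mirrorDouble t) ∧
      t.length = l.count s.length := by
  rcases l with b | b | o | ⟨i, b⟩ | ⟨i, b⟩ | ⟨i, o⟩
  · simp only [SymLetter.step, Option.some.injEq] at h
    subst h
    refine ⟨?_, by simp [SymLetter.count]⟩
    have := Letter.step_cup (s.map (!·)).reverse s (!b) s.length (by simp)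
    simp [SymLetter.unfold, run, mirrorDouble, this]
  · rcases s with _ | ⟨x, s⟩
    · simp [SymLetter.step] at h
    · simp only [SymLetter.step] at h
      split_ifs at h with hx
      simp only [Option.some.injEq] at h
      subst h hx
      refine ⟨?_, by simp [SymLetter.count]⟩
      have := Letter.step_cap (s.map (!·)).reverse s (!x) s.length (by simp)
      simp only [Bool.not_not] at this
      simp [SymLetter.unfold, run, mirrorDouble, this]
  · rcases s with _ | ⟨x, s⟩
    · simp [SymLetter.step] at h
    · simp only [SymLetter.step, Option.some.injEq] at h
      subst h
      refine ⟨?_, by simp [SymLetter.count]⟩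
      have := Letter.step_cross (s.map (!·)).reverse s (!x) x o s.length (by simp)
      simp [SymLetter.unfold, run, mirrorDouble, this]
  · simp only [SymLetter.step, Letter.step] at h
    split_ifs at h with hi
    obtain ⟨p, q, rfl, rfl⟩ : ∃ p q, s = p ++ q ∧ i = p.length :=
      ⟨s.take i, s.drop i, by simp, by simp [hi]⟩
    simp only [List.take_left', List.drop_left', Option.some.injEq] at h
    subst h
    refine ⟨?_, by simp [SymLetter.count]; omega⟩
    have h1 := Letter.step_cup (((p ++ q).map (!·)).reverse ++ p) q b
      ((p ++ q).length + p.length) (by simp; omega)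
    have h2 := Letter.step_cup (q.map (!·)).reverse
      ((p.map (!·)).reverse ++ p ++ b :: (!b) :: q) b ((p ++ q).length - p.length) (by simp)
    simp only [List.append_assoc, List.map_append, List.reverse_append] at h1 h2
    simp [SymLetter.unfold, run, mirrorDouble] at h1 h2 ⊢
    simp [h1, h2]
  · obtain ⟨p, q, rfl, rfl, rfl⟩ := Letter.of_step_cap i b s t h
    refine ⟨?_, by simp [SymLetter.count]; omega⟩
    have h1 := Letter.step_cap (((p ++ b :: (!b) :: q).map (!·)).reverse ++ p) q b
      ((p ++ b :: (!b) :: q).length + p.length) (by simp; omega)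
    have h2 := Letter.step_cap (q.map (!·)).reverse
      ((p.map (!·)).reverse ++ p ++ q) b ((p ++ b :: (!b) :: q).length - 2 - p.length)
      (by simp; omega)
    simp only [List.append_assoc, List.map_append, List.reverse_append] at h1 h2
    simp [SymLetter.unfold, run, mirrorDouble] at h1 h2 ⊢
    simp [h1, h2]
  · obtain ⟨p, q, x, y, rfl, rfl, rfl⟩ := Letter.of_step_cross i o s t h
    refine ⟨?_, by simp [SymLetter.count]⟩
    have h1 := Letter.step_cross (((p ++ x :: y :: q).map (!·)).reverse ++ p) q x y o
      ((p ++ x :: y :: q).length + p.length) (by simp; omega)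
    have h2 := Letter.step_cross (q.map (!·)).reverse
      ((p.map (!·)).reverse ++ p ++ y :: x :: q) (!y) (!x) (!o)
      ((p ++ x :: y :: q).length - 2 - p.length) (by simp; omega)
    simp only [List.append_assoc, List.map_append, List.reverse_append] at h1 h2
    simp [SymLetter.unfold, run, mirrorDouble] at h1 h2 ⊢
    simp [h1, h2]

theorem run_unfoldWord (w : List (SymLetter Bool)) (s t : List Bool) (h : symRun w s = some t) :
    run (unfoldWord s.length w) (mirrorDouble s) = some (mirrorDouble t) := by
  induction w generalizing s with
  | nil =>
    simp only [symRun, Option.some.injEq] at h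
    simp [unfoldWord, run, h]
  | cons l w ih =>
    simp only [symRun, Option.bind_eq_some_iff] at h
    obtain ⟨r, hr, hw⟩ := h
    obtain ⟨h1, h2⟩ := l.run_unfold s r hr
    rw [unfoldWord, run_append, h1, ← h2]
    exact ih r hw

/-- The full oriented diagram of an oriented symmetric diagram. -/
def SymDiagram.unfold (D : SymDiagram) : LinkDiagram :=
  ⟨unfoldWord 0 D.1, run_unfoldWord D.1 [] [] D.2⟩

/-! ### Moves of symmetric diagrams -/

/-- The elementary isotopies of symmetric diagrams in which the axis takes part. -/
inductive AxisIsotopy : List (SymLetter Bool) → List (SymLetter Bool) → Prop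
  /-- A strand meets the axis in a minimum, and its right leg turns down; equivalently it meets
  the axis in a maximum. -/
  | turn_down (b : Bool) : AxisIsotopy [.axisCup b, .off (.cap 0 b)] [.axisCap (!b)]
  /-- A strand meets the axis in a maximum, and its right leg turns up; equivalently it meets
  the axis in a minimum. -/
  | turn_up (b : Bool) : AxisIsotopy [.off (.cup 0 b), .axisCap b] [.axisCup (!b)]
  | exchange_axisCup (b : Bool) (l : Letter Bool) :
      AxisIsotopy [.axisCup b, .off (l.raise 1)] [.off l, .axisCup b]
  | exchange_axisCap (b : Bool) (l : Letter Bool) :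
      AxisIsotopy [.axisCap b, .off l] [.off (l.raise 1), .axisCap b]
  | exchange_axisCross (o : Bool) (l : Letter Bool) :
      AxisIsotopy [.axisCross o, .off (l.raise 1)] [.off (l.raise 1), .axisCross o]

/-- The symmetric Reidemeister moves on the axis. -/
inductive AxisReidemeister : List (SymLetter Bool) → List (SymLetter Bool) → Prop
  /-- `S2(h)`: two strands crossing the axis perpendicularly at consecutive points are pulled
  across each other, creating two mirror-symmetric crossings off the axis. -/
  | s2h (b c o : Bool) :
      AxisReidemeister [.axisCup b, .off (.cross 0 o), .axisCap c] [.axisCap c, .axisCup b]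
  /-- `S2(±)`: the strands at a crossing on the axis are twisted around each other on both sides
  of the axis, mirror-symmetrically; the crossing on the axis keeps its type. -/
  | s2 (b c o p : Bool) :
      AxisReidemeister [.off (.cup 0 b), .off (.cross 1 o), .axisCross p, .off (.cap 0 c)]
        [.axisCross p]
  /-- `S3(o±)`, `S3(u±)`: a strand crossing the axis perpendicularly passes over or under a
  crossing on the axis. -/
  | s3 (b o p : Bool) :
      AxisReidemeister [.axisCross p, .axisCup b, .off (.cross 0 o)]
        [.axisCup b, .off (.cross 0 o), .axisCross p]
  /-- `S4(±±)`: two consecutive crossings on the axis, of types `p` and `q`, change places, the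
  strands of one passing over those of the other. -/
  | s4 (b c o p q : Bool) :
      AxisReidemeister [.axisCross p, .off (.cap 0 c), .off (.cup 0 b), .axisCross q]
        [.off (.cup 0 b), .axisCross q, .off (.cross 1 o), .off (.cross 2 o), .off (.cross 0 o),
          .off (.cross 1 o), .axisCross p, .off (.cap 0 c)]

/-- The symmetric Reidemeister moves (and elementary isotopies) in local form: those off the axis,
carried out together with their mirror images, and those on the axis. -/
inductive SRMove : List (SymLetter Bool) → List (SymLetter Bool) → Prop
  | off_axis (a b : List (Letter Bool)) (h : Isotopy a b ∨ Reidemeister a b) :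
      SRMove (a.map .off) (b.map .off)
  | on_axis (a b : List (SymLetter Bool)) (h : AxisIsotopy a b ∨ AxisReidemeister a b) :
      SRMove a b

/-- `S1(±)`: a curl with its crossing on the axis is removed. -/
inductive S1Move : List (SymLetter Bool) → List (SymLetter Bool) → Prop
  | below (b p : Bool) : S1Move [.axisCup b, .axisCross p] [.axisCup (!b)]
  | above (b p : Bool) : S1Move [.axisCross p, .axisCap b] [.axisCap (!b)]

/-- `S2(v)`: two consecutive opposite crossings of two strands on the axis are removed. -/
inductive S2vMove : List (SymLetter Bool) → List (SymLetter Bool) → Prop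
  | mk (p : Bool) : S2vMove [.axisCross p, .axisCross (!p)] []

/-- Two oriented symmetric diagrams differ by one of the local moves `M`, or are carried into each
other by the rotation of the plane by `π` (symmetric diagrams are considered up to orientation
preserving diffeomorphisms of the plane which commute with the reflection, and up to isotopy this
rotation is the only one besides the identity). -/
inductive SymMove (M : List (SymLetter Bool) → List (SymLetter Bool) → Prop) :
    SymDiagram → SymDiagram → Prop
  | move (D D' : SymDiagram) (u v a b : List (SymLetter Bool)) (h : M a b)
      (hD : D.1 = u ++ a ++ v) (hD' : D'.1 = u ++ b ++ v) : SymMove M D D'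
  | rotate (D D' : SymDiagram) (h : D'.1 = (D.1.map SymLetter.turn).reverse) : SymMove M D D'

/-- Symmetric equivalence: symmetric Reidemeister moves and `S1`. -/
def SymmetricallyEquivalent : SymDiagram → SymDiagram → Prop :=
  Relation.EqvGen (SymMove fun a b => SRMove a b ∨ S1Move a b)

/-- Weak symmetric equivalence: symmetric Reidemeister moves, `S1` and `S2(v)`. -/
def WeaklySymmetricallyEquivalent : SymDiagram → SymDiagram → Prop :=
  Relation.EqvGen (SymMove fun a b => SRMove a b ∨ S1Move a b ∨ S2vMove a b)

/-! ### Unoriented symmetric diagrams, symmetric unions, connected sums -/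

/-- The underlying unoriented diagram. -/
def LinkDiagram.forget (D : LinkDiagram) : List (Letter Unit) :=
  D.1.map (Letter.map fun _ => ())

/-- The underlying unoriented symmetric diagram. -/
def SymDiagram.forget (D : SymDiagram) : List (SymLetter Unit) :=
  D.1.map (SymLetter.map fun _ => ())

/-- `S` is a symmetric union: the reflection maps each component to itself and reverses its
orientation. (This means that `S` is a diagram, and that every orientation of its components makes
it an oriented symmetric diagram.) -/
def IsSymmetricUnion (S : List (SymLetter Unit)) : Prop :=
  (∃ D : SymDiagram, D.forget = S) ∧
    ∀ D : SymDiagram, D.forget = S → ∀ E : LinkDiagram, E.forget = D.unfold.forget →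
      ∃ D' : SymDiagram, D'.forget = S ∧ D'.unfold = E

/-- Switch all the crossings on the axis. -/
def switchAxis : List (SymLetter Unit) → List (SymLetter Unit) :=
  List.map fun l => match l with
    | .axisCross o => .axisCross (!o)
    | l => l

/-- The connected sum `S # S'`, for diagrams which begin with `axisCup` and end with `axisCap`:
`S` is put above `S'`, and the lowest strand of `S` is joined symmetrically to the highest
strand of `S'`. -/
def connectedSum (S S' : List (SymLetter Unit)) : List (SymLetter Unit) :=
  S'.dropLast ++ S.tail

/-- The connected sum of `k` copies of `S`; for `k = 0` a circle. -/
def connectedSumPow (S : List (SymLetter Unit)) : ℕ → List (SymLetter Unit)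
  | 0 => [.axisCup (), .axisCap ()]
  | k + 1 => connectedSum S (connectedSumPow S k)

/-! ### The diagrams -/

open SymLetter Letter in
/-- The symmetric union diagram of `8_9` with three crossings on the axis. The letters between
`cup 1` and `cap 1` are the crossings of the picture, from bottom to top; `cup 1` and `cap 1` belong
to the large outer arc on the right. -/
def D89 : List (SymLetter Unit) :=
  [axisCup (), off (cup 1 ()),
    off (cross 0 true), axisCross false, off (cross 0 true), off (cross 0 true), axisCross true,
    off (cross 0 true), axisCross false, off (cross 0 true),
    off (cap 1 ()), axisCap ()]

/-- The second symmetric union diagram of `8_9`: the crossings on the axis are switched. -/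
def D89' : List (SymLetter Unit) := switchAxis D89

open SymLetter Letter in
/-- The symmetric union diagram of `10_42` with four crossings on the axis. -/
def D1042 : List (SymLetter Unit) :=
  [axisCup (), off (cup 1 ()),
    off (cross 0 false), axisCross false, off (cross 0 false), axisCross true,
    off (cross 0 false), axisCross false, off (cross 0 false), axisCross true,
    off (cross 1 true), off (cross 0 false),
    off (cap 1 ()), axisCap ()]

open SymLetter Letter in
/-- The symmetric union diagram of `10_42` with two crossings on the axis. -/
def D1042' : List (SymLetter Unit) :=
  [axisCup (), off (cup 1 ()),
    off (cross 0 false), off (cross 0 false), axisCross true, off (cross 0 false),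
    axisCross false, off (cross 0 false), off (cross 1 true), off (cross 0 false),
    off (cap 1 ()), axisCap ()]

end SymUnion

open SymUnion

/-! The two assertions about each pair are independent: an invariant separates the symmetric
diagrams, and an induction over the summands makes the full diagrams Reidemeister equivalent.

The invariant. Replace every crossing on the axis by two vertical strands and take the Fox colorings
of the right half for which each strand meeting the axis in an extremum has color `0`. A crossing on
the axis has a weight depending on its type, which counts only if its strand has a nonzero color.
The set of total weights of all colorings is unchanged by symmetric Reidemeister moves and `S1`
(`SymmetricallyEquivalent.colors_iff`), and also by `S2(v)` if the two types have opposite weights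
(`WeaklySymmetricallyEquivalent.colors_iff`). For `10_42` the ring is `ZMod 3` and only the
crossings of type `false` count: in a coloring with parameter `x` they have colors `x`, `3 * x` in
one diagram and only `3 * x` in the other. For `8_9` the ring is `ZMod 5` and the weights are `1`,
`-1`: a nonzero coloring has total weight `-1` for one diagram and `1` for the other. The strands
joining the summands have color `0`, so the weights of summands add up, and for all `k ≥ 1` the
weight `1` occurs on one side only.

The Reidemeister equivalence. A strand which is over, or under, everything can be carried across any
word (`UEq.sweep_word`). Hence a knot tied into a strand slides along it through crossings and
extrema (`KnotRule`). In a sum, the upper summands are a knot tied into the top of the lowest one;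
sliding them to the bottom leaves the lowest summand closed up, where it can be replaced. This
reduces everything to a single summand (`uEq_stack`). The closed summands are brought to plats with
four strands, which are compared by flypes (`IsPlat.flype`) and by moving a plat across its lower
end (`uEq_endpass`). The explicit sequences of moves are scripts, checked by evaluation
(`uEq_of_confluent`).

Orientations. The moves above are unoriented, but each of them transports coherent orientations
(`UEq.exists_lift`). A summand has only one orientation once its bottom strand is oriented
(`IsArc`); this gives the symmetric unions and leaves two orientations of each sum. These are
exchanged because the sums are reversible: a crossing of the two bottom ends can be absorbed. -/

namespace SymUnion

/-! ### Unoriented words -/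

variable {α β : Type}

/-- The number of strands above a letter, if there are `n` below and the letter fits. -/
def Letter.strands (l : Letter α) (n : ℕ) : Option ℕ :=
  if l.pos + l.ins ≤ n then some (n - l.ins + l.outs) else none

/-- The number of strands above a word, if there are `n` below and the word fits. -/
def strands : List (Letter α) → ℕ → Option ℕ
  | [], n => some n
  | l :: w, n => (l.strands n).bind (strands w)

theorem strands_append (u v : List (Letter α)) (n : ℕ) :
    strands (u ++ v) n = (strands u n).bind (strands v) := by
  induction u generalizing n with
  | nil => simp [strands]
  | cons l u ih =>
    simp only [List.cons_append, strands]
    cases l.strands n with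
    | none => rfl
    | some m => exact ih m

/-- The elementary isotopies (except for exchanges) and Reidemeister moves of unoriented words, at
the strand `0`. -/
inductive BaseMove : List (Letter Unit) → List (Letter Unit) → Prop
  | zigzag_right : BaseMove [.cup 0 (), .cap 1 ()] []
  | zigzag_left : BaseMove [.cup 1 (), .cap 0 ()] []
  | slide_cup (o : Bool) : BaseMove [.cup 0 (), .cross 1 o] [.cup 1 (), .cross 0 (!o)]
  | slide_cap (o : Bool) : BaseMove [.cross 1 o, .cap 0 ()] [.cross 0 (!o), .cap 1 ()]
  | r1_right (o : Bool) : BaseMove [.cup 1 (), .cross 0 o, .cap 1 ()] []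
  | r1_left (o : Bool) : BaseMove [.cup 0 (), .cross 1 o, .cap 0 ()] []
  | r2 (o : Bool) : BaseMove [.cross 0 o, .cross 0 (!o)] []
  | r3 (o₁ o₂ o₃ : Bool) (h : o₂ = o₁ ∨ o₂ = o₃) :
      BaseMove [.cross 0 o₁, .cross 1 o₂, .cross 0 o₃] [.cross 1 o₃, .cross 0 o₂, .cross 1 o₁]

/-- The elementary isotopies and Reidemeister moves of unoriented words. -/
inductive PlainMove : List (Letter Unit) → List (Letter Unit) → Prop
  | base (i : ℕ) (a b : List (Letter Unit)) (h : BaseMove a b) :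
      PlainMove (a.map (Letter.raise i)) (b.map (Letter.raise i))
  | exchange (l m : Letter Unit) :
      PlainMove [l, m.raise (l.pos + l.outs)] [m.raise (l.pos + l.ins), l]

theorem Letter.map_raise (f : α → β) (n : ℕ) (l : Letter α) :
    (l.raise n).map f = (l.map f).raise n := by cases l <;> rfl

@[simp] theorem Letter.pos_map (f : α → β) (l : Letter α) : (l.map f).pos = l.pos := by
  cases l <;> rfl

@[simp] theorem Letter.ins_map (f : α → β) (l : Letter α) : (l.map f).ins = l.ins := by
  cases l <;> rfl

@[simp] theorem Letter.outs_map (f : α → β) (l : Letter α) : (l.map f).outs = l.outs := by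
  cases l <;> rfl

@[simp] theorem Letter.pos_raise (l : Letter α) (n : ℕ) : (l.raise n).pos = l.pos + n := by
  cases l <;> rfl

@[simp] theorem Letter.ins_raise (l : Letter α) (n : ℕ) : (l.raise n).ins = l.ins := by
  cases l <;> rfl

@[simp] theorem Letter.outs_raise (l : Letter α) (n : ℕ) : (l.raise n).outs = l.outs := by
  cases l <;> rfl

@[simp] theorem Letter.strands_map (f : α → β) (l : Letter α) :
    (l.map f).strands = l.strands := by
  funext n; simp [Letter.strands]

@[simp] theorem strands_map (f : α → β) (w : List (Letter α)) :
    strands (w.map (Letter.map f)) = strands w := by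
  induction w with
  | nil => rfl
  | cons l w ih => funext n; simp [strands, ih]

/-- Forget the decorations of a word. -/
abbrev plain (w : List (Letter α)) : List (Letter Unit) := w.map (Letter.map fun _ => ())

theorem PlainMove.of_isotopy {a b : List (Letter Bool)} (h : Isotopy a b) :
    PlainMove (plain a) (plain b) := by
  cases h with
  | zigzag_right i b => simpa [Letter.raise, Letter.map, add_comm] using PlainMove.base i _ _ .zigzag_right
  | zigzag_left i b => simpa [Letter.raise, Letter.map, add_comm] using PlainMove.base i _ _ .zigzag_left
  | slide_cup i b o => simpa [Letter.raise, Letter.map, add_comm] using PlainMove.base i _ _ (.slide_cup o)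
  | slide_cap i b o => simpa [Letter.raise, Letter.map, add_comm] using PlainMove.base i _ _ (.slide_cap o)
  | exchange l m =>
    have := PlainMove.exchange (l.map fun _ => ()) (m.map fun _ => ())
    simpa [Letter.map_raise] using this

theorem PlainMove.of_reidemeister {a b : List (Letter Bool)} (h : Reidemeister a b) :
    PlainMove (plain a) (plain b) := by
  cases h with
  | r1_right i b o => simpa [Letter.raise, Letter.map, add_comm] using PlainMove.base i _ _ (.r1_right o)
  | r1_left i b o => simpa [Letter.raise, Letter.map, add_comm] using PlainMove.base i _ _ (.r1_left o)
  | r2 i o => simpa [Letter.raise, Letter.map, add_comm] using PlainMove.base i _ _ (.r2 o)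
  | r3 i o₁ o₂ o₃ h =>
    simpa [Letter.raise, Letter.map, add_comm] using PlainMove.base i _ _ (.r3 o₁ o₂ o₃ h)

theorem Letter.length_of_step {l : Letter Bool} {s t : List Bool} (h : l.step s = some t) :
    l.strands s.length = some t.length := by
  cases l with
  | cup i b =>
    simp only [Letter.step] at h
    split_ifs at h with hi
    simp only [Option.some.injEq] at h
    subst h
    simp [Letter.strands, Letter.pos, Letter.ins, Letter.outs, hi]
    omega
  | cap i b =>
    obtain ⟨p, q, rfl, rfl, rfl⟩ := Letter.of_step_cap i b s t h
    simp [Letter.strands, Letter.pos, Letter.ins, Letter.outs]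
    omega
  | cross i o =>
    obtain ⟨p, q, x, y, rfl, rfl, rfl⟩ := Letter.of_step_cross i o s t h
    simp [Letter.strands, Letter.pos, Letter.ins, Letter.outs]
    omega

theorem length_of_run {w : List (Letter Bool)} {s t : List Bool} (h : run w s = some t) :
    strands w s.length = some t.length := by
  induction w generalizing s with
  | nil => simp only [run, Option.some.injEq] at h; simp [strands, h]
  | cons l w ih =>
    simp only [run, Option.bind_eq_some_iff] at h
    obtain ⟨r, hr, hw⟩ := h
    simp [strands, Letter.length_of_step hr, ih hw]

/-! ### Colorings -/

variable {R : Type} [CommRing R]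

/-- The relation between the colors of the strands below and above a letter, near the letter: an
under-strand `y` which passes below `x` becomes `2 * x - y`. -/
inductive Letter.LocalColors : Letter α → List R → List R → Prop
  | cup (i : ℕ) (b : α) (c : R) (s : List R) : LocalColors (.cup i b) s (c :: c :: s)
  | cap (i : ℕ) (b : α) (c : R) (s : List R) : LocalColors (.cap i b) (c :: c :: s) s
  | cross_over (i : ℕ) (x y : R) (s : List R) :
      LocalColors (.cross i true) (x :: y :: s) ((2 * x - y) :: x :: s)
  | cross_under (i : ℕ) (x y : R) (s : List R) :
      LocalColors (.cross i false) (x :: y :: s) (y :: (2 * y - x) :: s)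

/-- The relation between the colors of the strands below and above a letter. -/
def Letter.Colors (l : Letter α) (s t : List R) : Prop :=
  ∃ p s' t', p.length = l.pos ∧ s = p ++ s' ∧ t = p ++ t' ∧ l.LocalColors s' t'

/-- The relation between the colors of the strands below and above a word. -/
def Colors : List (Letter α) → List R → List R → Prop
  | [], s, t => s = t
  | l :: w, s, t => ∃ r, l.Colors s r ∧ Colors w r t

theorem Letter.localColors_raise (n : ℕ) (l : Letter α) (s t : List R) :
    (l.raise n).LocalColors s t ↔ l.LocalColors s t := by
  constructor
  · intro h; cases l <;> cases h <;> constructor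
  · intro h; cases h <;> constructor

theorem Letter.localColors_map (f : α → β) (l : Letter α) (s t : List R) :
    (l.map f).LocalColors s t ↔ l.LocalColors s t := by
  constructor
  · intro h; cases l <;> cases h <;> constructor
  · intro h; cases h <;> constructor

theorem Letter.colors_map (f : α → β) (l : Letter α) (s t : List R) :
    (l.map f).Colors s t ↔ l.Colors s t := by
  simp [Letter.Colors, Letter.localColors_map]

theorem colors_map (f : α → β) (w : List (Letter α)) (s t : List R) :
    Colors (w.map (Letter.map f)) s t ↔ Colors w s t := by
  induction w generalizing s with
  | nil => rfl
  | cons l w ih => simp [Colors, Letter.colors_map, ih]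

theorem Letter.length_of_localColors {l : Letter α} {s t : List R} (h : l.LocalColors s t) :
    l.ins ≤ s.length ∧ t.length = s.length - l.ins + l.outs := by
  cases h <;> simp [Letter.ins, Letter.outs]

theorem Letter.length_of_colors {l : Letter α} {s t : List R} (h : l.Colors s t) :
    l.strands s.length = some t.length := by
  obtain ⟨p, s, t, hp, rfl, rfl, h⟩ := h
  have := l.length_of_localColors h
  simp [Letter.strands]
  omega

theorem Letter.colors_raise (l : Letter α) (p s t : List R) :
    (l.raise p.length).Colors (p ++ s) t ↔ ∃ t', t = p ++ t' ∧ l.Colors s t' := by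
  simp only [Letter.Colors, Letter.localColors_raise, Letter.pos_raise]
  constructor
  · rintro ⟨q, s', t', hq, h1, rfl, h⟩
    -- The untouched prefix `q` has length at least `p.length`, because the letter was raised by
    -- that amount; hence it extends `p`.
    obtain ⟨q', rfl⟩ : ∃ q', q = p ++ q' := by
      rw [List.append_eq_append_iff] at h1
      rcases h1 with ⟨a, rfl, _⟩ | ⟨a, rfl, rfl⟩
      · exact ⟨a, rfl⟩
      · simp at hq
        have : a = [] := by
          cases a
          · rfl
          · simp at hq; omega
        subst this
        exact ⟨[], by simp⟩
    rw [List.append_assoc, List.append_cancel_left_eq] at h1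
    exact ⟨q' ++ t', by simp, q', s', t', by simpa [add_comm] using hq, h1, rfl, h⟩
  · rintro ⟨_, rfl, q, s', t', hq, rfl, rfl, h⟩
    exact ⟨p ++ q, s', t', by simp [hq, add_comm], by simp, by simp, h⟩

theorem colors_raise (w : List (Letter α)) (p s t : List R) :
    Colors (w.map (Letter.raise p.length)) (p ++ s) t ↔ ∃ t', t = p ++ t' ∧ Colors w s t' := by
  induction w generalizing s with
  | nil => simp [Colors, eq_comm]
  | cons l w ih =>
    simp only [List.map_cons, Colors, Letter.colors_raise]
    constructor
    · rintro ⟨_, ⟨r, rfl, hr⟩, h⟩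
      obtain ⟨t', ht, h⟩ := (ih r).1 h
      exact ⟨t', ht, r, hr, h⟩
    · rintro ⟨t', rfl, r, hr, h⟩
      exact ⟨p ++ r, ⟨r, rfl, hr⟩, (ih r).2 ⟨t', rfl, h⟩⟩

/-- A letter does not see the strands to its right. -/
theorem Letter.colors_append_right (l : Letter α) (p s t : List R)
    (hp : p.length = l.pos + l.ins) :
    l.Colors (p ++ s) t ↔ ∃ p', p'.length = l.pos + l.outs ∧ t = p' ++ s ∧ l.Colors p p' := by
  constructor
  · rintro ⟨q, s', t', hq, h1, rfl, h⟩
    obtain ⟨p', rfl⟩ : ∃ p', p = q ++ p' := by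
      rw [List.append_eq_append_iff] at h1
      rcases h1 with ⟨a, rfl, rfl⟩ | ⟨a, rfl, _⟩
      · have : a = [] := by
          cases a
          · rfl
          · simp at hq; omega
        subst this
        exact ⟨[], by simp⟩
      · exact ⟨a, rfl⟩
    rw [List.append_assoc, List.append_cancel_left_eq] at h1
    rw [← h1] at h
    simp [hq] at hp
    generalize hu : p' ++ s = u at h
    cases h with
    | cup i b c =>
      obtain rfl : p' = [] := by simpa [Letter.ins] using hp
      obtain rfl : s = u := hu
      exact ⟨q ++ [c, c], by simp [hq, Letter.outs], by simp, q, [], _, hq, by simp, rfl, by constructor⟩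
    | cap i b c r =>
      match p', hp, hu with
      | [x, y], _, hu =>
        simp at hu
        obtain ⟨rfl, rfl, rfl⟩ := hu
        exact ⟨q, by simp [hq, Letter.outs], by simp, q, [y, y], [], hq, by simp, by simp, by constructor⟩
    | cross_over i x y r =>
      match p', hp, hu with
      | [x', y'], _, hu =>
        simp at hu
        obtain ⟨rfl, rfl, rfl⟩ := hu
        exact ⟨q ++ [2 * x' - y', x'], by simp [hq, Letter.outs], by simp, q, [x', y'], _, hq, by simp,
          rfl, by constructor⟩
    | cross_under i x y r =>
      match p', hp, hu with
      | [x', y'], _, hu =>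
        simp at hu
        obtain ⟨rfl, rfl, rfl⟩ := hu
        exact ⟨q ++ [y', 2 * y' - x'], by simp [hq, Letter.outs], by simp, q, [x', y'], _, hq, by simp,
          rfl, by constructor⟩
  · rintro ⟨_, _, rfl, q, s', t', hq, rfl, rfl, h⟩
    refine ⟨q, s' ++ s, t' ++ s, hq, by simp, by simp, ?_⟩
    cases h <;> constructor

@[simp] theorem Letter.colors_cup_zero (b : α) (s t : List R) :
    (Letter.cup 0 b).Colors s t ↔ ∃ c, t = c :: c :: s := by
  constructor
  · rintro ⟨p, s', t', hp, rfl, rfl, h⟩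
    obtain rfl : p = [] := by simpa [Letter.pos] using hp
    cases h with
    | cup i b c => exact ⟨c, rfl⟩
  · rintro ⟨c, rfl⟩
    exact ⟨[], _, _, rfl, rfl, rfl, by constructor⟩

@[simp] theorem Letter.colors_cap_zero (b : α) (s t : List R) :
    (Letter.cap 0 b).Colors s t ↔ ∃ c, s = c :: c :: t := by
  constructor
  · rintro ⟨p, s', t', hp, rfl, rfl, h⟩
    obtain rfl : p = [] := by simpa [Letter.pos] using hp
    cases h with
    | cap i b c => exact ⟨c, rfl⟩
  · rintro ⟨c, rfl⟩
    exact ⟨[], _, _, rfl, rfl, rfl, by constructor⟩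

/-- The colors above a crossing of two strands with the given colors. -/
def crossColors (o : Bool) (x y : R) : R × R := if o then (2 * x - y, x) else (y, 2 * y - x)

@[simp] theorem Letter.colors_cross_zero (o : Bool) (s t : List R) :
    (Letter.cross 0 o : Letter α).Colors s t ↔ ∃ x y r, s = x :: y :: r ∧
      t = (crossColors o x y).1 :: (crossColors o x y).2 :: r := by
  constructor
  · rintro ⟨p, s', t', hp, rfl, rfl, h⟩
    obtain rfl : p = [] := by simpa [Letter.pos] using hp
    cases h with
    | cross_over i x y r => exact ⟨x, y, r, rfl, rfl⟩
    | cross_under i x y r => exact ⟨x, y, r, rfl, rfl⟩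
  · rintro ⟨x, y, r, rfl, rfl⟩
    exact ⟨[], _, _, rfl, rfl, rfl, by cases o <;> constructor⟩

theorem Letter.colors_succ (l : Letter α) (x : R) (s t : List R) :
    (l.raise 1).Colors (x :: s) t ↔ ∃ t', t = x :: t' ∧ l.Colors s t' :=
  l.colors_raise [x] s t

@[simp] theorem Letter.not_colors_nil (l : Letter α) (t : List R) :
    ¬ (l.raise 1).Colors ([] : List R) t := by
  rintro ⟨p, s', t', hp, h, _⟩
  simp at hp h
  simp [h.1] at hp

@[simp] theorem Letter.colors_cup_one (b : α) (s t : List R) :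
    (Letter.cup 1 b).Colors s t ↔ ∃ x r c, s = x :: r ∧ t = x :: c :: c :: r := by
  change ((Letter.cup 0 b).raise 1).Colors s t ↔ _
  cases s with
  | nil => simp
  | cons x s => rw [Letter.colors_succ]; simp

@[simp] theorem Letter.colors_cap_one (b : α) (s t : List R) :
    (Letter.cap 1 b).Colors s t ↔ ∃ x r c, s = x :: c :: c :: r ∧ t = x :: r := by
  change ((Letter.cap 0 b).raise 1).Colors s t ↔ _
  cases s with
  | nil => simp
  | cons x s => rw [Letter.colors_succ]; simp; grind

@[simp] theorem Letter.colors_cross_one (o : Bool) (s t : List R) :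
    (Letter.cross 1 o : Letter α).Colors s t ↔ ∃ z x y r, s = z :: x :: y :: r ∧
      t = z :: (crossColors o x y).1 :: (crossColors o x y).2 :: r := by
  change ((Letter.cross 0 o).raise 1).Colors s t ↔ _
  cases s with
  | nil => simp
  | cons x s => rw [Letter.colors_succ]; simp; grind

@[simp] theorem Letter.colors_cross_two (o : Bool) (s t : List R) :
    (Letter.cross 2 o : Letter α).Colors s t ↔ ∃ z z' x y r, s = z :: z' :: x :: y :: r ∧
      t = z :: z' :: (crossColors o x y).1 :: (crossColors o x y).2 :: r := by
  change ((Letter.cross 1 o).raise 1).Colors s t ↔ _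
  cases s with
  | nil => simp
  | cons x s => rw [Letter.colors_succ]; simp; grind

end SymUnion

namespace SymUnion

variable {α β : Type} {R : Type} [CommRing R]

/-! ### Invariance of colorings off the axis -/

theorem Letter.strands_raise (l : Letter α) (n k : ℕ) :
    (l.raise k).strands (n + k) = (l.strands n).map (· + k) := by
  simp only [Letter.strands, Letter.pos_raise, Letter.ins_raise, Letter.outs_raise]
  split_ifs <;> first | (simp; omega) | omega | rfl

theorem strands_raise (w : List (Letter α)) (n k : ℕ) :
    strands (w.map (Letter.raise k)) (n + k) = (strands w n).map (· + k) := by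
  induction w generalizing n with
  | nil => rfl
  | cons l w ih =>
    simp only [List.map_cons, strands, Letter.strands_raise]
    cases l.strands n with
    | none => rfl
    | some m => exact ih m

theorem Letter.strands_add (l : Letter α) {n m : ℕ} (h : l.strands n = some m) (k : ℕ) :
    l.strands (n + k) = some (m + k) := by
  simp only [Letter.strands] at h ⊢
  split_ifs at h with hl
  simp only [Option.some.injEq] at h
  rw [if_pos (by omega)]
  simp; omega

theorem strands_add (w : List (Letter α)) {n m : ℕ} (h : strands w n = some m) (k : ℕ) :
    strands w (n + k) = some (m + k) := by
  induction w generalizing n with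
  | nil => simp_all [strands]
  | cons l w ih =>
    simp only [strands, Option.bind_eq_some_iff] at h ⊢
    obtain ⟨r, hr, h⟩ := h
    exact ⟨_, l.strands_add hr k, ih h⟩

theorem two_mul_sub_self (x : R) : 2 * x - x = x := by ring

/-- This is the invariance of Fox colorings: the colors of the strands inside the move are
determined by those outside. The words have to fit, since an empty side relates `[]` to itself while
the other side may need strands and then relates `[]` to nothing. -/
theorem BaseMove.colors_iff {a b : List (Letter Unit)} (h : BaseMove a b) {s t : List R}
    (ha : (strands a s.length).isSome) (hb : (strands b s.length).isSome) :
    Colors a s t ↔ Colors b s t := by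
  cases h with
  | zigzag_right =>
    cases s with
    | nil => simp [strands, Letter.strands, Letter.pos, Letter.ins, Letter.outs] at ha
    | cons x s => simp [Colors, eq_comm]
  | zigzag_left =>
    cases s with
    | nil => simp [strands, Letter.strands, Letter.pos, Letter.ins, Letter.outs] at ha
    | cons x s => simp [Colors]
  | slide_cup o =>
    cases o <;> simp [Colors, crossColors]
    · constructor
      · rintro ⟨c, x, r, rfl, rfl⟩
        exact ⟨x, r, rfl, 2 * x - c, by simp⟩
      · rintro ⟨x, r, rfl, c, rfl⟩
        exact ⟨2 * x - c, x, r, rfl, by simp⟩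
    · constructor
      · rintro ⟨c, x, r, rfl, rfl⟩
        exact ⟨x, r, rfl, c, by simp⟩
      · rintro ⟨x, r, rfl, c, rfl⟩
        exact ⟨c, x, r, rfl, by simp⟩
  | slide_cap o =>
    cases o <;> simp [Colors, crossColors]
    · constructor
      · rintro ⟨z, x, y, rfl, rfl⟩
        exact ⟨_, _, _, rfl, by simp⟩
      · rintro ⟨x, y, r, rfl, rfl⟩
        exact ⟨x, y, _, by simp, rfl⟩
    · constructor
      · rintro ⟨z, x, y, rfl, rfl⟩
        exact ⟨2 * z - x, z, y, by simp, rfl⟩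
      · rintro ⟨x, y, r, rfl, rfl⟩
        exact ⟨y, 2 * y - x, r, by simp, rfl⟩
  | r1_right o =>
    cases s with
    | nil => simp [strands, Letter.strands, Letter.pos, Letter.ins, Letter.outs] at ha
    | cons x s =>
      cases o <;> simp [Colors, crossColors, two_mul_sub_self]
      · constructor
        · rintro ⟨c, h, rfl⟩; simp; linear_combination h
        · rintro rfl; exact ⟨x, by ring, rfl⟩
      · exact eq_comm
  | r1_left o =>
    cases s with
    | nil => simp [strands, Letter.strands, Letter.pos, Letter.ins, Letter.outs] at ha
    | cons x s =>
      cases o <;> simp [Colors, crossColors, two_mul_sub_self]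
      constructor
      · rintro ⟨c, h, rfl⟩; simp; linear_combination h
      · rintro rfl; exact ⟨x, by ring, rfl⟩
  | r2 o =>
    match s with
    | [] => simp [strands, Letter.strands, Letter.pos, Letter.ins, Letter.outs] at ha
    | [x] => simp [strands, Letter.strands, Letter.pos, Letter.ins, Letter.outs] at ha
    | x :: y :: s => cases o <;> simp [Colors, crossColors, eq_comm]
  | r3 o₁ o₂ o₃ h =>
    match s with
    | [] => simp [strands, Letter.strands, Letter.pos, Letter.ins, Letter.outs] at ha
    | [x] => simp [strands, Letter.strands, Letter.pos, Letter.ins, Letter.outs] at ha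
    | [x, y] => simp [strands, Letter.strands, Letter.pos, Letter.ins, Letter.outs] at ha
    | x :: y :: z :: s =>
      cases o₁ <;> cases o₂ <;> cases o₃ <;> simp [Colors, crossColors] at h ⊢ <;> ring_nf

theorem PlainMove.colors_iff {a b : List (Letter Unit)} (h : PlainMove a b) {s t : List R}
    (ha : (strands a s.length).isSome) (hb : (strands b s.length).isSome) :
    Colors a s t ↔ Colors b s t := by
  cases h with
  | base i a b h =>
    by_cases hi : i ≤ s.length
    · obtain ⟨p, r, rfl, rfl⟩ : ∃ p r, s = p ++ r ∧ i = p.length :=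
        ⟨s.take i, s.drop i, by simp, by simp [hi]⟩
      have : ∀ w : List (Letter Unit), (strands (w.map (Letter.raise p.length))
          (p ++ r).length).isSome → (strands w r.length).isSome := fun w hw => by
        rw [List.length_append, add_comm, strands_raise] at hw
        simpa using hw
      rw [colors_raise, colors_raise]
      simp only [h.colors_iff (this a ha) (this b hb)]
    -- If there are fewer than `i` strands, the left side cannot fit, as it is never empty.
    · have : ∀ l w, strands ((l :: w : List (Letter Unit)).map (Letter.raise i)) s.length = none := by
        intro l w
        simp only [List.map_cons, strands, Letter.strands, Letter.pos_raise]
        rw [if_neg (by omega)]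
        rfl
      cases h <;> simp only [this] at ha <;> cases ha
  | exchange l m =>
    obtain ⟨n, hn⟩ := Option.isSome_iff_exists.1 ha
    have hl : l.pos + l.ins ≤ s.length := by
      by_contra hl
      simp [strands, Letter.strands, hl] at hn
    obtain ⟨p, r, rfl, hp⟩ : ∃ p r, s = p ++ r ∧ p.length = l.pos + l.ins :=
      ⟨s.take (l.pos + l.ins), s.drop (l.pos + l.ins), by simp, by simp [hl]⟩
    -- The strands `p` are those up to and including the letter `l`, the strands `r` those to its
    -- right; `l` acts only on `p` and `m` only on `r`, so the order does not matter.
    simp only [Colors, l.colors_append_right p r _ hp]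
    rw [← hp]
    simp only [Letter.colors_raise]
    constructor
    · rintro ⟨_, ⟨p', hp', rfl, h⟩, _, h', rfl⟩
      rw [← hp', Letter.colors_raise] at h'
      obtain ⟨r', rfl, h'⟩ := h'
      exact ⟨_, ⟨r', rfl, h'⟩, _, (l.colors_append_right p r' _ hp).2 ⟨p', hp', rfl, h⟩, rfl⟩
    · rintro ⟨_, ⟨r', rfl, h'⟩, _, h, rfl⟩
      obtain ⟨p', hp', rfl, h₁⟩ := (l.colors_append_right p r' _ hp).1 h
      refine ⟨_, ⟨p', hp', rfl, h₁⟩, _, ?_, rfl⟩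
      rw [← hp', Letter.colors_raise]
      exact ⟨r', rfl, h'⟩

end SymUnion

namespace SymUnion

variable {α β : Type} {R : Type} [CommRing R]

/-- The map `y ↦ 2 * x - y` is an involution, so the opposite crossing inverts the relation of
colors. This is what makes colorings compatible with turning a diagram upside down. -/
theorem Letter.colors_cross_not (i : ℕ) (o : Bool) (s t : List R) :
    (Letter.cross i (!o) : Letter α).Colors s t ↔ (Letter.cross i o : Letter β).Colors t s := by
  have key : ∀ (o : Bool) (s t : List R), (Letter.cross i o : Letter α).LocalColors s t →
      (Letter.cross i (!o) : Letter β).LocalColors t s := by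
    intro o s t h
    cases h with
    | cross_over i x y s =>
      have := LocalColors.cross_under (α := β) i (2 * x - y) x s
      simpa using this
    | cross_under i x y s =>
      have := LocalColors.cross_over (α := β) i y (2 * y - x) s
      simpa using this
  have key' : ∀ (o : Bool) (s t : List R), (Letter.cross i o : Letter β).LocalColors s t →
      (Letter.cross i (!o) : Letter α).LocalColors t s := by
    intro o s t h
    cases h with
    | cross_over i x y s =>
      have := LocalColors.cross_under (α := α) i (2 * x - y) x s
      simpa using this
    | cross_under i x y s =>
      have := LocalColors.cross_over (α := α) i y (2 * y - x) s
      simpa using this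
  constructor
  · rintro ⟨p, s', t', hp, rfl, rfl, h⟩
    exact ⟨p, t', s', hp, rfl, rfl, by simpa using key _ _ _ h⟩
  · rintro ⟨p, s', t', hp, rfl, rfl, h⟩
    exact ⟨p, t', s', hp, rfl, rfl, key' _ _ _ h⟩

variable [DecidableEq R]

/-! ### Weighted colorings of symmetric diagrams -/

/-- The number of strands above a letter of the right half, if there are `n` below and the letter
fits. -/
def SymLetter.strands : SymLetter α → ℕ → Option ℕ
  | axisCup _, n => some (n + 1)
  | axisCap _, n => if 1 ≤ n then some (n - 1) else none
  | axisCross _, n => if 1 ≤ n then some n else none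
  | off l, n => l.strands n

/-- The number of strands above a word of the right half, if there are `n` below and the word
fits. -/
def symStrands : List (SymLetter α) → ℕ → Option ℕ
  | [], n => some n
  | l :: w, n => (l.strands n).bind (symStrands w)

/-- Colorings of the right half of a symmetric diagram near a letter, in which the strands that
meet the axis have color `0` and the crossings on the axis do not change the color. A crossing on
the axis of type `o` has weight `c o` if its color is not `0`. -/
def SymLetter.Colors (c : Bool → ℤ) : SymLetter α → List R → List R → ℤ → Prop
  | axisCup _, s, t, q => t = 0 :: s ∧ q = 0
  | axisCap _, s, t, q => s = 0 :: t ∧ q = 0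
  | axisCross o, s, t, q => s = t ∧ ∃ x r, s = x :: r ∧ q = if x = 0 then 0 else c o
  | off l, s, t, q => l.Colors s t ∧ q = 0

/-- Colorings of a word of the right half; the weights of the letters are added up. -/
def SymColors (c : Bool → ℤ) : List (SymLetter α) → List R → List R → ℤ → Prop
  | [], s, t, q => s = t ∧ q = 0
  | l :: w, s, t, q => ∃ r q₁ q₂, l.Colors c s r q₁ ∧ SymColors c w r t q₂ ∧ q = q₁ + q₂

theorem SymLetter.length_of_colors {c : Bool → ℤ} {l : SymLetter α} {s t : List R} {q : ℤ}
    (h : l.Colors c s t q) : l.strands s.length = some t.length := by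
  cases l with
  | axisCup b => simp [SymLetter.Colors, SymLetter.strands] at h ⊢; simp [h.1]
  | axisCap b => simp [SymLetter.Colors, SymLetter.strands] at h ⊢; simp [h.1]
  | axisCross o =>
    obtain ⟨rfl, x, r, rfl, _⟩ := h
    simp [SymLetter.strands]
  | off l => exact Letter.length_of_colors h.1

theorem length_of_symColors {c : Bool → ℤ} {w : List (SymLetter α)} {s t : List R} {q : ℤ}
    (h : SymColors c w s t q) : symStrands w s.length = some t.length := by
  induction w generalizing s q with
  | nil => simp [symStrands, h.1]
  | cons l w ih =>
    obtain ⟨r, q₁, q₂, h₁, h₂, _⟩ := h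
    simp [symStrands, SymLetter.length_of_colors h₁, ih h₂]

theorem SymLetter.length_of_step {l : SymLetter Bool} {s t : List Bool} (h : l.step s = some t) :
    l.strands s.length = some t.length := by
  cases l with
  | axisCup b => simp [SymLetter.step] at h; simp [SymLetter.strands, ← h]
  | axisCap b =>
    cases s with
    | nil => simp [SymLetter.step] at h
    | cons x s => simp [SymLetter.step] at h; simp [SymLetter.strands, h.2]
  | axisCross o =>
    cases s with
    | nil => simp [SymLetter.step] at h
    | cons x s => simp [SymLetter.step] at h; simp [SymLetter.strands, ← h]
  | off l => exact Letter.length_of_step h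

theorem symStrands_of_symRun {w : List (SymLetter Bool)} {s t : List Bool}
    (h : symRun w s = some t) : symStrands w s.length = some t.length := by
  induction w generalizing s with
  | nil => simp only [symRun, Option.some.injEq] at h; simp [symStrands, h]
  | cons l w ih =>
    simp only [symRun, Option.bind_eq_some_iff] at h
    obtain ⟨r, hr, hw⟩ := h
    simp [symStrands, SymLetter.length_of_step hr, ih hw]

theorem symStrands_append (u v : List (SymLetter α)) (n : ℕ) :
    symStrands (u ++ v) n = (symStrands u n).bind (symStrands v) := by
  induction u generalizing n with
  | nil => simp [symStrands]
  | cons l u ih =>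
    simp only [List.cons_append, symStrands]
    cases l.strands n with
    | none => rfl
    | some m => exact ih m

theorem symStrands_map_off (w : List (Letter α)) (n : ℕ) :
    symStrands (w.map SymLetter.off) n = strands w n := by
  induction w generalizing n with
  | nil => rfl
  | cons l w ih => simp only [List.map_cons, symStrands, strands, SymLetter.strands, ih]

theorem symColors_append (c : Bool → ℤ) (u v : List (SymLetter α)) (s t : List R) (q : ℤ) :
    SymColors c (u ++ v) s t q ↔
      ∃ r q₁ q₂, SymColors c u s r q₁ ∧ SymColors c v r t q₂ ∧ q = q₁ + q₂ := by
  induction u generalizing s q with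
  | nil => simp [SymColors]
  | cons l u ih =>
    simp only [List.cons_append, SymColors, ih]
    constructor
    · rintro ⟨r, q₁, _, h₁, ⟨r', q₂, q₃, h₂, h₃, rfl⟩, rfl⟩
      exact ⟨r', _, q₃, ⟨r, q₁, q₂, h₁, h₂, rfl⟩, h₃, by ring⟩
    · rintro ⟨r', _, q₃, ⟨r, q₁, q₂, h₁, h₂, rfl⟩, h₃, rfl⟩
      exact ⟨r, q₁, _, h₁, ⟨r', q₂, q₃, h₂, h₃, rfl⟩, by ring⟩

theorem symColors_map_off (c : Bool → ℤ) (w : List (Letter α)) (s t : List R) (q : ℤ) :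
    SymColors c (w.map SymLetter.off) s t q ↔ Colors w s t ∧ q = 0 := by
  induction w generalizing s q with
  | nil => rfl
  | cons l w ih =>
    simp only [List.map_cons, SymColors, SymLetter.Colors, ih, Colors]
    grind

theorem SymLetter.colors_map (c : Bool → ℤ) (f : α → β) (l : SymLetter α) (s t : List R) (q : ℤ) :
    (l.map f).Colors c s t q ↔ l.Colors c s t q := by
  cases l <;> simp [SymLetter.map, SymLetter.Colors, Letter.colors_map]

theorem symColors_map (c : Bool → ℤ) (f : α → β) (w : List (SymLetter α)) (s t : List R) (q : ℤ) :
    SymColors c (w.map (SymLetter.map f)) s t q ↔ SymColors c w s t q := by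
  induction w generalizing s q with
  | nil => rfl
  | cons l w ih => simp only [List.map_cons, SymColors, SymLetter.colors_map, ih]

/-- Turning by `π` amounts, for the right half, to reading it downwards with the same colors. A
crossing on the axis keeps its type, hence its weight. -/
theorem SymLetter.colors_turn (c : Bool → ℤ) (l : SymLetter α) (s t : List R) (q : ℤ) :
    l.turn.Colors c s t q ↔ l.Colors c t s q := by
  rcases l with b | b | o | ⟨i, b⟩ | ⟨i, b⟩ | ⟨i, o⟩
  · rfl
  · rfl
  · simp only [SymLetter.turn, SymLetter.Colors]
    constructor <;> rintro ⟨rfl, h⟩ <;> exact ⟨rfl, h⟩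
  · simp only [SymLetter.turn, SymLetter.Colors, and_congr_left_iff]
    rintro -
    constructor <;> rintro ⟨p, _, _, hp, rfl, rfl, ⟨⟩⟩
    · exact ⟨p, _, _, hp, rfl, rfl, .cup i b _ _⟩
    · exact ⟨p, _, _, hp, rfl, rfl, .cap i b _ _⟩
  · simp only [SymLetter.turn, SymLetter.Colors, and_congr_left_iff]
    rintro -
    constructor <;> rintro ⟨p, _, _, hp, rfl, rfl, ⟨⟩⟩
    · exact ⟨p, _, _, hp, rfl, rfl, .cap i b _ _⟩
    · exact ⟨p, _, _, hp, rfl, rfl, .cup i b _ _⟩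
  · simp only [SymLetter.turn, SymLetter.Colors, Letter.colors_cross_not (β := α)]

theorem symColors_turn (c : Bool → ℤ) (w : List (SymLetter α)) (s t : List R) (q : ℤ) :
    SymColors c (w.map SymLetter.turn).reverse s t q ↔ SymColors c w t s q := by
  induction w generalizing t q with
  | nil => simp [SymColors, eq_comm]
  | cons l w ih =>
    simp only [List.map_cons, List.reverse_cons, symColors_append, SymColors,
      SymLetter.colors_turn, ih]
    constructor
    · rintro ⟨r, q₁, _, h₁, ⟨r', q₂, q₃, h₂, ⟨rfl, rfl⟩, rfl⟩, rfl⟩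
      exact ⟨r, q₂, q₁, h₂, h₁, by ring⟩
    · rintro ⟨r, q₁, q₂, h₁, h₂, rfl⟩
      exact ⟨r, q₂, q₁, h₂, ⟨t, q₁, 0, h₁, ⟨rfl, rfl⟩, by ring⟩, by ring⟩

end SymUnion

namespace SymUnion

variable {α β : Type} {R : Type} [CommRing R] [DecidableEq R]

/-! ### Invariance of weighted colorings under the moves on the axis -/

theorem AxisIsotopy.colors_iff (c : Bool → ℤ) {a b : List (SymLetter Bool)}
    (h : AxisIsotopy a b) {s t : List R} {q : ℤ} :
    SymColors c a s t q ↔ SymColors c b s t q := by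
  cases h with
  | turn_down b => simp [SymColors, SymLetter.Colors]; grind
  | turn_up b => simp [SymColors, SymLetter.Colors]
  | exchange_axisCup b l =>
    simp [SymColors, SymLetter.Colors, Letter.colors_succ]; grind
  | exchange_axisCap b l =>
    cases s <;> simp [SymColors, SymLetter.Colors, Letter.colors_succ]; grind
  | exchange_axisCross o l =>
    cases s <;> simp [SymColors, SymLetter.Colors, Letter.colors_succ]; grind

/-- In each move the crossings on the axis keep their types and colors. In `S2(±)` the condition at
the closing maximum forces the new strand to have the color of the old one; in `S3` the passing
strand has color `0` on both sides of the move; in `S4` the two weights only change their order in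
the sum. -/
theorem AxisReidemeister.colors_iff (c : Bool → ℤ) {a b : List (SymLetter Bool)}
    (h : AxisReidemeister a b) {s t : List R} {q : ℤ} :
    SymColors c a s t q ↔ SymColors c b s t q := by
  cases h with
  | s2h b d o =>
    cases o <;> simp [SymColors, SymLetter.Colors, crossColors] <;> grind
  | s2 b d o p =>
    cases o <;> simp [SymColors, SymLetter.Colors, crossColors] 
    · constructor
      · rintro ⟨x, ⟨r, rfl, rfl⟩, rfl⟩
        exact ⟨by rw [two_mul_sub_self], x, ⟨r, rfl⟩, rfl⟩
      · rintro ⟨rfl, x, ⟨r, rfl⟩, rfl⟩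
        exact ⟨x, ⟨r, rfl, by rw [two_mul_sub_self]⟩, rfl⟩
    · constructor
      · rintro ⟨x, y, ⟨r, ⟨h, rfl⟩, rfl⟩, rfl⟩
        obtain rfl : x = y := by linear_combination -h
        exact ⟨rfl, x, ⟨r, rfl⟩, by rw [two_mul_sub_self]⟩
      · rintro ⟨rfl, x, ⟨r, rfl⟩, rfl⟩
        exact ⟨x, x, ⟨r, ⟨by ring, rfl⟩, rfl⟩, by rw [two_mul_sub_self]⟩
  | s3 b o p =>
    cases o <;> simp [SymColors, SymLetter.Colors, crossColors] 
    all_goals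
      constructor
      · rintro ⟨⟨_, ⟨_, rfl⟩, rfl⟩, y, r, ⟨⟨⟩⟩, rfl⟩
        exact ⟨_, ⟨_, rfl, rfl⟩, rfl⟩
      · rintro ⟨y, ⟨r, rfl, rfl⟩, rfl⟩
        exact ⟨⟨y, ⟨r, rfl⟩, rfl⟩, y, r, rfl, rfl⟩
  | s4 b d o p q =>
    cases o <;> simp [SymColors, SymLetter.Colors, crossColors]
    all_goals
      constructor
      · rintro ⟨_, ⟨_, rfl⟩, r, z, ⟨⟨y, ⟨⟨⟩⟩⟩, rfl⟩, rfl⟩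
        exact ⟨z, _, ⟨r, rfl, rfl⟩, add_comm _ _⟩
      · rintro ⟨z, y, ⟨r, rfl, rfl⟩, rfl⟩
        exact ⟨y, ⟨_, rfl⟩, r, z, ⟨⟨y, rfl⟩, rfl⟩, add_comm _ _⟩

/-- The crossing of the curl is next to an extremum on the axis, so its color is `0` and its weight
does not count. -/
theorem S1Move.colors_iff (c : Bool → ℤ) {a b : List (SymLetter Bool)}
    (h : S1Move a b) {s t : List R} {q : ℤ} :
    SymColors c a s t q ↔ SymColors c b s t q := by
  cases h with
  | below b p => simp [SymColors, SymLetter.Colors, eq_comm]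
  | above b p => simp [SymColors, SymLetter.Colors]; grind

/-- Both crossings lie on a strand of the same color, so either neither of them counts or their
opposite weights cancel. -/
theorem S2vMove.colors_iff (c : Bool → ℤ) (hc : c true + c false = 0) {a b : List (SymLetter Bool)}
    (h : S2vMove a b) {s t : List R} {q : ℤ} (ha : (symStrands a s.length).isSome) :
    SymColors c a s t q ↔ SymColors c b s t q := by
  cases h with
  | mk p => 
    cases s with
    | nil => simp [symStrands, SymLetter.strands] at ha
    | cons x s =>
      have : c (!p) = - c p := by cases p <;> simp <;> omega
      simp [SymColors, SymLetter.Colors, this]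
      split_ifs <;> simp

end SymUnion

namespace SymUnion

variable {α β : Type} {R : Type} [CommRing R] [DecidableEq R]

/-! ### The set of weights as an invariant -/

theorem SRMove.colors_iff (c : Bool → ℤ) {a b : List (SymLetter Bool)}
    (h : SRMove a b) {s t : List R} {q : ℤ} (ha : (symStrands a s.length).isSome)
    (hb : (symStrands b s.length).isSome) :
    SymColors c a s t q ↔ SymColors c b s t q := by
  cases h with
  | off_axis a b h =>
    have hm : PlainMove (plain a) (plain b) := h.elim .of_isotopy .of_reidemeister
    rw [symStrands_map_off] at ha hb
    have := hm.colors_iff (s := s) (t := t) (by rwa [strands_map]) (by rwa [strands_map])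
    rw [colors_map, colors_map] at this
    simp [symColors_map_off, this]
  | on_axis a b h =>
    rcases h with h | h
    · exact h.colors_iff c
    · exact h.colors_iff c

/-- The weights of colorings are not changed by local moves which do not change them locally. -/
theorem SymMove.colors_iff (c : Bool → ℤ) {M : List (SymLetter Bool) → List (SymLetter Bool) → Prop}
    (hM : ∀ a b, M a b → ∀ (s t : List R) (q : ℤ), (symStrands a s.length).isSome →
      (symStrands b s.length).isSome → (SymColors c a s t q ↔ SymColors c b s t q))
    {D D' : SymDiagram} (h : SymMove M D D') (q : ℤ) :
    SymColors c D.1 ([] : List R) [] q ↔ SymColors c D'.1 ([] : List R) [] q := by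
  -- The colors above `u` determine how many strands there are; since `D` is a diagram, `a` fits
  -- onto them. This supplies the hypotheses of the local invariance.
  have local_strands : ∀ (D : SymDiagram) (u a v : List (SymLetter Bool)), D.1 = u ++ a ++ v →
      ∀ (r : List R) (q : ℤ), SymColors c u [] r q → (symStrands a r.length).isSome := by
    intro D u a v hD r q hr
    have h1 := symStrands_of_symRun D.2
    have h2 := length_of_symColors hr
    rw [hD, List.append_assoc, symStrands_append] at h1
    simp only [List.length_nil] at h1 h2
    rw [h2, Option.bind_some, symStrands_append, Option.bind_eq_some_iff] at h1
    obtain ⟨m, hm, _⟩ := h1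
    simp [hm]
  cases h with
  | move u v a b h hD hD' =>
    have h1 := local_strands D u a v hD
    have h2 := local_strands D' u b v hD'
    rw [hD, hD']
    simp only [symColors_append]
    constructor
    · rintro ⟨r, q₁, q₂, ⟨r', q₃, q₄, hu, ha, rfl⟩, hv, rfl⟩
      exact ⟨r, _, q₂, ⟨r', q₃, q₄, hu, (hM a b h r' r q₄ (h1 _ _ hu) (h2 _ _ hu)).1 ha, rfl⟩,
        hv, rfl⟩
    · rintro ⟨r, q₁, q₂, ⟨r', q₃, q₄, hu, ha, rfl⟩, hv, rfl⟩
      exact ⟨r, _, q₂, ⟨r', q₃, q₄, hu, (hM a b h r' r q₄ (h1 _ _ hu) (h2 _ _ hu)).2 ha, rfl⟩,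
        hv, rfl⟩
  -- Turning exchanges the strands below and above, and both lists are empty.
  | rotate h => rw [h, symColors_turn]

theorem SymmetricallyEquivalent.colors_iff (R : Type) [CommRing R] [DecidableEq R] (c : Bool → ℤ)
    {D D' : SymDiagram} (h : SymmetricallyEquivalent D D') (q : ℤ) :
    SymColors c D.forget ([] : List R) [] q ↔ SymColors c D'.forget ([] : List R) [] q := by
  simp only [SymDiagram.forget, symColors_map]
  induction h with
  | rel D D' h =>
    refine h.colors_iff c (fun a b h s t q ha hb => ?_) q
    rcases h with h | h
    · exact h.colors_iff c ha hb
    · exact h.colors_iff c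
  | refl => rfl
  | symm _ _ _ ih => exact ih.symm
  | trans _ _ _ _ _ ih ih' => exact ih.trans ih'

theorem WeaklySymmetricallyEquivalent.colors_iff (R : Type) [CommRing R] [DecidableEq R]
    (c : Bool → ℤ) (hc : c true + c false = 0)
    {D D' : SymDiagram} (h : WeaklySymmetricallyEquivalent D D') (q : ℤ) :
    SymColors c D.forget ([] : List R) [] q ↔ SymColors c D'.forget ([] : List R) [] q := by
  simp only [SymDiagram.forget, symColors_map]
  induction h with
  | rel D D' h =>
    refine h.colors_iff c (fun a b h s t q ha hb => ?_) q
    rcases h with h | h | h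
    · exact h.colors_iff c ha hb
    · exact h.colors_iff c
    · exact h.colors_iff c hc ha
  | refl => rfl
  | symm _ _ _ ih => exact ih.symm
  | trans _ _ _ _ _ ih ih' => exact ih.trans ih'

/-! ### Colorings of connected sums -/

/-- The word of copies of a word on top of each other. -/
abbrev stack (k : ℕ) (M : List α) : List α := (List.replicate k M).flatten

theorem stack_succ' (k : ℕ) (M : List α) : stack (k + 1) M = stack k M ++ M := by
  simp [stack, List.replicate_succ']

/-- At each sum the `axisCap` of the lower diagram and the `axisCup` of the upper one disappear, so
that only the middle parts pile up. -/
theorem connectedSumPow_eq (M : List (SymLetter Unit)) (k : ℕ) :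
    connectedSumPow (.axisCup () :: M ++ [.axisCap ()]) k =
      .axisCup () :: stack k M ++ [.axisCap ()] := by
  induction k with
  | zero => rfl
  | succ k ih =>
    rw [connectedSumPow, ih, connectedSum, stack_succ', List.dropLast_concat]
    simp

open SymLetter Letter in
/-- The part of `D89` between the two extrema on the axis. -/
def mid89 (o : Bool) : List (SymLetter Unit) :=
  [off (cup 1 ()),
    off (cross 0 true), axisCross o, off (cross 0 true), off (cross 0 true), axisCross (!o),
    off (cross 0 true), axisCross o, off (cross 0 true),
    off (cap 1 ())]

open SymLetter Letter in
/-- The part of `D1042` between the two extrema on the axis. -/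
def mid1042 : List (SymLetter Unit) :=
  [off (cup 1 ()),
    off (cross 0 false), axisCross false, off (cross 0 false), axisCross true,
    off (cross 0 false), axisCross false, off (cross 0 false), axisCross true,
    off (cross 1 true), off (cross 0 false),
    off (cap 1 ())]

open SymLetter Letter in
/-- The part of `D1042'` between the two extrema on the axis. -/
def mid1042' : List (SymLetter Unit) :=
  [off (cup 1 ()),
    off (cross 0 false), off (cross 0 false), axisCross true, off (cross 0 false),
    axisCross false, off (cross 0 false), off (cross 1 true), off (cross 0 false),
    off (cap 1 ())]

theorem D89_eq : D89 = .axisCup () :: mid89 false ++ [.axisCap ()] := rfl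
theorem D89'_eq : D89' = .axisCup () :: mid89 true ++ [.axisCap ()] := rfl
theorem D1042_eq : D1042 = .axisCup () :: mid1042 ++ [.axisCap ()] := rfl
theorem D1042'_eq : D1042' = .axisCup () :: mid1042' ++ [.axisCap ()] := rfl

variable (c : Bool → ℤ) (M : List (SymLetter α))

/-- Bounds from above the weights of a sum: a summand that starts with the color `0` ends with it,
so the summands are colored independently of each other. -/
theorem symColors_stack {P : ℤ → Prop} (h0 : P 0) (hadd : ∀ a b, P a → P b → P (a + b))
    (hM : ∀ (t : List R) (q : ℤ), SymColors c M [0] t q → t = [0] ∧ P q) (k : ℕ) (t : List R) (q : ℤ)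
    (h : SymColors c (stack k M) [0] t q) : t = [0] ∧ P q := by
  induction k generalizing t q with
  | zero => obtain ⟨rfl, rfl⟩ := h; exact ⟨rfl, h0⟩
  | succ k ih =>
    rw [stack_succ', symColors_append] at h
    obtain ⟨r, q₁, q₂, h₁, h₂, rfl⟩ := h
    obtain ⟨rfl, hq₁⟩ := ih _ _ h₁
    obtain ⟨rfl, hq₂⟩ := hM _ _ h₂
    exact ⟨rfl, hadd _ _ hq₁ hq₂⟩

/-- One summand carries a coloring of weight `1`, all others one of weight `0`. -/
theorem exists_symColors_stack (h0 : SymColors c M ([0] : List R) [0] 0)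
    (h1 : SymColors c M ([0] : List R) [0] 1) (k : ℕ) :
    SymColors c (stack (k + 1) M) ([0] : List R) [0] 1 := by
  induction k with
  | zero => simpa [stack] using h1
  | succ k ih =>
    rw [stack_succ', symColors_append]
    exact ⟨[0], 1, 0, ih, h0, rfl⟩

theorem symColors_closure (M : List (SymLetter Unit)) (q : ℤ) :
    SymColors c (.axisCup () :: M ++ [.axisCap ()]) ([] : List R) [] q ↔
      SymColors c M ([0] : List R) [0] q := by
  simp [SymColors, symColors_append, SymLetter.Colors]

end SymUnion

namespace SymUnion

/-! ### The colorings which separate the diagrams -/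

/-- If the minimum off the axis has color `x`, the crossings on the axis have the colors `2 * x`
(type `true`) and `3 * x` (type `false`), and the top strand has color `9 * x`. Modulo `3` the only
crossing that could count has color `0`. -/
theorem of_colors_mid1042' (t : List (ZMod 3)) (q : ℤ)
    (h : SymColors (fun o => if o then 0 else 1) mid1042' [0] t q) : t = [0] ∧ q = 0 := by
  simp [mid1042', SymColors, SymLetter.Colors, crossColors] at h
  obtain ⟨x, ⟨-, rfl⟩, rfl⟩ := h
  revert x; decide

/-- Here the crossings of type `false` have colors `x` and `3 * x`, so exactly one counts if `x ≠
0`. The maximum off the axis requires `14 * x = 5 * x`, which always holds modulo `3`. -/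
theorem colors_mid1042 (x : ZMod 3) (q : ℤ) (hx : q = if x = 0 then 0 else 1) :
    SymColors (fun o => if o then 0 else 1) mid1042 ([0] : List (ZMod 3)) [0] q := by
  simp [mid1042, SymColors, SymLetter.Colors, crossColors]
  refine ⟨x, ?_, ?_⟩
  · clear hx; revert x; decide
  · subst hx; revert x; decide

/-- The colors on the axis are `-x`, `-3 * x`, `-4 * x` and the top strand has color `-5 * x`. For
`x ≠ 0` all three crossings count, two of type `false` and one of type `true`, which gives `-1`. -/
theorem of_colors_mid89 (t : List (ZMod 5)) (q : ℤ)
    (h : SymColors (fun o => if o then 1 else -1) (mid89 false) [0] t q) : t = [0] ∧ q ≤ 0 := by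
  simp [mid89, SymColors, SymLetter.Colors, crossColors] at h
  obtain ⟨x, ⟨-, rfl⟩, rfl⟩ := h
  revert x; decide

/-- The colors are those of `mid89 false`, because a crossing on the axis transmits the color
whatever its type; only the signs of the weights change. -/
theorem colors_mid89 (x : ZMod 5) (q : ℤ) (hx : q = if x = 0 then 0 else 1) :
    SymColors (fun o => if o then 1 else -1) (mid89 true) ([0] : List (ZMod 5)) [0] q := by
  simp [mid89, SymColors, SymLetter.Colors, crossColors]
  refine ⟨x, ?_, ?_⟩
  · clear hx; revert x; decide
  · subst hx; revert x; decide

theorem not_symmetricallyEquivalent_1042 (k : ℕ) (hk : 1 ≤ k) (D D' : SymDiagram)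
    (hD : D.forget = connectedSumPow D1042 k) (hD' : D'.forget = connectedSumPow D1042' k) :
    ¬ SymmetricallyEquivalent D D' := by
  intro h
  obtain ⟨k, rfl⟩ := Nat.exists_eq_add_of_le' hk
  -- These weights do not add up to `0`, so this invariant is not one of weak symmetric equivalence.
  have := h.colors_iff (ZMod 3) (fun o => if o then 0 else 1) 1
  rw [hD, hD', D1042_eq, D1042'_eq, connectedSumPow_eq, connectedSumPow_eq, symColors_closure,
    symColors_closure] at this
  have h1 := this.1 (exists_symColors_stack _ _ (colors_mid1042 0 0 rfl) (colors_mid1042 1 1 rfl) k)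
  have h2 := (symColors_stack _ _ (P := fun q => q = 0) rfl (by omega) of_colors_mid1042' _ _ _ h1).2
  omega

theorem not_weaklySymmetricallyEquivalent_89 (k : ℕ) (hk : 1 ≤ k) (D D' : SymDiagram)
    (hD : D.forget = connectedSumPow D89 k) (hD' : D'.forget = connectedSumPow D89' k) :
    ¬ WeaklySymmetricallyEquivalent D D' := by
  intro h
  obtain ⟨k, rfl⟩ := Nat.exists_eq_add_of_le' hk
  -- The opposite weights are what invariance under `S2(v)` requires.
  have := h.colors_iff (ZMod 5) (fun o => if o then 1 else -1) (by simp) 1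
  rw [hD, hD', D89_eq, D89'_eq, connectedSumPow_eq, connectedSumPow_eq, symColors_closure,
    symColors_closure] at this
  have h1 := this.2 (exists_symColors_stack _ _ (colors_mid89 0 0 rfl) (colors_mid89 1 1 rfl) k)
  have h2 := (symColors_stack _ _ (P := fun q => q ≤ 0) le_rfl (by omega) of_colors_mid89 _ _ _ h1).2
  omega

end SymUnion

namespace SymUnion

/-! ### Equivalence of unoriented words -/

/-- One move between unoriented words from `n` strands to `m` strands. -/
def UStep (n m : ℕ) (w w' : List (Letter Unit)) : Prop :=
  strands w n = some m ∧ strands w' n = some m ∧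
    ∃ u v a b, PlainMove a b ∧ w = u ++ a ++ v ∧ w' = u ++ b ++ v

/-- Equivalence of unoriented words from `n` strands to `m` strands. -/
def UEq (n m : ℕ) : List (Letter Unit) → List (Letter Unit) → Prop :=
  Relation.EqvGen (UStep n m)

namespace UEq

variable {n m k l : ℕ} {a b c u v w : List (Letter Unit)}

theorem refl (w : List (Letter Unit)) : UEq n m w w := Relation.EqvGen.refl w

theorem symm (h : UEq n m a b) : UEq n m b a := Relation.EqvGen.symm _ _ h

theorem trans (h : UEq n m a b) (h' : UEq n m b c) : UEq n m a c := Relation.EqvGen.trans _ _ _ h h'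

theorem lift {n' m' : ℕ} {f : List (Letter Unit) → List (Letter Unit)}
    (hf : ∀ a b, UStep n m a b → UStep n' m' (f a) (f b)) (h : UEq n m a b) :
    UEq n' m' (f a) (f b) := by
  induction h with
  | rel a b h => exact .rel _ _ (hf a b h)
  | refl a => exact refl _
  | symm a b _ ih => exact ih.symm
  | trans a b c _ _ ih ih' => exact ih.trans ih'

theorem context (h : UEq n m a b) (hu : strands u k = some n) (hv : strands v m = some l) :
    UEq k l (u ++ a ++ v) (u ++ b ++ v) := by
  refine h.lift (f := fun a => u ++ a ++ v) ?_
  rintro a b ⟨ha, hb, u', v', a', b', h, rfl, rfl⟩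
  refine ⟨?_, ?_, u ++ u', v' ++ v, a', b', h, by simp, by simp⟩
  · rw [strands_append, strands_append, hu, Option.bind_some, ha, Option.bind_some, hv]
  · rw [strands_append, strands_append, hu, Option.bind_some, hb, Option.bind_some, hv]

theorem left (h : UEq n m a b) (hu : strands u k = some n) : UEq k m (u ++ a) (u ++ b) := by
  simpa using h.context (v := []) hu rfl

theorem right (h : UEq n m a b) (hv : strands v m = some l) : UEq n l (a ++ v) (b ++ v) := by
  simpa using h.context (u := []) rfl hv

end UEq

theorem Letter.raise_raise {α : Type} (i j : ℕ) (l : Letter α) :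
    (l.raise i).raise j = l.raise (i + j) := by
  cases l <;> simp [Letter.raise, add_assoc]

theorem PlainMove.raise {a b : List (Letter Unit)} (h : PlainMove a b) (i : ℕ) :
    PlainMove (a.map (Letter.raise i)) (b.map (Letter.raise i)) := by
  cases h with
  | base j a b h =>
    have := PlainMove.base (j + i) a b h
    simpa [Function.comp_def, Letter.raise_raise] using this
  | exchange l m =>
    have := PlainMove.exchange (l.raise i) m
    simp only [Letter.pos_raise, Letter.outs_raise, Letter.ins_raise] at this
    simp only [List.map_cons, List.map_nil, Letter.raise_raise]
    rwa [add_right_comm l.pos i, add_right_comm l.pos i] at this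

namespace UEq

variable {n m k l : ℕ} {a b c u v w : List (Letter Unit)}

theorem raise (h : UEq n m a b) (i : ℕ) :
    UEq (n + i) (m + i) (a.map (Letter.raise i)) (b.map (Letter.raise i)) := by
  refine h.lift (f := fun a => a.map (Letter.raise i)) ?_
  rintro a b ⟨ha, hb, u, v, a', b', h, rfl, rfl⟩
  exact ⟨by simp only [strands_raise, ha]; rfl, by simp only [strands_raise, hb]; rfl,
    u.map (Letter.raise i), v.map (Letter.raise i), _, _, h.raise i, by simp, by simp⟩

theorem add (h : UEq n m a b) (i : ℕ) : UEq (n + i) (m + i) a b := by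
  refine h.lift (f := id) ?_
  rintro a b ⟨ha, hb, h⟩
  exact ⟨strands_add _ ha i, strands_add _ hb i, h⟩

theorem of_plainMove (h : PlainMove a b) (ha : strands a n = some m) (hb : strands b n = some m) :
    UEq n m a b :=
  .rel _ _ ⟨ha, hb, [], [], a, b, h, by simp, by simp⟩

theorem of_base (h : BaseMove a b) (ha : strands a n = some m) (hb : strands b n = some m) :
    UEq n m a b := by
  have := PlainMove.base 0 a b h
  have h0 : (Letter.raise 0 : Letter Unit → Letter Unit) = id := by
    funext l; cases l <;> rfl
  simp only [h0, List.map_id] at this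
  exact of_plainMove this ha hb

end UEq

theorem Letter.strands_exchange {α : Type} (l m : Letter α) (n : ℕ) :
    SymUnion.strands [l, m.raise (l.pos + l.outs)] n =
      SymUnion.strands [m.raise (l.pos + l.ins), l] n := by
  simp only [SymUnion.strands, Letter.strands, Letter.pos_raise, Letter.ins_raise,
    Letter.outs_raise]
  split_ifs with h1 h2 h2
  · simp only [Option.bind_some]
    split_ifs with h3 h4 h4
    · simp; omega
    · omega
    · omega
    · rfl
  · simp only [Option.bind_some, Option.bind_none]
    rw [if_neg (by omega)]; rfl
  · simp only [Option.bind_some, Option.bind_none]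
    omega
  · rfl

/-- The letter `l` lives on the first `n` strands and the whole word `v` to the right of them, so
they can be exchanged letter by letter. -/
theorem UEq.exchange_letter {n m : ℕ} (l : Letter Unit) (hl : l.strands n = some m)
    (v : List (Letter Unit)) {j k : ℕ} (hv : strands v j = some k) :
    UEq (j + n) (k + m) (l :: v.map (Letter.raise m)) (v.map (Letter.raise n) ++ [l]) := by
  induction v generalizing j with
  | nil => exact .refl _
  | cons x v ih =>
    simp only [strands, Option.bind_eq_some_iff] at hv
    obtain ⟨r, hr, hv⟩ := hv
    have h1 := ih hv
    have hn : l.pos + l.ins ≤ n ∧ m = n - l.ins + l.outs := by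
      simp only [Letter.strands] at hl
      split_ifs at hl with h
      simp only [Option.some.injEq] at hl
      exact ⟨h, hl.symm⟩
    -- The strands among the first `n` to the right of `l` are counted as part of the shift of `x`,
    -- since the elementary exchange measures positions from `l` itself.
    have hx := PlainMove.exchange l (x.raise (n - l.pos - l.ins))
    rw [Letter.raise_raise, Letter.raise_raise,
      show n - l.pos - l.ins + (l.pos + l.outs) = m by omega,
      show n - l.pos - l.ins + (l.pos + l.ins) = n by omega] at hx
    have hs : strands [x.raise n, l] (j + n) = some (r + m) := by
      have h2 : (x.raise n).strands (j + n) = some (r + n) := by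
        rw [Letter.strands_raise, hr]; rfl
      have h3 := l.strands_add hl r
      simp only [strands, h2, Option.bind_some, add_comm r]
      simp [h3]
    have hs' : strands [l, x.raise m] (j + n) = some (r + m) := by
      have h2 := l.strands_add hl j
      rw [add_comm n, add_comm m] at h2
      have h3 : (x.raise m).strands (j + m) = some (r + m) := by
        rw [Letter.strands_raise, hr]; rfl
      simp [strands, h2, h3]
    have h4 : strands (v.map (Letter.raise m)) (r + m) = some (k + m) := by
      rw [strands_raise, hv]; rfl
    have h5 : strands [x.raise n] (j + n) = some (r + n) := by
      simp only [strands, Letter.strands_raise, hr]; rfl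
    exact ((UEq.of_plainMove hx hs' hs).right h4).trans (h1.left h5)

theorem UEq.exchange {n m : ℕ} {u : List (Letter Unit)} (hu : strands u n = some m)
    {v : List (Letter Unit)} {j k : ℕ} (hv : strands v j = some k) :
    UEq (j + n) (k + m) (u ++ v.map (Letter.raise m)) (v.map (Letter.raise n) ++ u) := by
  induction u generalizing n with
  | nil =>
    simp only [strands, Option.some.injEq] at hu
    subst hu
    simpa using UEq.refl _
  | cons l u ih =>
    simp only [strands, Option.bind_eq_some_iff] at hu
    obtain ⟨r, hr, hu⟩ := hu
    have h1 := ih hu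
    have h2 := UEq.exchange_letter l hr v hv
    have h3 : strands [l] (j + n) = some (j + r) := by
      have := l.strands_add hr j
      simp [strands, add_comm j, this]
    have h4 : strands u (k + r) = some (k + m) := by
      have := strands_add _ hu k
      rwa [add_comm k, add_comm k]
    have h5 := h1.left h3
    have h6 := h2.right h4
    refine h5.trans ?_
    simpa using h6

/-! ### Sweeping a strand across a word -/

/-- The leftmost of `n + 1` strands passes across the others. -/
def sweep (n : ℕ) (o : Bool) : List (Letter Unit) := (List.range n).map fun j => .cross j o

theorem sweep_add (n k : ℕ) (o : Bool) :
    sweep (n + k) o = sweep n o ++ (sweep k o).map (Letter.raise n) := by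
  simp [sweep, List.range_add, Function.comp_def, Letter.raise, add_comm]

theorem strands_sweep (n : ℕ) (o : Bool) : strands (sweep n o) (n + 1) = some (n + 1) := by
  induction n with
  | zero => rfl
  | succ n ih =>
    rw [sweep_add, strands_append, strands_add _ ih 1]
    simp [sweep, strands, Letter.strands, Letter.raise, Letter.pos, Letter.ins, Letter.outs]

end SymUnion

namespace SymUnion

/-- The letter moved to the position `0`. -/
def Letter.ground {α : Type} : Letter α → Letter α
  | .cup _ b => .cup 0 b
  | .cap _ b => .cap 0 b
  | .cross _ o => .cross 0 o

theorem Letter.ground_raise {α : Type} (l : Letter α) : l.ground.raise l.pos = l := by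
  cases l <;> simp [Letter.ground, Letter.raise, Letter.pos]

theorem Letter.strands_ground {α : Type} (l : Letter α) : l.ground.strands l.ins = some l.outs := by
  cases l <;> rfl

/-- For an extremum the strand is moved from one leg to the other and a second Reidemeister move
removes the two crossings. For a crossing it is a third Reidemeister move, allowed since the
sweeping strand has the same level at both of its crossings. -/
theorem UEq.sweep_ground (l : Letter Unit) (o : Bool) :
    UEq (l.ins + 1) (l.outs + 1) (sweep l.ins o ++ [l.ground])
      (l.ground.raise 1 :: sweep l.outs o) := by
  cases l with
  | cup i b =>
    have h1 : UEq 1 3 [.cup 0 (), .cross 1 (!o), .cross 1 o] [.cup 1 (), .cross 0 o, .cross 1 o] := by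
      have := UEq.of_base (n := 1) (m := 3) (.slide_cup (!o)) rfl rfl
      rw [Bool.not_not] at this
      exact this.right (v := [.cross 1 o]) rfl
    have h2 : UEq 1 3 [.cup 0 (), .cross 1 (!o), .cross 1 o] [.cup 0 ()] := by
      have := (UEq.of_base (n := 2) (m := 2) (.r2 (!o)) rfl rfl).raise 1
      rw [Bool.not_not] at this
      exact this.left (u := [.cup 0 ()]) rfl
    exact h2.symm.trans h1
  | cap i b =>
    have h1 : UEq 3 1 [.cross 0 o, .cross 1 o, .cap 0 ()] [.cross 0 o, .cross 0 (!o), .cap 1 ()] :=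
      (UEq.of_base (n := 3) (m := 1) (.slide_cap o) rfl rfl).left (u := [.cross 0 o]) rfl
    have h2 : UEq 3 1 [.cross 0 o, .cross 0 (!o), .cap 1 ()] [.cap 1 ()] :=
      (UEq.of_base (n := 3) (m := 3) (.r2 o) rfl rfl).right (v := [.cap 1 ()]) rfl
    exact h1.trans h2
  | cross i p => exact UEq.of_base (.r3 o o p (.inl rfl)) rfl rfl

/-- The sweep splits into its crossings with the strands to the left of `l`, with those entering
`l`, and with those to the right. The outer two parts are disjoint from `l` and are exchanged with
it; the middle part is `UEq.sweep_ground`. -/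
theorem UEq.sweep_letter (l : Letter Unit) (o : Bool) {n m : ℕ} (h : l.strands n = some m) :
    UEq (n + 1) (m + 1) (sweep n o ++ [l]) (l.raise 1 :: sweep m o) := by
  obtain ⟨q, hn, hm⟩ : ∃ q, n = l.pos + l.ins + q ∧ m = l.pos + l.outs + q := by
    simp only [Letter.strands] at h
    split_ifs at h with hl
    simp only [Option.some.injEq] at h
    exact ⟨n - l.pos - l.ins, by omega, by omega⟩
  subst hn hm
  have hl : ∀ k, strands [l] (l.pos + l.ins + k) = some (l.pos + l.outs + k) := by
    intro k
    simp only [strands, Letter.strands]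
    rw [if_pos (by omega)]
    simp; omega
  have hp := strands_sweep l.pos o
  have hq := strands_sweep q o
  -- the strands to the right of the letter
  have h1 := (UEq.exchange_letter (n := l.pos + l.ins) (m := l.pos + l.outs) l (by simpa [strands] using hl 0)
    (sweep q o) hq).symm
  have h2 := (UEq.sweep_ground l o).raise l.pos
  -- The sweeping strand itself is still to the left of the letter here, hence the letter is raised
  -- by `l.pos + 1`.
  have h3 := (UEq.exchange hp (v := [l.ground]) (j := l.ins) (k := l.outs)
    (by simp [strands, l.strands_ground]))
  have e1 : sweep (l.pos + l.ins + q) o = sweep l.pos o ++ (sweep l.ins o).map (Letter.raise l.pos) ++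
      (sweep q o).map (Letter.raise (l.pos + l.ins)) := by
    rw [sweep_add, sweep_add]
  have e2 : sweep (l.pos + l.outs + q) o = sweep l.pos o ++ (sweep l.outs o).map (Letter.raise l.pos) ++
      (sweep q o).map (Letter.raise (l.pos + l.outs)) := by
    rw [sweep_add, sweep_add]
  have e3 : l.ground.raise (l.pos + 1) = l.raise 1 := by
    rw [← Letter.raise_raise, l.ground_raise]
  simp only [List.map_append, List.map_cons, List.map_nil, Letter.raise_raise, l.ground_raise,
    add_comm 1 l.pos, e3] at h2 h3
  have s1 : strands (sweep l.pos o ++ (sweep l.ins o).map (Letter.raise l.pos))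
      (l.pos + l.ins + q + 1) = some (q + 1 + (l.pos + l.ins)) := by
    rw [← sweep_add, show l.pos + l.ins + q + 1 = l.pos + l.ins + 1 + q by ring,
      strands_add _ (strands_sweep _ _) q]
    congr 1; ring
  have s2 : ∀ k, strands (sweep l.pos o) (k + 1 + l.pos + q) = some (k + 1 + l.pos + q) := by
    intro k
    rw [show k + 1 + l.pos + q = l.pos + 1 + (k + q) by ring, strands_add _ hp]
  have s3 : strands ((sweep q o).map (Letter.raise (l.pos + l.outs))) (l.outs + 1 + l.pos + q) =
      some (l.pos + l.outs + q + 1) := by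
    rw [show l.outs + 1 + l.pos + q = q + 1 + (l.pos + l.outs) by ring, strands_raise, hq]
    simp; ring
  have s4 : strands ((sweep l.outs o).map (Letter.raise l.pos) ++
      (sweep q o).map (Letter.raise (l.pos + l.outs))) (l.outs + (l.pos + 1) + q) =
      some (l.pos + l.outs + q + 1) := by
    have : strands ((sweep l.outs o).map (Letter.raise l.pos)) (l.outs + (l.pos + 1) + q) =
        some (l.outs + 1 + l.pos + q) := by
      rw [show l.outs + (l.pos + 1) + q = (l.outs + 1 + l.pos) + q by ring]
      refine strands_add _ ?_ q
      rw [strands_raise, strands_sweep]; rfl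
    rw [strands_append, this, Option.bind_some, s3]
  have g1 := h1.left s1
  have g2 := ((h2.add q).right s3).left (k := l.pos + l.ins + q + 1)
    (by rw [show l.pos + l.ins + q + 1 = l.ins + 1 + l.pos + q by ring]; exact s2 _)
  have g3 := (h3.add q).right s4
  rw [e1, e2]
  have t1 : l.ins + (l.pos + 1) + q = l.pos + l.ins + q + 1 := by ring
  have t2 : q + 1 + (l.pos + l.outs) = l.pos + l.outs + q + 1 := by ring
  rw [t1] at g3
  rw [t2] at g1
  simp only [List.append_assoc, List.cons_append, List.nil_append] at g1 g2 g3 ⊢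
  exact g1.trans (g2.trans g3)

/-- A strand which is over (or under) everything can be moved across a word. -/
theorem UEq.sweep_word (w : List (Letter Unit)) (o : Bool) {n m : ℕ} (h : strands w n = some m) :
    UEq (n + 1) (m + 1) (sweep n o ++ w) (w.map (Letter.raise 1) ++ sweep m o) := by
  induction w generalizing n with
  | nil =>
    simp only [strands, Option.some.injEq] at h
    subst h
    simpa using UEq.refl _
  | cons l w ih =>
    simp only [strands, Option.bind_eq_some_iff] at h
    obtain ⟨r, hr, h⟩ := h
    have h1 := (UEq.sweep_letter l o hr).right (strands_add w h 1)
    have h2 := (ih h).left (u := [l.raise 1]) (k := n + 1)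
      (by simp [strands, Letter.strands_raise, hr])
    simp only [List.map_cons, List.append_assoc, List.cons_append, List.nil_append] at h1 h2 ⊢
    exact h1.trans h2

end SymUnion

namespace SymUnion

/-! ### Words with blobs and rewriting scripts

Words over `Letter Bool` in which `cap i true` stands for a word from two strands to none, placed at
the strands `i` and `i + 1`. -/

/-- The word placed at a letter. -/
def Letter.fill (X : List (Letter Unit)) : Letter Bool → List (Letter Unit)
  | .cap i true => X.map (Letter.raise i)
  | l => [l.map fun _ => ()]

/-- Fill in the word `X` for the blobs. -/
def fill (X : List (Letter Unit)) (w : List (Letter Bool)) : List (Letter Unit) :=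
  w.flatMap (Letter.fill X)

theorem fill_append (X : List (Letter Unit)) (u v : List (Letter Bool)) :
    fill X (u ++ v) = fill X u ++ fill X v := by simp [fill]

theorem fill_cons (X : List (Letter Unit)) (l : Letter Bool) (v : List (Letter Bool)) :
    fill X (l :: v) = l.fill X ++ fill X v := by simp [fill]

theorem Letter.fill_raise (X : List (Letter Unit)) (l : Letter Bool) (i : ℕ) :
    (l.raise i).fill X = (l.fill X).map (Letter.raise i) := by
  rcases l with ⟨j, _ | _⟩ | ⟨j, _ | _⟩ | ⟨j, o⟩
  case cap.true =>
    change X.map (Letter.raise (j + i)) = (X.map (Letter.raise j)).map (Letter.raise i)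
    rw [List.map_map]
    exact List.map_congr_left fun x _ => (x.raise_raise j i).symm
  all_goals rfl

theorem fill_raise (X : List (Letter Unit)) (w : List (Letter Bool)) (i : ℕ) :
    fill X (w.map (Letter.raise i)) = (fill X w).map (Letter.raise i) := by
  induction w with
  | nil => rfl
  | cons l w ih => simp [fill_cons, Letter.fill_raise, ih]

theorem Letter.strands_fill {X : List (Letter Unit)} (hX : SymUnion.strands X 2 = some 0)
    (l : Letter Bool)    {n m : ℕ} (h : l.strands n = some m) : SymUnion.strands (l.fill X) n = some m := by
  have key : ∀ l : Letter Unit, l.strands n = some m → SymUnion.strands [l] n = some m := by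
    intro l h; simp [SymUnion.strands, h]
  rcases l with ⟨j, b⟩ | ⟨j, _ | _⟩ | ⟨j, o⟩
  · exact key _ h
  · exact key _ h
  · obtain ⟨hj, hm⟩ : j + 2 ≤ n ∧ n - 2 = m := by
      simpa [Letter.strands, Letter.pos, Letter.ins, Letter.outs] using h
    obtain ⟨k, rfl⟩ := Nat.exists_eq_add_of_le hj
    have h1 := SymUnion.strands_raise X 2 j
    rw [hX] at h1
    have h2 := SymUnion.strands_add _ h1 k
    rw [show j + 2 + k = 2 + j + k by ring, Letter.fill, h2]
    simp only [Option.some.injEq]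
    omega
  · exact key _ h

theorem strands_fill {X : List (Letter Unit)} (hX : strands X 2 = some 0) {w : List (Letter Bool)}
    {n m : ℕ} (h : strands w n = some m) : strands (fill X w) n = some m := by
  induction w generalizing n with
  | nil => exact h
  | cons l w ih =>
    simp only [strands, Option.bind_eq_some_iff] at h
    obtain ⟨r, hr, h⟩ := h
    rw [fill_cons, strands_append, l.strands_fill hX hr, Option.bind_some, ih h]

/-- An action on words which is realized by moves, whatever the blobs are. -/
def Realized (f : List (Letter Bool) → Option (List (Letter Bool))) : Prop :=
  ∀ X : List (Letter Unit), strands X 2 = some 0 → ∀ v v' n m, f v = some v' →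
    strands v n = some m → strands v' n = some m → UEq n m (fill X v) (fill X v')

/-- Apply a sequence of actions, each to the part of a word above a given height, and check that the
words fit. -/
def runScript {O : Type} (act : O → List (Letter Bool) → Option (List (Letter Bool))) (n m : ℕ) :
    List (ℕ × O) → List (Letter Bool) → Option (List (Letter Bool))
  | [], w => some w
  | (k, o) :: s, w =>
    match act o (w.drop k) with
    | none => none
    | some v =>
      if strands (w.take k ++ v) n = some m then runScript act n m s (w.take k ++ v) else none

/-- A word changes the number of strands by a fixed amount. So when the lower part of a word is
rewritten, equal totals force equal numbers of strands at the intermediate height. -/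
theorem strands_inj {α : Type} {w : List (Letter α)} {n n' m : ℕ} (h : strands w n = some m)
    (h' : strands w n' = some m) : n = n' := by
  rcases Nat.le_total n n' with hn | hn
  · obtain ⟨k, rfl⟩ := Nat.exists_eq_add_of_le hn
    have := strands_add _ h k
    rw [h'] at this
    simp at this; omega
  · obtain ⟨k, rfl⟩ := Nat.exists_eq_add_of_le hn
    have := strands_add _ h' k
    rw [h] at this
    simp at this; omega

/-- Turns a computation into an equivalence: soundness has to be shown for single actions only,
after which any concrete sequence of moves is data to be evaluated. The blobs stay symbolic, so one
evaluation covers all `X`. -/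
theorem uEq_of_runScript {O : Type} {act : O → List (Letter Bool) → Option (List (Letter Bool))}
    (hact : ∀ o, Realized (act o)) {X : List (Letter Unit)} (hX : strands X 2 = some 0) {n m : ℕ}
    {s : List (ℕ × O)} {w w' : List (Letter Bool)} (hw : strands w n = some m)
    (h : runScript act n m s w = some w') : UEq n m (fill X w) (fill X w') := by
  induction s generalizing w with
  | nil =>
    simp only [runScript, Option.some.injEq] at h
    subst h
    exact .refl _
  | cons o s ih =>
    obtain ⟨k, o⟩ := o
    simp only [runScript] at h
    split at h
    · cases h
    · rename_i v hv
      split_ifs at h with hs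
      refine UEq.trans ?_ (ih hs h)
      obtain ⟨u, z, rfl, hu, hz⟩ : ∃ u z, w = u ++ z ∧ w.take k = u ∧ w.drop k = z :=
        ⟨w.take k, w.drop k, by simp, rfl, rfl⟩
      rw [hz] at hv
      rw [hu] at hs ⊢
      simp only [strands_append, Option.bind_eq_some_iff] at hw hs
      obtain ⟨r, hr, h1⟩ := hw
      obtain ⟨r', hr', h2⟩ := hs
      obtain rfl : r = r' := by simpa [hr] using hr'
      rw [fill_append, fill_append]
      exact (hact o X hX _ _ _ _ hv h1 h2).left (strands_fill hX hr)

/-! ### Exchanges -/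

/-- Exchange the heights of two letters, if possible. If both ways of exchanging are possible, then
the second letter passes to the right if `p`. -/
def exchange (p : Bool) (a b : Letter Bool) : Option (Letter Bool × Letter Bool) :=
  if a.pos + a.outs ≤ b.pos ∧ (p ∨ a.pos < b.pos + b.ins) then
    some (b.ground.raise (b.pos - a.outs + a.ins), a)
  else if b.pos + b.ins ≤ a.pos then
    some (b, a.ground.raise (a.pos - b.ins + b.outs))
  else none

/-- Bring the letter number `d` of a word to the bottom by exchanges. -/
def pull (p : Bool) : ℕ → List (Letter Bool) → Option (List (Letter Bool))
  | 0, v => some v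
  | _ + 1, [] => none
  | d + 1, a :: v =>
    match pull p d v with
    | some (b :: v') => (exchange p a b).map fun x => x.1 :: x.2 :: v'
    | _ => none

/-- A blob is a letter in a script but a whole word after filling in, so the exchange of two words
is needed. -/
theorem uEq_fill_exchange {X : List (Letter Unit)} (hX : strands X 2 = some 0) (l m : Letter Bool)
    {n k : ℕ} (h : strands [l, m.raise (l.pos + l.outs)] n = some k) :
    UEq n k (fill X [l, m.raise (l.pos + l.outs)]) (fill X [m.raise (l.pos + l.ins), l]) := by
  simp only [strands, Option.bind_eq_some_iff] at h
  obtain ⟨r, hr, r', hr', h⟩ := h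
  simp only [Option.some.injEq] at h
  subst h
  have hl : l.pos + l.ins ≤ n := by
    by_contra hl
    simp [Letter.strands, hl] at hr
  obtain ⟨j, rfl⟩ := Nat.exists_eq_add_of_le hl
  have h0 : l.strands (l.pos + l.ins) = some (l.pos + l.outs) := by
    simp only [Letter.strands, le_refl, if_true]
    congr 1; omega
  have h1 := l.strands_add h0 j
  rw [hr, Option.some.injEq] at h1
  subst h1
  rw [add_comm _ j, Letter.strands_raise, Option.map_eq_some_iff] at hr'
  obtain ⟨k, hk, rfl⟩ := hr'
  have := UEq.exchange (l.strands_fill hX h0) (m.strands_fill hX hk)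
  rw [add_comm _ j]
  simpa [fill, Letter.fill_raise] using this

theorem exchange_spec {p : Bool} {a b b' a' : Letter Bool} (h : exchange p a b = some (b', a')) :
    (∃ l m : Letter Bool, a = l ∧ b = m.raise (l.pos + l.outs) ∧
      b' = m.raise (l.pos + l.ins) ∧ a' = l) ∨
    (∃ l m : Letter Bool, b = l ∧ a' = m.raise (l.pos + l.outs) ∧
      a = m.raise (l.pos + l.ins) ∧ b' = l) := by
  simp only [exchange] at h
  split_ifs at h with h1 h2
  · simp only [Option.some.injEq, Prod.mk.injEq] at h
    obtain ⟨rfl, rfl⟩ := h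
    refine .inl ⟨a, b.ground.raise (b.pos - a.pos - a.outs), rfl, ?_, ?_, rfl⟩
    · rw [Letter.raise_raise, show b.pos - a.pos - a.outs + (a.pos + a.outs) = b.pos by omega,
        b.ground_raise]
    · rw [Letter.raise_raise]; congr 1; omega
  · simp only [Option.some.injEq, Prod.mk.injEq] at h
    obtain ⟨rfl, rfl⟩ := h
    refine .inr ⟨b, a.ground.raise (a.pos - b.pos - b.ins), rfl, ?_, ?_, rfl⟩
    · rw [Letter.raise_raise]; congr 1; omega
    · rw [Letter.raise_raise, show a.pos - b.pos - b.ins + (b.pos + b.ins) = a.pos by omega,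
        a.ground_raise]

theorem uEq_of_exchange {X : List (Letter Unit)} (hX : strands X 2 = some 0) {p : Bool}
    {a b b' a' : Letter Bool} (h : exchange p a b = some (b', a')) {n m : ℕ}
    (hs : strands [a, b] n = some m) :
    strands [b', a'] n = some m ∧ UEq n m (fill X [a, b]) (fill X [b', a']) := by
  rcases exchange_spec h with ⟨l, x, rfl, rfl, rfl, rfl⟩ | ⟨l, x, rfl, rfl, rfl, rfl⟩
  · exact ⟨by rw [← Letter.strands_exchange, hs], uEq_fill_exchange hX _ _ hs⟩
  · rw [← Letter.strands_exchange] at hs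
    exact ⟨hs, (uEq_fill_exchange hX _ _ hs).symm⟩

theorem uEq_of_pull {X : List (Letter Unit)} (hX : strands X 2 = some 0) {p : Bool} {d : ℕ}
    {v v' : List (Letter Bool)} (h : pull p d v = some v') {n m : ℕ} (hs : strands v n = some m) :
    strands v' n = some m ∧ UEq n m (fill X v) (fill X v') := by
  induction d generalizing v v' n with
  | zero =>
    simp only [pull, Option.some.injEq] at h
    subst h
    exact ⟨hs, .refl _⟩
  | succ d ih =>
    cases v with
    | nil => simp [pull] at h
    | cons a v =>
      simp only [pull] at h
      split at h
      · rename_i b w hw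
        simp only [Option.map_eq_some_iff, Prod.exists] at h
        obtain ⟨b', a', hab, rfl⟩ := h
        simp only [strands, Option.bind_eq_some_iff] at hs
        obtain ⟨r, hr, hs⟩ := hs
        obtain ⟨h1, h2⟩ := ih hw hs
        simp only [strands, Option.bind_eq_some_iff] at h1
        obtain ⟨r', hr', h1⟩ := h1
        have hab' : strands [a, b] n = some r' := by simp [strands, hr, hr']
        obtain ⟨h3, h4⟩ := uEq_of_exchange hX hab hab'
        refine ⟨by rw [show b' :: a' :: w = [b', a'] ++ w from rfl, strands_append, h3,
          Option.bind_some, h1], ?_⟩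
        have h5 := h2.left (a.strands_fill hX hr)
        have h6 := h4.right (strands_fill hX h1)
        rw [← fill_append, ← fill_append] at h6
        rw [← fill_cons, ← fill_cons] at h5
        exact h5.trans h6
      · cases h

theorem realized_pull (p : Bool) (d : ℕ) : Realized (pull p d) :=
  fun _ hX _ _ _ _ h hs _ => (uEq_of_pull hX h hs).2

/-! ### Local rules -/

/-- Replace the bottom part `a` of a word, at the strand `i`, by `b`. -/
def replace (a b : List (Letter Bool)) (i : ℕ) (v : List (Letter Bool)) :
    Option (List (Letter Bool)) :=
  if v.take a.length = a.map (Letter.raise i) then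
    some (b.map (Letter.raise i) ++ v.drop a.length)
  else none

/-- Two words which are equivalent whatever the blobs are. -/
def LocalEq (a b : List (Letter Bool)) : Prop :=
  ∀ X : List (Letter Unit), strands X 2 = some 0 → ∀ n m, strands a n = some m →
    strands b n = some m → UEq n m (fill X a) (fill X b)

theorem LocalEq.symm {a b : List (Letter Bool)} (h : LocalEq a b) : LocalEq b a :=
  fun X hX n m ha hb => (h X hX n m hb ha).symm

theorem le_of_strands_raise {α : Type} {w : List (Letter α)} (hw : w ≠ []) {i n m : ℕ}
    (h : strands (w.map (Letter.raise i)) n = some m) : i ≤ n := by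
  cases w with
  | nil => exact absurd rfl hw
  | cons l w =>
    by_contra hi
    simp only [List.map_cons, strands, Letter.strands, Letter.pos_raise] at h
    rw [if_neg (by omega)] at h
    cases h

theorem LocalEq.realized_replace {a b : List (Letter Bool)} (h : LocalEq a b) (i : ℕ) :
    Realized (replace a b i) := by
  intro X hX v v' n m hv hs hs'
  simp only [replace] at hv
  split_ifs at hv with ha
  simp only [Option.some.injEq] at hv
  subst hv
  obtain ⟨w, rfl⟩ : ∃ w, v = a.map (Letter.raise i) ++ w :=
    ⟨v.drop a.length, by rw [← ha, List.take_append_drop]⟩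
  rw [List.drop_left' (by simp)] at hs' ⊢
  rw [strands_append, Option.bind_eq_some_iff] at hs hs'
  obtain ⟨r, hr, hs⟩ := hs
  obtain ⟨r', hr', hs'⟩ := hs'
  obtain rfl := strands_inj hs hs'
  rw [fill_append, fill_append]
  refine UEq.right ?_ (strands_fill hX hs)
  by_cases hab : a = [] ∧ b = []
  · obtain ⟨rfl, rfl⟩ := hab
    exact .refl _
  -- At least one of the two sides has a letter at a position `≥ i`, so there are `i` strands on the
  -- left to be split off.
  · have hi : i ≤ n := by
      by_cases ha : a = []
      · exact le_of_strands_raise (fun hb => hab ⟨ha, hb⟩) hr'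
      · exact le_of_strands_raise ha hr
    obtain ⟨j, rfl⟩ := Nat.exists_eq_add_of_le' hi
    rw [strands_raise, Option.map_eq_some_iff] at hr hr'
    obtain ⟨q, hq, rfl⟩ := hr
    obtain ⟨q', hq', hqq⟩ := hr'
    obtain rfl : q' = q := by omega
    rw [fill_raise, fill_raise]
    exact (h X hX _ _ hq hq').raise i

/-- The basic local rules. -/
inductive Rule : Type
  | zigzag_right
  | zigzag_left
  | slide_cup (o : Bool)
  | slide_cap (o : Bool)
  | r1_right (o : Bool)
  | r1_left (o : Bool)
  | r2 (o : Bool)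
  | r3 (o p : Bool) (b : Bool)
  | blob (o : Bool)

namespace Rule

/-- The left hand side of a rule. -/
def lhs : Rule → List (Letter Bool)
  | zigzag_right => [.cup 0 false, .cap 1 false]
  | zigzag_left => [.cup 1 false, .cap 0 false]
  | slide_cup o => [.cup 0 false, .cross 1 o]
  | slide_cap o => [.cross 1 o, .cap 0 false]
  | r1_right o => [.cup 1 false, .cross 0 o, .cap 1 false]
  | r1_left o => [.cup 0 false, .cross 1 o, .cap 0 false]
  | r2 o => [.cross 0 o, .cross 0 (!o)]
  | r3 o p b => [.cross 0 o, .cross 1 (cond b o p), .cross 0 p]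
  | blob o => [.cross 0 o, .cross 1 o, .cap 0 true]

/-- The right hand side of a rule. -/
def rhs : Rule → List (Letter Bool)
  | slide_cup o => [.cup 1 false, .cross 0 (!o)]
  | slide_cap o => [.cross 0 (!o), .cap 1 false]
  | r3 o p b => [.cross 1 p, .cross 0 (cond b o p), .cross 1 o]
  | blob _ => [.cap 1 true]
  | _ => []

/-- All rules except `blob` are elementary moves. The rule `blob` is `UEq.sweep_word` for the word
`X` itself, where the sweep below meets two strands and the one above meets none. -/
theorem localEq (r : Rule) : LocalEq r.lhs r.rhs := by
  intro X hX n m h h'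
  have base : ∀ a b : List (Letter Bool), BaseMove (fill X a) (fill X b) →
      strands a n = some m → strands b n = some m → UEq n m (fill X a) (fill X b) :=
    fun a b hab ha hb => .of_base hab (strands_fill hX ha) (strands_fill hX hb)
  cases r with
  | zigzag_right => exact base _ _ .zigzag_right h h'
  | zigzag_left => exact base _ _ .zigzag_left h h'
  | slide_cup o => exact base _ _ (.slide_cup o) h h'
  | slide_cap o => exact base _ _ (.slide_cap o) h h'
  | r1_right o => exact base _ _ (.r1_right o) h h'
  | r1_left o => exact base _ _ (.r1_left o) h h'
  | r2 o => exact base _ _ (.r2 o) h h'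
  | r3 o p b => exact base _ _ (.r3 o (cond b o p) p (by cases b <;> simp)) h h'
  | blob o =>
    have hn : 3 ≤ n := by
      by_contra hn
      simp [rhs, strands, Letter.strands, Letter.pos, Letter.ins, hn] at h'
    obtain ⟨k, rfl⟩ := Nat.exists_eq_add_of_le hn
    obtain rfl : m = 1 + k := by
      have : strands (rhs (blob o)) (3 + k) = some (1 + k) := strands_add _ rfl k
      rw [this] at h'
      simpa using h'.symm
    have h0 : (Letter.raise 0 : Letter Unit → Letter Unit) = id := by funext x; cases x <;> rfl
    have := (UEq.sweep_word X o hX).add k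
    simpa [sweep, List.range_succ, fill, lhs, rhs, Letter.fill, Letter.map, h0] using this

end Rule

/-- A system of local rules. -/
class RuleSystem (R : Type) where
  /-- The left hand side of a rule. -/
  lhs : R → List (Letter Bool)
  /-- The right hand side of a rule. -/
  rhs : R → List (Letter Bool)
  localEq : ∀ r, LocalEq (lhs r) (rhs r)

instance : RuleSystem Rule := ⟨Rule.lhs, Rule.rhs, Rule.localEq⟩

/-- Exchanges and the local rules of a system, in both directions. -/
inductive RuleOp (R : Type) : Type
  | pull (p : Bool) (d : ℕ)
  | rule (r : R) (i : ℕ)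
  | unrule (r : R) (i : ℕ)

/-- The action of an operation on words. -/
def RuleOp.act {R : Type} [RuleSystem R] : RuleOp R → List (Letter Bool) → Option (List (Letter Bool))
  | pull p d => SymUnion.pull p d
  | rule r i => replace (RuleSystem.lhs r) (RuleSystem.rhs r) i
  | unrule r i => replace (RuleSystem.rhs r) (RuleSystem.lhs r) i

theorem RuleOp.realized {R : Type} [RuleSystem R] (o : RuleOp R) : Realized o.act := by
  cases o with
  | pull p d => exact realized_pull p d
  | rule r i => exact (RuleSystem.localEq r).realized_replace i
  | unrule r i => exact (RuleSystem.localEq r).symm.realized_replace i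

/-- The scripts `s` and `t` transform two words on `n` strands into the same word. -/
def confluent {O : Type} (act : O → List (Letter Bool) → Option (List (Letter Bool))) (n : ℕ)
    (a b : List (Letter Bool)) (s t : List (ℕ × O)) : Bool :=
  match strands a n with
  | none => false
  | some m => strands b n = some m ∧ (runScript act n m s a).isSome ∧
      runScript act n m s a = runScript act n m t b

theorem uEq_of_confluent {O : Type} {act : O → List (Letter Bool) → Option (List (Letter Bool))}
    (hact : ∀ o, Realized (act o)) {X : List (Letter Unit)} (hX : strands X 2 = some 0) {n m : ℕ}
    {a b : List (Letter Bool)} {s t : List (ℕ × O)} (h : confluent act n a b s t)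
    (ha : strands a n = some m) : UEq n m (fill X a) (fill X b) := by
  simp only [confluent, ha, decide_eq_true_eq] at h
  obtain ⟨hb, hs, hst⟩ := h
  obtain ⟨c, hc⟩ := Option.isSome_iff_exists.1 hs
  exact (uEq_of_runScript hact hX ha hc).trans (uEq_of_runScript hact hX hb (hst ▸ hc)).symm

/-- It suffices to run the scripts on the least number `n` of strands on which `a` fits, as further
strands on the right do not interfere; `hn` says that `n` is the least. -/
theorem localEq_of_confluent {R : Type} [RuleSystem R] (n : ℕ) (s t : List (ℕ × RuleOp R))
    {a b : List (Letter Bool)} (h : confluent RuleOp.act n a b s t)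
    (hn : n = 0 ∨ strands a (n - 1) = none) : LocalEq a b := by
  intro X hX k m ha hb
  have hk : n ≤ k := by
    by_contra hk
    rcases hn with rfl | hn
    · omega
    · have := strands_add _ ha (n - 1 - k)
      rw [show k + (n - 1 - k) = n - 1 by omega, hn] at this
      cases this
  obtain ⟨j, rfl⟩ := Nat.exists_eq_add_of_le hk
  cases hr : strands a n with
  | none => simp [confluent, hr] at h
  | some r =>
    have h1 := strands_add _ hr j
    obtain rfl : r + j = m := by rw [ha] at h1; simpa using h1.symm
    exact (uEq_of_confluent RuleOp.realized hX h hr).add j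

end SymUnion

namespace SymUnion

/-! ### Derived rules: curls at extrema and knots tied into a strand -/

/-- The basic rules, the passage of a strand across a blob from the right, and the removal of a
curl at an extremum. -/
inductive CurlRule : Type
  | basic (r : Rule)
  | blob_left (o : Bool)
  | curl_cup (o : Bool)
  | curl_cap (o : Bool)

namespace CurlRule

/-- The left hand side of a rule. -/
def lhs : CurlRule → List (Letter Bool)
  | basic r => r.lhs
  | blob_left o => [.cross 1 o, .cross 0 o, .cap 1 true]
  | curl_cup o => [.cup 0 false, .cross 0 o]
  | curl_cap o => [.cross 0 o, .cap 0 false]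

/-- The right hand side of a rule. -/
def rhs : CurlRule → List (Letter Bool)
  | basic r => r.rhs
  | blob_left _ => [.cap 0 true]
  | curl_cup _ => [.cup 0 false]
  | curl_cap _ => [.cap 0 false]

/-- The rule `blob_left` reverses the passage `blob` and cancels the crossings by second
Reidemeister moves. In the other two the curl at an extremum is turned into a curl on a vertical
strand by a zigzag, where the first Reidemeister move applies. -/
theorem localEq (r : CurlRule) : LocalEq r.lhs r.rhs := by
  cases r with
  | basic r => exact r.localEq
  | blob_left o =>
    exact localEq_of_confluent (R := Rule) 3 [(2, .unrule (.blob (!o)) 0)]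
      [(0, .unrule (.r2 o) 1), (1, .unrule (.r2 o) 0)] (by revert o; decide +kernel) (.inr rfl)
  | curl_cup o =>
    exact localEq_of_confluent (R := Rule) 0 [(1, .unrule .zigzag_left 0)]
      [(1, .unrule (.r1_left (!o)) 0), (0, .pull true 1), (1, .unrule (.slide_cup o) 1),
        (2, .pull true 1)] (by revert o; decide +kernel) (.inl rfl)
  | curl_cap o =>
    exact localEq_of_confluent (R := Rule) 2
      [(0, .unrule .zigzag_right 1), (1, .pull true 1), (0, .unrule (.slide_cup (!o)) 0),
        (2, .pull true 1)] [(0, .unrule (.r1_left (!o)) 0)] (by revert o; decide +kernel) (.inr rfl)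

instance : RuleSystem CurlRule := ⟨lhs, rhs, localEq⟩

end CurlRule

/-- The rules which slide a blob which is tied into a strand along this strand, across crossings and
past extrema. On the strand `i` the blob is tied in on the left by `cup i`, blob `i + 1`, or on the
right by `cup (i + 1)`, blob `i`. -/
inductive KnotRule : Type
  | curl (r : CurlRule)
  | right_up (o : Bool)
  | right_down (o : Bool)
  | left_up (o : Bool)
  | left_down (o : Bool)
  | cap
  | cup
  | cap_left
  | cap_right

namespace KnotRule

/-- The left hand side of a rule. -/
def lhs : KnotRule → List (Letter Bool)
  | curl r => r.lhs
  | right_up o => [.cup 1 false, .cap 0 true, .cross 0 o]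
  | right_down o => [.cup 2 false, .cap 1 true, .cross 0 o]
  | left_up o => [.cup 0 false, .cap 1 true, .cross 0 o]
  | left_down o => [.cup 1 false, .cap 2 true, .cross 0 o]
  | cap => [.cup 2 false, .cap 1 true, .cap 0 false]
  | cup => [.cup 0 false, .cup 1 false, .cap 2 true]
  | cap_left => [.cup 1 false, .cap 0 true, .cap 0 false]
  | cap_right => [.cup 1 false, .cap 2 true, .cap 0 false]

/-- The right hand side of a rule. -/
def rhs : KnotRule → List (Letter Bool)
  | curl r => r.rhs
  | right_up o => [.cross 0 o, .cup 2 false, .cap 1 true]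
  | right_down o => [.cross 0 o, .cup 1 false, .cap 0 true]
  | left_up o => [.cross 0 o, .cup 1 false, .cap 2 true]
  | left_down o => [.cross 0 o, .cup 0 false, .cap 1 true]
  | cap => [.cup 0 false, .cap 1 true, .cap 0 false]
  | cup => [.cup 0 false, .cup 1 false, .cap 0 true]
  | cap_left => [.cap 0 true]
  | cap_right => [.cap 0 true]

/-- A knot passes a crossing because the other strand is over, or under, all of it: the strand is
swept across the blob and then slid along the small minimum which ties the blob in. At an extremum
the knot changes legs and also the side on which it is tied in. The last two rules close up a
knotted strand, leaving the blob alone. -/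
theorem localEq (r : KnotRule) : LocalEq r.lhs r.rhs := by
  cases r with
  | curl r => exact r.localEq
  | right_up o =>
    exact localEq_of_confluent (R := CurlRule) 2
      [(1, .pull true 1), (0, .rule (.basic (.slide_cup o)) 1)]
      [(0, .pull true 1), (2, .unrule (.basic (.blob (!o))) 0), (1, .rule (.basic (.r2 o)) 0)]
      (by revert o; decide +kernel) (.inr rfl)
  | right_down o =>
    exact localEq_of_confluent (R := CurlRule) 2
      [(1, .unrule (.basic (.blob o)) 0), (0, .pull true 1),
        (1, .unrule (.basic (.slide_cup (!o))) 1), (2, .pull true 1), (3, .rule (.basic (.r2 (!o))) 0)]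
      [] (by revert o; decide +kernel) (.inr rfl)
  | left_up o =>
    exact localEq_of_confluent (R := CurlRule) 2
      [(1, .unrule (.blob_left o) 1), (0, .pull true 1), (1, .rule (.basic (.slide_cup o)) 0),
        (2, .pull true 1), (3, .rule (.basic (.r2 (!o))) 0)]
      [] (by revert o; decide +kernel) (.inr rfl)
  | left_down o =>
    exact localEq_of_confluent (R := CurlRule) 2
      [(1, .pull true 1), (0, .unrule (.basic (.slide_cup (!o))) 0)]
      [(0, .pull true 1), (2, .unrule (.blob_left (!o)) 1), (1, .rule (.basic (.r2 o)) 2)]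
      (by revert o; decide +kernel) (.inr rfl)
  | cap =>
    exact localEq_of_confluent (R := CurlRule) 2
      [(1, .unrule (.basic (.blob false)) 0), (3, .pull true 1), (0, .pull true 1),
        (1, .rule (.basic (.r1_right false)) 1)]
      [(1, .unrule (.blob_left false) 1), (3, .pull true 1), (0, .pull true 1),
        (1, .rule (.basic (.r1_left false)) 0)] (by decide +kernel) (.inr rfl)
  | cup =>
    exact localEq_of_confluent (R := CurlRule) 0
      [(2, .unrule (.basic (.blob false)) 1), (1, .rule (.curl_cup false) 1),
        (1, .rule (.basic (.slide_cup false)) 1), (0, .pull true 1),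
        (1, .rule (.basic (.slide_cup true)) 0)]
      [(2, .unrule (.blob_left false) 0), (1, .rule (.curl_cup false) 1)]
      (by decide +kernel) (.inl rfl)
  | cap_left =>
    exact localEq_of_confluent (R := CurlRule) 2
      [(1, .pull true 1), (0, .rule (.basic .zigzag_right) 1)] [] (by decide +kernel) (.inr rfl)
  | cap_right =>
    exact localEq_of_confluent (R := CurlRule) 2
      [(1, .pull true 1), (0, .rule (.basic .zigzag_left) 0)] [] (by decide +kernel) (.inr rfl)

instance : RuleSystem KnotRule := ⟨lhs, rhs, localEq⟩

end KnotRule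

end SymUnion

namespace SymUnion

theorem strands_blob : strands [.cap 0 ()] 2 = some 0 := rfl

/-- Scripts for words without blobs. -/
theorem uEq_of_scripts {R : Type} [RuleSystem R] (a b : List (Letter Bool))
    (s t : List (ℕ × RuleOp R)) {n m : ℕ} (h : confluent RuleOp.act n a b s t)
    (ha : strands a n = some m) : UEq n m (fill [.cap 0 ()] a) (fill [.cap 0 ()] b) :=
  uEq_of_confluent RuleOp.realized strands_blob h ha

/-! ### Flypes of plats with four strands -/

/-- The word `v` on four strands can be absorbed by `S`. -/
def Absorbs (S v : List (Letter Unit)) : Prop := strands v 4 = some 4 ∧ UEq 4 0 (v ++ S) S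

section

variable {S u v w : List (Letter Unit)}

theorem Absorbs.append (hu : Absorbs S u) (hv : Absorbs S v) : Absorbs S (u ++ v) := by
  refine ⟨by rw [strands_append, hu.1, Option.bind_some, hv.1], ?_⟩
  rw [List.append_assoc]
  exact (hv.2.left hu.1).trans hu.2

/-- Together with `Absorbs.append` this lets the absorbed braids be treated as a group. -/
theorem Absorbs.of_inverse (hS : strands S 4 = some 0) (hv : Absorbs S v)
    (hu : strands u 4 = some 4) (h : UEq 4 4 (u ++ v) []) : Absorbs S u := by
  refine ⟨hu, (hv.2.left hu).symm.trans ?_⟩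
  have := h.right hS
  rwa [List.append_assoc] at this

/-- If `S` absorbs the conjugate `v` of `u` by `l`, then `u` moves past `l`, becomes `v` and is
absorbed. -/
theorem Absorbs.cons {l : Letter Unit} (hl : strands [l] 4 = some 4) (hS : strands S 4 = some 0)
    (hu : strands u 4 = some 4) (hv : Absorbs S v) (h : UEq 4 4 (u ++ [l]) (l :: v)) :
    Absorbs (l :: S) u := by
  refine ⟨hu, ?_⟩
  have h1 := h.right hS
  have h2 := hv.2.left hl
  simp only [List.append_assoc, List.cons_append, List.nil_append] at h1 h2
  exact h1.trans h2

/-- The pure braid `σ₀ σ₂⁻¹`. -/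
def flypeX : List (Letter Unit) := [.cross 0 true, .cross 2 false]

/-- The inverse of `flypeX`. -/
def flypeXInv : List (Letter Unit) := [.cross 2 true, .cross 0 false]

/-- The conjugate of `flypeX` by `σ₁`. -/
def flypeY : List (Letter Unit) :=
  [.cross 1 true, .cross 0 true, .cross 2 false, .cross 1 false]

/-- The inverse of `flypeY`. -/
def flypeYInv : List (Letter Unit) :=
  [.cross 1 true, .cross 2 true, .cross 0 false, .cross 1 false]

/-- Words from four strands to none which absorb the kernel of the map from the braid group on four
strands to the braid group on three strands. -/
structure IsPlat (S : List (Letter Unit)) : Prop where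
  strands : strands S 4 = some 0
  absorbs_x : Absorbs S flypeX
  absorbs_y : Absorbs S flypeY

theorem IsPlat.absorbs_xInv (h : IsPlat S) : Absorbs S flypeXInv :=
  h.absorbs_x.of_inverse h.strands rfl
    (uEq_of_scripts (R := Rule) [.cross 2 true, .cross 0 false, .cross 0 true, .cross 2 false] []
      [(1, .rule (.r2 false) 0), (0, .rule (.r2 true) 2)] [] (by decide +kernel) rfl)

theorem IsPlat.absorbs_yInv (h : IsPlat S) : Absorbs S flypeYInv :=
  h.absorbs_y.of_inverse h.strands rfl
    (uEq_of_scripts (R := Rule) [.cross 1 true, .cross 2 true, .cross 0 false, .cross 1 false,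
        .cross 1 true, .cross 0 true, .cross 2 false, .cross 1 false] []
      [(3, .rule (.r2 false) 1), (2, .rule (.r2 false) 0), (1, .rule (.r2 true) 2),
        (0, .rule (.r2 true) 1)] [] (by decide +kernel) rfl)

/-- The subgroup generated by `flypeX` and `flypeY` is normal: the conjugates of both by each
crossing are words in them and their inverses. -/
theorem IsPlat.cons {i : ℕ} (hi : i ≤ 2) (o : Bool) (h : IsPlat S) : IsPlat (.cross i o :: S) := by
  have hx := h.absorbs_x
  have hy := h.absorbs_y
  have hX := h.absorbs_xInv
  have hY := h.absorbs_yInv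
  have key : ∀ (l : Letter Unit), SymUnion.strands [l] 4 = some 4 → ∀ v v', Absorbs S v →
      Absorbs S v' → UEq 4 4 (flypeX ++ [l]) (l :: v) → UEq 4 4 (flypeY ++ [l]) (l :: v') →
      IsPlat (l :: S) := fun l hl v v' hv hv' e e' =>
    ⟨by rw [← List.singleton_append, strands_append, hl, Option.bind_some, h.strands],
      hv.cons hl h.strands rfl e, hv'.cons hl h.strands rfl e'⟩
  -- In each of the six cases the absorbed words handed to `key` spell out the conjugates of
  -- `flypeX` and of `flypeY`; the braid identities are checked by scripts.
  interval_cases i <;> cases o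
  · refine key _ rfl _ _ hx (hy.append hX) ?_ ?_
    · exact uEq_of_scripts (R := Rule)
        [.cross 0 true, .cross 2 false, .cross 0 false]
        [.cross 0 false, .cross 0 true, .cross 2 false]
        [(1, .pull true 1), (0, .rule (.r2 true) 0)]
        [(0, .rule (.r2 false) 0)] (by decide +kernel) rfl
    · exact uEq_of_scripts (R := Rule)
        [.cross 1 true, .cross 0 true, .cross 2 false, .cross 1 false, .cross 0 false]
        [.cross 0 false, .cross 1 true, .cross 0 true, .cross 2 false, .cross 1 false,
          .cross 2 true, .cross 0 false]
        [(4, .unrule (.r2 false) 2), (4, .pull true 2)]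
        [(5, .pull true 1), (0, .rule (.r3 false true false) 0), (2,
          .rule (.r3 false false false) 1), (4, .pull true 1)] (by decide +kernel) rfl
  · refine key _ rfl _ _ hx (hy.append hx) ?_ ?_
    · exact uEq_of_scripts (R := Rule)
        [.cross 0 true, .cross 2 false, .cross 0 true]
        [.cross 0 true, .cross 0 true, .cross 2 false]
        [(1, .pull true 1)]
        [] (by decide +kernel) rfl
    · exact uEq_of_scripts (R := Rule)
        [.cross 1 true, .cross 0 true, .cross 2 false, .cross 1 false, .cross 0 true]
        [.cross 0 true, .cross 1 true, .cross 0 true, .cross 2 false, .cross 1 false,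
          .cross 0 true, .cross 2 false]
        [(4, .unrule (.r2 true) 2), (4, .pull true 2)]
        [(0, .rule (.r3 true true false) 0), (2, .rule (.r3 true false false) 1), (4,
          .pull true 1)] (by decide +kernel) rfl
  · refine key _ rfl _ _ hy ((hy.append hX).append hy) ?_ ?_
    · exact uEq_of_scripts (R := Rule)
        [.cross 0 true, .cross 2 false, .cross 1 false]
        [.cross 1 false, .cross 1 true, .cross 0 true, .cross 2 false, .cross 1 false]
        [(0, .unrule (.r2 false) 1)]
        [] (by decide +kernel) rfl
    · exact uEq_of_scripts (R := Rule)
        [.cross 1 true, .cross 0 true, .cross 2 false, .cross 1 false, .cross 1 false]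
        [.cross 1 false, .cross 1 true, .cross 0 true, .cross 2 false, .cross 1 false,
          .cross 2 true, .cross 0 false, .cross 1 true, .cross 0 true, .cross 2 false,
            .cross 1 false]
        [(0, .unrule (.r2 false) 2), (3, .pull true 1), (1, .unrule (.r3 false true false) 1)]
        [(5, .pull true 1), (0, .rule (.r2 false) 1), (0, .pull true 1), (1,
          .rule (.r3 true false false) 0), (3, .rule (.r3 true true false) 1), (5, .pull true 1),
            (6, .rule (.r2 true) 2), (2, .pull true 1), (3,
              .rule (.r3 false true false) 0)] (by decide +kernel) rfl
  · refine key _ rfl _ _ ((hx.append hY).append hx) hx ?_ ?_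
    · exact uEq_of_scripts (R := Rule)
        [.cross 0 true, .cross 2 false, .cross 1 true]
        [.cross 1 true, .cross 0 true, .cross 2 false, .cross 1 true, .cross 2 true,
          .cross 0 false, .cross 1 false, .cross 0 true, .cross 2 false]
        [(3, .unrule (.r2 false) 0)]
        [(4, .pull true 1), (1, .pull true 1), (2, .rule (.r3 true false true) 0), (4,
          .rule (.r3 true false true) 1), (6, .pull true 1), (7, .rule (.r2 true) 2), (0,
            .rule (.r3 true false false) 1), (2, .pull true 1), (3, .rule (.r2 true) 2), (1,
              .unrule (.r3 true false true) 0), (0, .pull true 1)] (by decide +kernel) rfl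
    · exact uEq_of_scripts (R := Rule)
        [.cross 1 true, .cross 0 true, .cross 2 false, .cross 1 false, .cross 1 true]
        [.cross 1 true, .cross 0 true, .cross 2 false]
        [(3, .rule (.r2 false) 1)]
        [] (by decide +kernel) rfl
  · refine key _ rfl _ _ hx (hX.append hy) ?_ ?_
    · exact uEq_of_scripts (R := Rule)
        [.cross 0 true, .cross 2 false, .cross 2 false]
        [.cross 2 false, .cross 0 true, .cross 2 false]
        []
        [(0, .pull true 1)] (by decide +kernel) rfl
    · exact uEq_of_scripts (R := Rule)
        [.cross 1 true, .cross 0 true, .cross 2 false, .cross 1 false, .cross 2 false]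
        [.cross 2 false, .cross 2 true, .cross 0 false, .cross 1 true, .cross 0 true,
          .cross 2 false, .cross 1 false]
        [(2, .unrule (.r3 false false false) 1), (0, .unrule (.r3 false true false) 0)]
        [(0, .pull true 2), (1, .rule (.r2 false) 2)] (by decide +kernel) rfl
  · refine key _ rfl _ _ hx (hx.append hy) ?_ ?_
    · exact uEq_of_scripts (R := Rule)
        [.cross 0 true, .cross 2 false, .cross 2 true]
        [.cross 2 true, .cross 0 true, .cross 2 false]
        [(1, .rule (.r2 false) 2)]
        [(0, .pull true 1), (1, .rule (.r2 true) 2)] (by decide +kernel) rfl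
    · exact uEq_of_scripts (R := Rule)
        [.cross 1 true, .cross 0 true, .cross 2 false, .cross 1 false, .cross 2 true]
        [.cross 2 true, .cross 0 true, .cross 2 false, .cross 1 true, .cross 0 true,
          .cross 2 false, .cross 1 false]
        [(2, .unrule (.r3 true false false) 1), (0, .unrule (.r3 true true false) 0)]
        [(0, .pull true 1), (1, .rule (.r2 true) 2)] (by decide +kernel) rfl

/-- The crossings of `flypeX` are curls at the two maxima. In `flypeY` strands are slid over the
maxima until everything cancels in pairs. -/
theorem isPlat_caps : IsPlat [.cap 0 (), .cap 0 ()] where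
  strands := rfl
  absorbs_x := ⟨rfl, uEq_of_scripts (R := CurlRule)
    [.cross 0 true, .cross 2 false, .cap 0 false, .cap 0 false] [.cap 0 false, .cap 0 false]
    [(1, .pull true 1), (2, .rule (.curl_cap false) 0), (0, .pull true 2)]
    [(0, .unrule (.curl_cap true) 0), (0, .pull true 2)] (by decide +kernel) rfl⟩
  absorbs_y := ⟨rfl, uEq_of_scripts (R := Rule)
    [.cross 1 true, .cross 0 true, .cross 2 false, .cross 1 false, .cap 0 false, .cap 0 false]
    [.cap 0 false, .cap 0 false]
    [(4, .pull true 1), (3, .unrule (.slide_cap true) 1), (2, .rule (.r2 false) 2),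
      (1, .unrule (.slide_cap false) 0), (0, .rule (.r2 true) 1)] [] (by decide +kernel) rfl⟩

/-- A flype: in a plat with four strands a crossing of the first two strands can be replaced by a
crossing of the last two strands. -/
theorem IsPlat.flype (h : IsPlat S) (o : Bool) :
    UEq 4 0 (.cross 2 o :: S) (.cross 0 o :: S) := by
  have h1 : Absorbs S [.cross 0 o, .cross 2 (!o)] := by
    cases o
    · refine ⟨rfl, UEq.trans (UEq.right (m := 4) ?_ h.strands) h.absorbs_xInv.2⟩
      exact uEq_of_scripts (R := Rule) [.cross 0 false, .cross 2 true] [.cross 2 true,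
        .cross 0 false]
        [(0, .pull true 1)] [] (by decide +kernel) rfl
    · exact h.absorbs_x
  have h2 : UEq 4 4 [.cross 2 o, .cross 0 o, .cross 2 (!o)] [.cross 0 o] := by
    cases o
    · exact uEq_of_scripts (R := Rule) [.cross 2 false, .cross 0 false,
      .cross 2 true] [.cross 0 false]
        [(0, .pull true 1), (1, .rule (.r2 false) 2)] [] (by decide +kernel) rfl
    · exact uEq_of_scripts (R := Rule) [.cross 2 true, .cross 0 true,
      .cross 2 false] [.cross 0 true]
        [(0, .pull true 1), (1, .rule (.r2 true) 2)] [] (by decide +kernel) rfl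
  -- The plat emits a crossing of the first two strands and the opposite crossing of the last two;
  -- the latter cancels the given one.
  exact (h1.2.left (u := [.cross 2 o]) rfl).symm.trans (h2.right h.strands)

end

/-! ### Moving a plat across its lower end -/

/-- On the right side `R` has an extra strand to its left. Sweep this strand back across `R`: it
then forms, together with the minimum below, a part disjoint from `R` which simplifies to the left
side. -/
theorem uEq_endpass (R : List (Letter Unit)) (hR : strands R 4 = some 0) (o : Bool) :
    UEq 2 0 (.cup 2 () :: .cross 1 o :: R)
      (.cup 0 () :: .cross 1 (!o) :: .cup 4 () :: (R.map (Letter.raise 1) ++ [.cap 0 ()])) := by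
  have h0 : (Letter.raise 0 : Letter Unit → Letter Unit) = id := by funext x; cases x <;> rfl
  have h1 := ((UEq.sweep_word R (!o) hR).add 1).right (v := [.cap 0 ()]) (l := 0) rfl
  have h2 := h1.left (u := [.cup 0 (), .cross 1 (!o), .cup 4 ()]) (k := 2) rfl
  have h3 := (UEq.exchange hR (v := [.cap 0 ()]) (j := 2) (k := 0) rfl).left
    (u := [.cup 0 (), .cross 1 (!o), .cup 4 ()] ++ sweep 4 (!o)) (k := 2) rfl
  -- The part below `R` after the sweep: the strand ends to the right of the four strands of `R`,
  -- where its maximum has become `cap 4`.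
  have h4 : UEq 2 4 ([.cup 0 (), .cross 1 (!o), .cup 4 ()] ++ sweep 4 (!o) ++ [.cap 4 ()])
      [.cup 2 (), .cross 1 o] := by
    cases o
    · exact uEq_of_scripts (R := CurlRule) [.cup 0 false, .cross 1 true, .cup 4 false,
          .cross 0 true, .cross 1 true, .cross 2 true, .cross 3 true, .cap 4 false]
        [.cup 2 false, .cross 1 false] 
        [(2, .pull true 1), (3, .pull true 1), (4, .pull true 1), (5,
          .rule (.basic (.r1_right true)) 3), (0, .rule (.basic (.slide_cup true)) 0), (1,
            .rule (.basic (.r2 false)) 0)]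
        [(0, .unrule (.basic (.slide_cup true)) 1), (0,
          .unrule (.curl_cup true) 1)] (by decide +kernel) rfl
    · exact uEq_of_scripts (R := CurlRule) [.cup 0 false, .cross 1 false, .cup 4 false,
          .cross 0 false, .cross 1 false, .cross 2 false, .cross 3 false, .cap 4 false]
        [.cup 2 false, .cross 1 true] 
        [(2, .pull true 1), (3, .pull true 1), (4, .pull true 1), (5,
          .rule (.basic (.r1_right false)) 3), (0, .rule (.basic (.slide_cup false)) 0), (1,
            .rule (.basic (.r2 true)) 0)]
        [(0, .unrule (.basic (.slide_cup false)) 1), (0,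
          .unrule (.curl_cup false) 1)] (by decide +kernel) rfl
  have h5 := h4.right hR
  simp only [h0, Letter.raise, List.map_cons, List.map_nil, List.append_assoc,
    List.cons_append, List.nil_append, show sweep 0 (!o) = [] from rfl] at h2 h3 h5 ⊢
  exact h5.symm.trans (h3.symm.trans h2)

theorem uEq_endpass_mirror (R : List (Letter Unit)) (hR : strands R 4 = some 0) (o : Bool) :
    UEq 2 0 (.cup 0 () :: .cross 1 o :: R)
      (.cup 2 () :: .cross 1 (!o) :: .cup 0 () :: (R.map (Letter.raise 1) ++ [.cap 0 ()])) := by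
  have h0 : (Letter.raise 0 : Letter Unit → Letter Unit) = id := by funext x; cases x <;> rfl
  have h1 := ((UEq.sweep_word R o hR).add 1).right (v := [.cap 0 ()]) (l := 0) rfl
  have h2 := h1.left (u := [.cup 2 (), .cross 1 (!o), .cup 0 ()]) (k := 2) rfl
  have h3 := (UEq.exchange hR (v := [.cap 0 ()]) (j := 2) (k := 0) rfl).left
    (u := [.cup 2 (), .cross 1 (!o), .cup 0 ()] ++ sweep 4 o) (k := 2) rfl
  have h4 : UEq 2 4 ([.cup 2 (), .cross 1 (!o), .cup 0 ()] ++ sweep 4 o ++ [.cap 4 ()])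
      [.cup 0 (), .cross 1 o] := by
    cases o
    · exact uEq_of_scripts (R := CurlRule) [.cup 2 false, .cross 1 true, .cup 0 false,
          .cross 0 false, .cross 1 false, .cross 2 false, .cross 3 false, .cap 4 false]
        [.cup 0 false, .cross 1 false] 
        [(0, .pull true 2), (2, .pull true 1), (3, .pull true 1), (0, .pull true 1), (1,
          .rule (.curl_cup false) 0), (0, .pull true 1), (3,
            .unrule (.basic (.r3 false true true)) 2), (5, .pull true 1), (1, .pull true 1), (2,
              .pull true 1), (3, .rule (.basic (.r1_right false)) 3), (2,
                .rule (.basic (.r2 false)) 2)]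
        [] (by decide +kernel) rfl
    · exact uEq_of_scripts (R := CurlRule) [.cup 2 false, .cross 1 false, .cup 0 false,
          .cross 0 true, .cross 1 true, .cross 2 true, .cross 3 true, .cap 4 false]
        [.cup 0 false, .cross 1 true] 
        [(0, .pull true 2), (2, .pull true 1), (3, .pull true 1), (0, .pull true 1), (1,
          .rule (.curl_cup true) 0), (0, .pull true 1), (3,
            .unrule (.basic (.r3 true false true)) 2), (5, .pull true 1), (1, .pull true 1), (2,
              .pull true 1), (3, .rule (.basic (.r1_right true)) 3), (2,
                .rule (.basic (.r2 true)) 2)]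
        [] (by decide +kernel) rfl
  have h5 := h4.right hR
  simp only [h0, Letter.raise, List.map_cons, List.map_nil, List.append_assoc,
    List.cons_append, List.nil_append, show sweep 0 o = [] from rfl] at h2 h3 h5 ⊢
  exact h5.symm.trans (h3.symm.trans h2)

end SymUnion

namespace SymUnion

/-! ### Scripts for plats -/

/-- Recognize a word in crossings of four strands which is closed by `cap 0`, `cap 0`. -/
def isPlatWord : List (Letter Bool) → Bool
  | [.cap 0 false, .cap 0 false] => true
  | .cross i _ :: w => decide (i ≤ 2) && isPlatWord w
  | _ => false

theorem strands_cross {α : Type} {i n : ℕ} (h : i + 2 ≤ n) (o : Bool) (w : List (Letter α)) :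
    strands (.cross i o :: w) n = strands w n := by
  have : (Letter.cross i o : Letter α).strands n = some n := by
    simp [Letter.strands, Letter.pos, Letter.ins, Letter.outs, h]
    omega
  simp [strands, this]

theorem isPlat_of_isPlatWord {X : List (Letter Unit)} (w : List (Letter Bool))
    (h : isPlatWord w) : IsPlat (fill X w) ∧ strands w 4 = some 0 := by
  induction w using isPlatWord.induct with
  | case1 => exact ⟨isPlat_caps, rfl⟩
  | case2 i o w ih =>
    simp only [isPlatWord, Bool.and_eq_true, decide_eq_true_eq] at h
    obtain ⟨h1, h2⟩ := ih h.2
    exact ⟨h1.cons h.1 o, by rw [strands_cross (by omega), h2]⟩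
  | case3 w h1 h2 => simp [isPlatWord] at h

/-- Operations on words: exchanges, local rules, flypes of plats with four strands, and moving a
word across its lower end. -/
inductive PlatOp : Type
  | pull (p : Bool) (d : ℕ)
  | rule (r : CurlRule) (i : ℕ)
  | unrule (r : CurlRule) (i : ℕ)
  | flype
  | endpass (mirror : Bool)
  | unendpass (mirror : Bool)

/-- Replace a crossing of the first two strands by a crossing of the last two strands in a plat, or
conversely. -/
def flypeAct : List (Letter Bool) → Option (List (Letter Bool))
  | .cross i o :: w =>
    if (i = 0 ∨ i = 2) ∧ isPlatWord w then some (.cross (2 - i) o :: w) else none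
  | _ => none

/-- Move a word across its lower end. -/
def endpassAct (mirror : Bool) : List (Letter Bool) → Option (List (Letter Bool))
  | .cup i false :: .cross 1 o :: w =>
    if i = cond mirror 0 2 ∧ strands w 4 = some 0 then
      some (.cup (2 - i) false :: .cross 1 (!o) :: .cup (cond mirror 0 4) false ::
        (w.map (Letter.raise 1) ++ [.cap 0 false]))
    else none
  | _ => none

/-- The inverse of `endpassAct`. -/
def unendpassAct (mirror : Bool) : List (Letter Bool) → Option (List (Letter Bool))
  | .cup i false :: .cross 1 o :: l :: w =>
    let u := Letter.cup (2 - i) false :: Letter.cross 1 (!o) ::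
      w.dropLast.map fun x => x.ground.raise (x.pos - 1)
    if endpassAct mirror u = some (.cup i false :: .cross 1 o :: l :: w) then some u else none
  | _ => none

/-- A word which closes off all of its `n` strands cannot fit on fewer, so every other use of it
just has additional strands on the right. -/
theorem UEq.of_strands {n m k l : ℕ} {a b c : List (Letter Unit)} (h : UEq n m a b)
    (hc : strands c n = some m) (hc' : strands c k = some l) (hm : m = 0) : UEq k l a b := by
  subst hm
  have hk : n ≤ k := by
    by_contra hk
    have := strands_add _ hc' (n - k)
    rw [show k + (n - k) = n by omega, hc] at this
    simp at this; omega
  obtain ⟨j, rfl⟩ := Nat.exists_eq_add_of_le hk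
  obtain rfl : l = 0 + j := by
    have := strands_add _ hc j
    rw [hc'] at this
    simpa using this
  exact h.add j

theorem realized_flype : Realized flypeAct := by
  intro X hX v v' n m hv hs hs'
  match v, hv with
  | .cross i o :: w, hv =>
    simp only [flypeAct] at hv
    split_ifs at hv with h
    simp only [Option.some.injEq] at hv
    subst hv
    obtain ⟨hi, hw⟩ := h
    obtain ⟨h1, h2⟩ := isPlat_of_isPlatWord (X := X) w hw
    have h3 := h1.flype o
    have h4 : ∀ i, i ≤ 2 → strands (.cross i o :: w) 4 = some 0 := by
      intro i hi
      rw [strands_cross (by omega), h2]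
    rcases hi with rfl | rfl
    · exact h3.symm.of_strands (strands_fill hX (h4 0 (by omega))) (strands_fill hX hs) rfl
    · exact h3.of_strands (strands_fill hX (h4 2 (by omega))) (strands_fill hX hs) rfl

theorem realized_endpass (mirror : Bool) : Realized (endpassAct mirror) := by
  intro X hX v v' n m hv hs hs'
  match v, hv with
  | .cup i false :: .cross 1 o :: w, hv =>
    simp only [endpassAct] at hv
    split_ifs at hv with h
    simp only [Option.some.injEq] at hv
    subst hv
    obtain ⟨rfl, hw⟩ := h
    have hw' := strands_fill hX hw
    cases mirror
    · have h1 := uEq_endpass (fill X w) hw' o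
      have h2 : strands (.cup 2 false :: .cross 1 o :: w) 2 = some 0 := hw
      have := h1.of_strands (strands_fill hX h2) (strands_fill hX hs) rfl
      rw [← fill_raise] at this
      simpa [fill_cons, fill_append, Letter.fill, Letter.map, fill] using this
    · have h1 := uEq_endpass_mirror (fill X w) hw' o
      have h2 : strands (.cup 0 false :: .cross 1 o :: w) 2 = some 0 := hw
      have := h1.of_strands (strands_fill hX h2) (strands_fill hX hs) rfl
      rw [← fill_raise] at this
      simpa [fill_cons, fill_append, Letter.fill, Letter.map, fill] using this

theorem realized_unendpass (mirror : Bool) : Realized (unendpassAct mirror) := by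
  intro X hX v v' n m hv hs hs'
  match v, hv with
  | .cup i false :: .cross 1 o :: l :: w, hv =>
    simp only [unendpassAct] at hv
    split_ifs at hv with h
    simp only [Option.some.injEq] at hv
    subst hv
    -- The word found by `unendpassAct` is accepted only if `endpassAct` leads back from it, so no
    -- separate argument is needed.
    exact (realized_endpass mirror X hX _ _ n m h hs' hs).symm

/-- The action of an operation on words. -/
def PlatOp.act : PlatOp → List (Letter Bool) → Option (List (Letter Bool))
  | pull p d => RuleOp.act (R := CurlRule) (.pull p d)
  | rule r i => RuleOp.act (.rule r i)
  | unrule r i => RuleOp.act (.unrule r i)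
  | flype => flypeAct
  | endpass m => endpassAct m
  | unendpass m => unendpassAct m

theorem PlatOp.realized (o : PlatOp) : Realized o.act := by
  cases o with
  | pull p d => exact RuleOp.realized (R := CurlRule) (.pull p d)
  | rule r i => exact RuleOp.realized (.rule r i)
  | unrule r i => exact RuleOp.realized (.unrule r i)
  | flype => exact realized_flype
  | endpass m => exact realized_endpass m
  | unendpass m => exact realized_unendpass m

/-- Scripts for words without blobs, with flypes. -/
theorem uEq_of_platScripts (a b : List (Letter Bool)) (s t : List (ℕ × PlatOp)) {n m : ℕ}
    (h : confluent PlatOp.act n a b s t) (ha : strands a n = some m) :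
    UEq n m (fill [.cap 0 ()] a) (fill [.cap 0 ()] b) :=
  uEq_of_confluent PlatOp.realized strands_blob h ha

end SymUnion

namespace SymUnion

/-! ### The summands -/

/-- The full diagram of `mid89`. -/
def block89 (o : Bool) : List (Letter Bool) :=
  [.cup 2 false, .cup 0 false, .cross 3 true, .cross 1 false, .cross 2 o, .cross 3 true,
    .cross 1 false, .cross 3 true, .cross 1 false, .cross 2 (!o), .cross 3 true, .cross 1 false,
    .cross 2 o, .cross 3 true, .cross 1 false, .cap 4 false, .cap 0 false]

/-- The full diagram of `mid1042`. -/
def block1042 : List (Letter Bool) :=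
  [.cup 2 false, .cup 0 false, .cross 3 false, .cross 1 true, .cross 2 false, .cross 3 false,
    .cross 1 true, .cross 2 true, .cross 3 false, .cross 1 true, .cross 2 false, .cross 3 false,
    .cross 1 true, .cross 2 true, .cross 4 true, .cross 0 false, .cross 3 false, .cross 1 true,
    .cap 4 false, .cap 0 false]

/-- The full diagram of `mid1042'`. -/
def block1042' : List (Letter Bool) :=
  [.cup 2 false, .cup 0 false, .cross 3 false, .cross 1 true, .cross 3 false, .cross 1 true,
    .cross 2 true, .cross 3 false, .cross 1 true, .cross 2 false, .cross 3 false, .cross 1 true,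
    .cross 4 true, .cross 0 false, .cross 3 false, .cross 1 true, .cap 4 false, .cap 0 false]

/-- The knot at the top is regarded as tied into the left end there and is pushed along the arc of
the block, which comes out at the right end at the bottom. -/
theorem uEq_knot_block89 (o : Bool) {X : List (Letter Unit)} (hX : strands X 2 = some 0) :
    UEq 2 0 (fill X (block89 o ++ [.cap 0 true]))
      (fill X ([.cup 2 false, .cap 1 true] ++ block89 o ++ [.cap 0 false])) :=
  uEq_of_confluent (RuleOp.realized (R := KnotRule)) hX (t := [])
    (s := [(17, .unrule .cap_left 0), (16, .pull true 1), (17, .pull true 1), (15, .pull false 1),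
      (16, .pull false 1), (14, .unrule (.right_up false) 1), (13, .pull false 1), (14,
      .pull false 1), (12, .pull false 1), (13, .pull false 1), (11,
      .unrule (.right_down false) 1), (10, .pull false 1), (11, .pull false 1), (9,
      .unrule (.right_down (!o)) 2), (8, .pull true 1), (9, .pull true 1), (7,
      .unrule (.right_down true) 3), (6, .pull true 1), (7, .pull true 1), (5,
      .unrule (.right_up true) 3), (4, .unrule (.right_up o) 2), (3, .unrule (.right_up false) 1),
      (2, .pull false 1), (3, .pull false 1), (1, .pull true 1), (3, .pull true 1), (2,
      .pull true 1), (4, .pull true 1), (3, .pull true 1), (5, .pull true 1), (4, .pull true 1),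
      (6, .pull true 1), (5, .pull true 1), (7, .pull true 1), (6, .pull true 1), (8,
      .pull true 1), (7, .pull true 1), (9, .pull true 1), (8, .pull true 1), (10, .pull true 1),
      (9, .pull true 1), (11, .pull true 1), (10, .pull true 1), (12, .pull true 1), (11,
      .pull true 1), (13, .pull true 1), (12, .pull true 1), (14, .pull true 1), (13,
      .pull true 1), (15, .pull true 1), (14, .pull true 1), (16, .pull true 1), (15,
      .pull true 1), (16, .unrule .cap 0), (15, .pull false 1), (16, .pull false 1), (14,
      .unrule (.right_down false) 1), (13, .pull false 1), (14, .pull false 1), (12,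
      .unrule (.right_down o) 2), (11, .pull true 1), (12, .pull true 1), (10,
      .unrule (.right_down true) 3), (9, .pull true 1), (10, .pull true 1), (8, .pull true 1), (9,
      .pull true 1), (7, .unrule (.right_up true) 3), (6, .pull true 1), (7, .pull true 1), (5,
      .unrule (.right_down true) 3), (4, .pull true 1), (5, .pull true 1), (3, .pull true 1), (4,
      .pull true 1), (2, .unrule (.right_up true) 3), (1, .pull true 1), (2, .pull true 1), (0,
      .pull false 1), (1, .pull false 1)])
    (by revert o; decide +kernel) (by cases o <;> rfl)

/-- The same journey along the other arc, from the right end at the top to the left end at the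
bottom. It is needed for reversing sums. -/
theorem uEq_knot_block89_left {X : List (Letter Unit)} (hX : strands X 2 = some 0) :
    UEq 2 0 (fill X (block89 false ++ [.cap 0 true]))
      (fill X ([.cup 0 false, .cap 1 true] ++ block89 false ++ [.cap 0 false])) :=
  uEq_of_confluent (RuleOp.realized (R := KnotRule)) hX (t := [])
    (s := [(17, .unrule .cap_right 0), (16, .pull true 1), (17, .pull true 1), (15, .pull false 1),
      (16, .pull false 1), (14, .pull true 1), (15, .pull true 1), (13,
      .unrule (.left_down true) 3), (12, .pull true 1), (13, .pull true 1), (11, .pull true 1),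
      (12, .pull true 1), (10, .unrule (.left_up true) 3), (9, .unrule (.left_up true) 2), (8,
      .unrule (.left_up false) 1), (7, .pull false 1), (8, .pull false 1), (6,
      .unrule (.left_down false) 1), (5, .pull false 1), (6, .pull false 1), (4,
      .unrule (.left_down false) 2), (3, .pull true 1), (4, .pull true 1), (2,
      .unrule (.left_down true) 3), (1, .pull true 1), (2, .pull true 1), (0, .pull true 1), (2,
      .pull false 1), (1, .pull false 1), (3, .pull false 1), (2, .pull false 1), (4,
      .pull false 1), (3, .pull false 1), (5, .pull false 1), (4, .pull false 1), (6,
      .pull false 1), (5, .pull false 1), (7, .pull false 1), (6, .pull false 1), (8,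
      .pull false 1), (7, .pull false 1), (9, .pull false 1), (8, .pull false 1), (10,
      .pull false 1), (9, .pull false 1), (11, .pull false 1), (10, .pull false 1), (12,
      .pull false 1), (11, .pull false 1), (13, .pull false 1), (12, .pull false 1), (14,
      .pull false 1), (13, .pull false 1), (15, .pull false 1), (14, .pull false 1), (15,
      .rule .cap 4), (14, .pull true 1), (15, .pull true 1), (13, .unrule (.left_up true) 3), (12,
      .unrule (.left_up false) 2), (11, .unrule (.left_up false) 1), (10, .pull false 1), (11,
      .pull false 1), (9, .pull false 1), (10, .pull false 1), (8, .unrule (.left_down false) 1),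
      (7, .pull false 1), (8, .pull false 1), (6, .unrule (.left_up false) 1), (5, .pull false 1),
      (6, .pull false 1), (4, .pull false 1), (5, .pull false 1), (3,
      .unrule (.left_down false) 1), (2, .pull false 1), (3, .pull false 1), (1, .pull true 1), (2,
      .pull true 1), (0, .pull false 1), (1, .pull false 1)])
    (by decide +kernel) rfl

/-- Unlike in `block89`, the left end at the top is connected to the left end at the bottom, so the
knot arrives on the strand `0`. -/
theorem uEq_knot_block1042 {X : List (Letter Unit)} (hX : strands X 2 = some 0) :
    UEq 2 0 (fill X (block1042 ++ [.cap 0 true]))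
      (fill X ([.cup 1 false, .cap 0 true] ++ block1042 ++ [.cap 0 false])) :=
  uEq_of_confluent (RuleOp.realized (R := KnotRule)) hX (t := [])
    (s := [(20, .unrule .cap_left 0), (19, .pull true 1), (20, .pull true 1), (18, .pull false 1),
      (19, .pull false 1), (17, .unrule (.right_up true) 1), (16, .pull false 1), (17,
      .pull false 1), (15, .unrule (.right_up false) 0), (14, .pull false 1), (15, .pull false 1),
      (13, .pull false 1), (14, .pull false 1), (12, .pull false 1), (13, .pull false 1), (11,
      .pull false 1), (12, .pull false 1), (10, .pull false 1), (11, .pull false 1), (9,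
      .pull false 1), (10, .pull false 1), (8, .pull false 1), (9, .pull false 1), (7,
      .pull false 1), (8, .pull false 1), (6, .pull false 1), (7, .pull false 1), (5,
      .pull false 1), (6, .pull false 1), (4, .pull false 1), (5, .pull false 1), (3,
      .pull false 1), (4, .pull false 1), (2, .pull false 1), (3, .pull false 1), (1,
      .unrule .cup 0), (3, .pull true 1), (2, .pull true 1), (3, .rule (.left_up true) 1), (4,
      .rule (.left_up false) 2), (5, .rule (.left_up false) 3), (7, .pull false 1), (6,
      .pull false 1), (8, .pull false 1), (7, .pull false 1), (8, .rule (.left_down false) 3), (10,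
      .pull false 1), (9, .pull false 1), (10, .rule (.left_down false) 2), (12, .pull true 1),
      (11, .pull true 1), (12, .rule (.left_down true) 1), (14, .pull true 1), (13, .pull true 1),
      (15, .pull true 1), (14, .pull true 1), (15, .rule (.left_down false) 0), (17, .pull true 1),
      (16, .pull true 1), (18, .pull true 1), (17, .pull true 1), (19, .pull true 1), (18,
      .pull true 1), (19, .unrule .cap 0), (18, .pull false 1), (19, .pull false 1), (17,
      .unrule (.right_down true) 1), (16, .pull false 1), (17, .pull false 1), (15, .pull true 1),
      (16, .pull true 1), (14, .pull false 1), (15, .pull false 1), (13,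
      .unrule (.right_down true) 2), (12, .pull true 1), (13, .pull true 1), (11,
      .unrule (.right_down false) 3), (10, .pull true 1), (11, .pull true 1), (9, .pull true 1),
      (10, .pull true 1), (8, .unrule (.right_up false) 3), (7, .unrule (.right_up true) 2), (6,
      .unrule (.right_up true) 1), (5, .pull false 1), (6, .pull false 1), (4, .pull false 1), (5,
      .pull false 1), (3, .unrule (.right_down true) 1), (2, .pull false 1), (3, .pull false 1),
      (1, .pull true 1), (2, .pull true 1), (0, .pull false 1), (1, .pull false 1)])
    (by decide +kernel) rfl

theorem uEq_knot_block1042_left {X : List (Letter Unit)} (hX : strands X 2 = some 0) :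
    UEq 2 0 (fill X (block1042 ++ [.cap 0 true]))
      (fill X ([.cup 1 false, .cap 2 true] ++ block1042 ++ [.cap 0 false])) :=
  uEq_of_confluent (RuleOp.realized (R := KnotRule)) hX (t := [])
    (s := [(20, .unrule .cap_right 0), (19, .pull true 1), (20, .pull true 1), (18, .pull false 1),
      (19, .pull false 1), (17, .pull true 1), (18, .pull true 1), (16,
      .unrule (.left_down false) 3), (15, .pull true 1), (16, .pull true 1), (14,
      .unrule (.left_down true) 4), (13, .pull true 1), (14, .pull true 1), (12, .pull true 1),
      (13, .pull true 1), (11, .pull true 1), (12, .pull true 1), (10, .pull true 1), (11,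
      .pull true 1), (9, .pull true 1), (10, .pull true 1), (8, .pull true 1), (9, .pull true 1),
      (7, .pull true 1), (8, .pull true 1), (6, .pull true 1), (7, .pull true 1), (5,
      .pull true 1), (6, .pull true 1), (4, .pull true 1), (5, .pull true 1), (3, .pull true 1),
      (4, .pull true 1), (2, .pull true 1), (3, .pull true 1), (1, .pull true 1), (2,
      .pull true 1), (0, .rule .cup 2), (2, .pull false 1), (1, .pull false 1), (2,
      .rule (.right_down false) 3), (4, .pull false 1), (3, .pull false 1), (4,
      .rule (.right_down false) 2), (6, .pull true 1), (5, .pull true 1), (6,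
      .rule (.right_down true) 1), (8, .pull true 1), (7, .pull true 1), (9, .pull true 1), (8,
      .pull true 1), (9, .rule (.right_up true) 1), (10, .rule (.right_up false) 2), (11,
      .rule (.right_up false) 3), (13, .pull false 1), (12, .pull false 1), (14, .pull false 1),
      (13, .pull false 1), (14, .rule (.right_up true) 4), (16, .pull false 1), (15,
      .pull false 1), (17, .pull false 1), (16, .pull false 1), (18, .pull false 1), (17,
      .pull false 1), (18, .rule .cap 4), (17, .pull true 1), (18, .pull true 1), (16,
      .unrule (.left_up false) 3), (15, .pull true 1), (16, .pull true 1), (14, .pull false 1),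
      (15, .pull false 1), (13, .unrule (.left_up true) 2), (12, .unrule (.left_up true) 1), (11,
      .pull false 1), (12, .pull false 1), (10, .pull false 1), (11, .pull false 1), (9,
      .unrule (.left_down true) 1), (8, .pull false 1), (9, .pull false 1), (7,
      .unrule (.left_down true) 2), (6, .pull true 1), (7, .pull true 1), (5,
      .unrule (.left_down false) 3), (4, .pull true 1), (5, .pull true 1), (3, .pull true 1), (4,
      .pull true 1), (2, .unrule (.left_up false) 3), (1, .pull true 1), (2, .pull true 1), (0,
      .pull false 1), (1, .pull false 1)])
    (by decide +kernel) rfl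

theorem uEq_knot_block1042' {X : List (Letter Unit)} (hX : strands X 2 = some 0) :
    UEq 2 0 (fill X (block1042' ++ [.cap 0 true]))
      (fill X ([.cup 1 false, .cap 0 true] ++ block1042' ++ [.cap 0 false])) :=
  uEq_of_confluent (RuleOp.realized (R := KnotRule)) hX (t := [])
    (s := [(18, .unrule .cap_left 0), (17, .pull true 1), (18, .pull true 1), (16, .pull false 1),
      (17, .pull false 1), (15, .unrule (.right_up true) 1), (14, .pull false 1), (15,
      .pull false 1), (13, .unrule (.right_up false) 0), (12, .pull false 1), (13, .pull false 1),
      (11, .pull false 1), (12, .pull false 1), (10, .pull false 1), (11, .pull false 1), (9,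
      .pull false 1), (10, .pull false 1), (8, .pull false 1), (9, .pull false 1), (7,
      .pull false 1), (8, .pull false 1), (6, .pull false 1), (7, .pull false 1), (5,
      .pull false 1), (6, .pull false 1), (4, .pull false 1), (5, .pull false 1), (3,
      .pull false 1), (4, .pull false 1), (2, .pull false 1), (3, .pull false 1), (1,
      .unrule .cup 0), (3, .pull true 1), (2, .pull true 1), (3, .rule (.left_up true) 1), (5,
      .pull true 1), (4, .pull true 1), (5, .rule (.left_down true) 1), (7, .pull true 1), (6,
      .pull true 1), (8, .pull true 1), (7, .pull true 1), (8, .rule (.left_up true) 1), (9,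
      .rule (.left_up false) 2), (10, .rule (.left_up false) 3), (12, .pull false 1), (11,
      .pull false 1), (12, .rule (.left_up true) 4), (14, .pull false 1), (13, .pull false 1), (15,
      .pull false 1), (14, .pull false 1), (16, .pull false 1), (15, .pull false 1), (16,
      .rule .cap_right 4), (16, .unrule .cap_left 4), (15, .pull true 1), (16, .pull true 1), (14,
      .unrule (.right_up false) 3), (13, .pull true 1), (14, .pull true 1), (12, .pull false 1),
      (13, .pull false 1), (11, .pull true 1), (12, .pull true 1), (10,
      .unrule (.right_down false) 3), (9, .pull true 1), (10, .pull true 1), (8, .pull true 1), (9,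
      .pull true 1), (7, .unrule (.right_up false) 3), (6, .unrule (.right_up true) 2), (5,
      .unrule (.right_up true) 1), (4, .pull false 1), (5, .pull false 1), (3,
      .unrule (.right_down true) 1), (2, .pull false 1), (3, .pull false 1), (1, .pull true 1), (2,
      .pull true 1), (0, .pull false 1), (1, .pull false 1)])
    (by decide +kernel) rfl

/-! ### Reduction of the closed summands to plats with four strands -/

/-- A plat of `8_9`. -/
def plat89 : List (Letter Bool) :=
  [.cup 2 false, .cross 1 true, .cross 0 false, .cross 0 false, .cross 1 true, .cross 2 false,
    .cross 1 true, .cross 1 true, .cross 1 true, .cap 0 false, .cap 0 false]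

/-- Another plat of `8_9`. -/
def plat89' : List (Letter Bool) :=
  [.cup 2 false, .cross 1 false, .cross 0 true, .cross 2 true, .cross 1 false, .cross 0 true,
    .cross 1 false, .cross 1 false, .cross 1 false, .cap 0 false, .cap 0 false]

/-- A plat of `10_42`. -/
def plat1042 : List (Letter Bool) :=
  [.cup 2 false, .cross 1 true, .cross 0 false, .cross 1 true, .cross 0 false, .cross 1 true,
    .cross 0 false, .cross 1 true, .cross 1 true, .cross 0 false, .cross 1 true, .cap 0 false,
    .cap 0 false]

/-- Another plat of `10_42`. -/
def plat1042' : List (Letter Bool) :=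
  [.cup 2 false, .cross 1 false, .cross 1 false, .cross 0 true, .cross 0 true, .cross 1 false,
    .cross 0 true, .cross 1 false, .cross 0 true, .cross 1 false, .cross 1 false, .cap 0 false,
    .cap 0 false]

/-- A plat of `10_42` with eleven crossings. -/
def plat1042'' : List (Letter Bool) :=
  [.cup 2 false, .cross 1 true, .cross 0 false, .cross 1 true, .cross 1 true, .cross 0 true,
    .cross 0 true, .cross 1 false, .cross 0 true, .cross 0 true, .cross 1 false, .cross 1 false,
    .cap 0 false, .cap 0 false]

/-- Another plat of `10_42` with eleven crossings. -/
def plat1042''' : List (Letter Bool) :=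
  [.cup 2 false, .cross 1 false, .cross 1 false, .cross 0 true, .cross 1 false, .cross 2 false,
    .cross 2 false, .cross 1 true, .cross 0 false, .cross 1 true, .cross 0 false, .cross 1 true,
    .cap 0 false, .cap 0 false]

theorem uEq_block89_plat :
    UEq 2 0 (fill [.cap 0 ()] (block89 false ++ [.cap 0 false]))
      (fill [.cap 0 ()] (plat89)) :=
  uEq_of_platScripts _ _
    [(7, .pull true 1), (8, .unrule (.basic (.r3 true true false)) 2), (10,
      .unrule (.basic (.r3 false true true)) 1), (12, .pull true 1), (13,
      .rule (.basic (.r2 true)) 1), (5, .pull true 1), (3,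
      .rule (.basic (.r3 false false false)) 1), (6, .pull true 1), (4,
      .rule (.basic (.r3 false false false)) 1), (6, .rule (.basic (.r3 false true false)) 2), (8,
      .rule (.basic (.r2 false)) 3), (1, .pull true 1), (2, .pull true 1), (3, .pull true 1), (4,
      .rule (.basic (.slide_cup false)) 0), (7, .unrule (.basic (.r3 false true true)) 1), (9,
      .pull true 1), (10, .pull true 1), (11, .rule (.basic (.slide_cap true)) 0), (5,
      .pull true 1), (8, .pull true 3), (6, .rule (.basic (.r3 true false false)) 0), (4,
      .pull true 1), (5, .rule (.curl_cup false) 1), (9, .unrule (.basic (.slide_cap false)) 3),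
      (8, .pull true 1), (9, .unrule (.basic (.slide_cap true)) 2), (7, .pull true 1), (8,
      .pull true 1), (9, .unrule (.basic (.slide_cap false)) 1), (5, .pull true 2), (6,
      .pull true 2), (8, .pull true 1), (7, .rule (.basic (.slide_cup false)) 1), (8,
      .pull true 3), (7, .rule (.basic .zigzag_right) 2), (8, .unrule (.basic (.slide_cap true)) 0)]
    []
    (by decide +kernel) rfl

theorem uEq_block89_plat' :
    UEq 2 0 (fill [.cap 0 ()] (block89 true ++ [.cap 0 false]))
      (fill [.cap 0 ()] (plat89')) :=
  uEq_of_platScripts _ _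
    [(10, .pull true 1), (8, .rule (.basic (.r3 false false false)) 1), (10,
      .rule (.basic (.r3 false true false)) 2), (12, .rule (.basic (.r2 false)) 3), (2,
      .pull true 1), (3, .unrule (.basic (.r3 true true false)) 2), (6, .pull true 1), (4,
      .unrule (.basic (.r3 true true false)) 2), (6, .unrule (.basic (.r3 false true true)) 1), (8,
      .rule (.basic (.r2 true)) 1), (0, .pull true 1), (1, .pull true 1), (2, .pull true 1), (3,
      .pull true 1), (4, .unrule (.basic (.slide_cup false)) 3), (7,
      .rule (.basic (.r3 false true false)) 2), (9, .pull true 1), (10,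
      .unrule (.basic (.slide_cap true)) 3), (5, .pull true 1), (8, .pull true 2), (6,
      .unrule (.basic (.r3 true false true)) 3), (4, .pull true 1), (5, .rule (.curl_cup true) 3),
      (9, .pull true 1), (10, .rule (.basic (.slide_cap false)) 0), (8, .pull true 2), (10,
      .pull true 1), (9, .rule (.basic (.slide_cap true)) 1), (7, .pull true 1), (8, .pull true 1),
      (9, .rule (.basic (.slide_cap false)) 2), (5, .pull true 2), (6, .pull true 2), (8,
      .pull true 1), (7, .unrule (.basic (.slide_cup false)) 2), (8, .pull true 3), (7,
      .rule (.basic .zigzag_left) 1), (0, .rule (.basic (.slide_cup false)) 0), (1, .pull true 1),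
      (0, .rule (.basic (.slide_cup true)) 1), (8, .rule (.basic (.slide_cap true)) 1), (9,
      .pull true 1)]
    []
    (by decide +kernel) rfl

/-- The comparison of the two plats of `8_9`, where flypes and moves across the lower end take part.
-/
theorem uEq_plat89 :
    UEq 2 0 (fill [.cap 0 ()] (plat89))
      (fill [.cap 0 ()] (plat89')) :=
  uEq_of_platScripts _ _
    [(0, .unrule (.basic (.slide_cup false)) 1), (2, .flype), (9, .pull true 1), (8,
      .unrule (.basic (.slide_cap false)) 1), (1, .pull true 2), (0,
      .unrule (.basic (.slide_cup true)) 0), (0, .endpass true), (2, .pull true 1), (3,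
      .pull true 1), (4, .pull true 1), (5, .pull true 1), (6, .pull true 1), (7, .pull true 1),
      (8, .pull true 1), (9, .pull true 1), (10, .rule (.basic .zigzag_right) 0), (4, .flype), (8,
      .rule (.basic (.slide_cap false)) 0), (0, .endpass false), (2, .pull true 1), (3,
      .pull true 1), (4, .unrule (.basic (.slide_cup false)) 3), (5, .pull true 1), (4,
      .unrule (.basic (.slide_cup true)) 2), (5, .pull true 2), (6, .pull true 2), (7,
      .pull true 2), (9, .pull true 1), (8, .rule (.basic (.slide_cap true)) 2), (3, .pull true 1),
      (4, .pull true 1), (5, .pull true 1), (6, .pull true 1), (7, .pull true 1), (8,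
      .rule (.basic (.slide_cap false)) 3), (10, .rule (.basic (.slide_cap false)) 1), (2,
      .pull true 1), (3, .pull true 1), (4, .pull true 1), (5, .pull true 1), (6, .pull true 1),
      (7, .pull true 3), (8, .pull true 4), (11, .pull true 1), (9, .flype), (10,
      .rule (.basic (.slide_cap true)) 0), (0, .endpass true), (2, .pull true 1), (3,
      .pull true 1), (4, .pull true 1), (5, .pull true 1), (6, .pull true 1), (7, .pull true 1),
      (8, .rule (.basic .zigzag_right) 0), (0, .pull true 2), (2, .pull true 1), (3, .pull true 1),
      (4, .pull true 1), (5, .pull true 1), (6, .pull true 1), (7, .pull true 1), (8,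
      .pull true 1), (1, .pull true 1), (2, .pull true 1), (3, .pull true 1), (4, .pull true 1),
      (5, .pull true 1), (6, .pull true 1), (7, .pull true 1), (8,
      .unrule (.basic (.slide_cup true)) 3), (9, .pull true 1), (8, .rule (.basic .zigzag_left) 2)]
    [(0, .unrule (.basic (.slide_cup true)) 1), (1, .flype), (3, .flype), (9, .pull true 1), (8,
      .unrule (.basic (.slide_cap true)) 1)]
    (by decide +kernel) rfl

theorem uEq_block1042_plat'' :
    UEq 2 0 (fill [.cap 0 ()] (block1042 ++ [.cap 0 false]))
      (fill [.cap 0 ()] (plat1042'')) :=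
  uEq_of_platScripts _ _
    [(2, .pull true 1), (3, .unrule (.basic (.r3 false false false)) 2), (5,
      .unrule (.basic (.r3 true false true)) 1), (7, .pull true 1), (8,
      .rule (.basic (.r2 false)) 1), (6, .rule (.basic (.r3 true false false)) 2), (8,
      .rule (.basic (.r2 true)) 3), (7, .unrule (.basic (.r3 true false true)) 1), (9,
      .pull true 1), (10, .pull true 2), (11, .unrule (.basic (.r3 true false false)) 0), (13,
      .pull true 1), (14, .rule (.curl_cap false) 0), (0, .pull true 1), (1, .pull true 1), (2,
      .pull true 1), (3, .unrule (.basic (.slide_cup true)) 3), (12, .pull true 1), (13,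
      .rule (.basic (.slide_cap false)) 0), (8, .pull true 1), (9, .pull true 2), (10,
      .pull true 3), (12, .pull true 2), (11, .rule (.basic (.slide_cap true)) 1), (6,
      .pull true 1), (7, .pull true 2), (8, .pull true 2), (9, .pull true 2), (11, .pull true 1),
      (10, .rule (.basic (.slide_cap false)) 2), (3, .pull true 2), (4, .pull true 2), (5,
      .pull true 2), (6, .pull true 2), (7, .pull true 2), (9, .pull true 1), (8,
      .unrule (.basic (.slide_cup false)) 2), (14, .pull true 1), (13,
      .rule (.basic (.slide_cap false)) 0), (12, .pull true 1), (13,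
      .rule (.basic (.slide_cap true)) 1), (8, .pull true 4), (10, .pull true 3), (9,
      .unrule (.basic (.slide_cup true)) 1), (10, .pull true 5), (9,
      .rule (.basic .zigzag_left) 0), (0, .rule (.basic (.slide_cup true)) 0), (1, .pull true 1),
      (0, .rule (.basic (.slide_cup false)) 1), (11, .rule (.basic (.slide_cap true)) 1), (12,
      .pull true 1)]
    []
    (by decide +kernel) rfl

theorem uEq_block1042'_plat''' :
    UEq 2 0 (fill [.cap 0 ()] (block1042' ++ [.cap 0 false]))
      (fill [.cap 0 ()] (plat1042''')) :=
  uEq_of_platScripts _ _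
    [(7, .pull true 1), (5, .rule (.basic (.r3 true true false)) 1), (7,
      .rule (.basic (.r3 true false false)) 2), (9, .rule (.basic (.r2 true)) 3), (3,
      .pull true 1), (4, .rule (.basic (.r3 true true false)) 1), (6,
      .rule (.basic (.r3 true false false)) 2), (8, .pull true 1), (9, .pull true 2), (10,
      .rule (.basic (.r3 true false true)) 3), (12, .pull true 1), (13, .rule (.curl_cap true) 4),
      (1, .pull true 1), (2, .pull true 1), (3, .pull true 1), (4,
      .rule (.basic (.slide_cup true)) 0), (4, .pull true 2), (6, .pull true 1), (5,
      .rule (.basic (.slide_cup false)) 1), (5, .pull true 5), (7, .pull true 4), (6,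
      .rule (.basic (.slide_cup true)) 2), (7, .pull true 6), (6, .rule (.basic .zigzag_right) 3)]
    []
    (by decide +kernel) rfl

theorem uEq_plat1042''_plat1042 :
    UEq 2 0 (fill [.cap 0 ()] (plat1042''))
      (fill [.cap 0 ()] (plat1042)) :=
  uEq_of_platScripts _ _
    [(2, .unrule (.basic (.r2 true)) 1), (3, .unrule (.basic (.r3 true false false)) 0), (4,
      .unrule (.basic (.r3 true false false)) 0), (6, .rule (.basic (.r2 false)) 0), (0,
      .unrule (.basic (.slide_cup false)) 1), (3, .flype), (1,
      .unrule (.basic (.r3 true false true)) 1), (0, .rule (.curl_cup true) 1), (0,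
      .rule (.basic (.slide_cup true)) 1), (10, .rule (.basic (.slide_cap false)) 0)]
    [(0, .unrule (.basic (.slide_cup false)) 1), (9, .flype), (6, .flype), (4, .flype), (1,
      .pull true 1), (0, .unrule (.basic (.slide_cup true)) 0), (0, .endpass true), (2,
      .pull true 1), (3, .pull true 1), (4, .pull true 1), (5, .pull true 1), (6, .pull true 1),
      (7, .pull true 1), (8, .pull true 1), (9, .pull true 1), (10, .pull true 1), (11,
      .rule (.basic .zigzag_right) 0)]
    (by decide +kernel) rfl

theorem uEq_plat1042'''_plat1042' :
    UEq 2 0 (fill [.cap 0 ()] (plat1042'''))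
      (fill [.cap 0 ()] (plat1042')) :=
  uEq_of_platScripts _ _
    [(0, .unrule (.basic (.slide_cup true)) 1), (10, .flype), (8, .flype), (3, .flype), (1,
      .flype), (0, .unrule (.basic (.slide_cup false)) 0), (0, .endpass true), (2, .pull true 1),
      (3, .pull true 1), (4, .pull true 1), (5, .pull true 1), (6, .pull true 1), (7,
      .pull true 1), (8, .pull true 1), (9, .pull true 1), (10, .pull true 1), (11, .pull true 1),
      (12, .rule (.basic .zigzag_right) 0)]
    [(2, .unrule (.basic (.r2 true)) 0), (3, .rule (.basic (.r3 false true true)) 0), (1,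
      .unrule (.basic (.r3 true false true)) 0), (1, .flype), (0, .rule (.curl_cup true) 2), (3,
      .rule (.basic (.r3 false true true)) 0), (11, .rule (.basic (.slide_cap false)) 0)]
    (by decide +kernel) rfl

/-- The two plats of `10_42` are matched only up to exchanging the two bottom ends; the target is
the second plat with its ends joined the other way, which `uEq_turn` rewrites as a crossing below
it. -/
theorem uEq_plat1042_turn :
    UEq 2 0 (fill [.cap 0 ()] (plat1042))
      (fill [.cap 0 ()] (.cup 2 false :: plat1042'.map (Letter.raise 1) ++ [.cap 0 false])) :=
  uEq_of_platScripts _ _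
    [(9, .flype), (2, .flype), (0, .endpass false), (2, .unrule (.basic (.slide_cup true)) 3), (3,
      .pull true 1), (2, .unrule (.basic (.slide_cup false)) 2), (0, .endpass true), (2,
      .pull true 1), (3, .pull true 1), (4, .pull true 1), (5, .pull true 1), (6, .pull true 1),
      (7, .pull true 1), (8, .pull true 1), (9, .pull true 1), (10, .pull true 1), (11,
      .pull true 1), (12, .pull true 1), (13, .pull true 1), (14, .rule (.basic .zigzag_right) 0),
      (0, .pull true 2), (2, .pull true 3), (5, .pull true 1), (6, .pull true 1), (7,
      .pull true 1), (8, .pull true 1), (10, .pull true 4), (1, .pull true 1), (2,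
      .unrule (.basic (.slide_cup false)) 3), (3, .pull true 1), (2,
      .unrule (.basic (.slide_cup true)) 2), (0, .unrule (.basic (.slide_cup true)) 0), (0,
      .endpass true), (2, .pull true 1), (3, .pull true 1), (4, .pull true 1), (5, .pull true 1),
      (6, .rule (.basic (.slide_cup false)) 0), (0, .pull true 2), (2, .pull true 3), (3,
      .pull true 3), (4, .pull true 3), (5, .pull true 3), (6, .pull true 3), (1, .pull true 1),
      (2, .pull true 1), (3, .pull true 1), (4, .pull true 1), (5, .pull true 1), (6,
      .unrule (.basic (.slide_cup true)) 5), (7, .pull true 1), (6,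
      .unrule (.basic (.slide_cup false)) 4), (3, .pull true 1), (4, .pull true 1), (5,
      .pull true 1), (6, .pull true 1), (7, .pull true 1), (8, .pull true 1), (9, .pull true 1),
      (10, .pull true 1), (11, .pull true 1), (12, .pull true 1), (13,
      .unrule (.basic (.slide_cap false)) 0), (0, .unrule (.basic (.slide_cup false)) 0), (0,
      .endpass true), (2, .pull true 1), (3, .pull true 1), (4, .pull true 1), (5, .pull true 1),
      (6, .pull true 1), (7, .pull true 1), (8, .pull true 1), (9, .pull true 1), (10,
      .pull true 1), (11, .pull true 1), (12, .pull true 1), (13, .pull true 1), (14,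
      .rule (.basic .zigzag_right) 0), (0, .pull true 2), (1, .pull true 4), (3, .pull true 1), (4,
      .pull true 1), (13, .pull true 1)]
    [(1, .unrule (.basic (.slide_cup true)) 2), (0, .pull true 1), (1,
      .unrule (.basic (.slide_cup false)) 3), (2, .pull true 1), (1,
      .unrule (.basic (.slide_cup true)) 2), (0, .pull true 1), (1,
      .unrule (.basic (.slide_cup false)) 3), (1, .pull true 3), (2, .pull true 3), (4,
      .pull true 2), (3, .unrule (.basic (.slide_cup true)) 2), (11,
      .rule (.basic (.slide_cap false)) 1), (6, .pull true 1), (7, .pull true 1), (8,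
      .pull true 1), (9, .pull true 1), (10, .pull true 1), (11, .pull true 1), (12,
      .rule (.basic (.slide_cap false)) 1), (4, .pull true 2), (6, .pull true 1), (7,
      .pull true 1), (8, .pull true 1), (9, .pull true 1), (10, .pull true 1), (13, .pull true 1),
      (11, .flype), (12, .rule (.basic (.slide_cap true)) 0), (0, .endpass false), (0,
      .rule (.basic (.slide_cup false)) 0), (2, .pull true 1), (3, .pull true 1), (4,
      .pull true 1), (5, .pull true 1), (6, .pull true 1), (7, .pull true 1), (8, .pull true 1),
      (9, .pull true 1), (10, .pull true 1), (11, .pull true 1), (12, .pull true 1), (13,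
      .pull true 1), (14, .rule (.basic .zigzag_left) 1), (13, .pull true 1), (12,
      .rule (.basic (.slide_cap false)) 0), (1, .pull true 1), (0,
      .rule (.basic (.slide_cup true)) 1), (0, .endpass false), (2, .pull true 1), (3,
      .pull true 1), (4, .pull true 1), (5, .unrule (.basic (.slide_cup false)) 5), (6,
      .pull true 1), (5, .unrule (.basic (.slide_cup true)) 4), (6, .pull true 2), (5,
      .unrule (.basic (.slide_cup false)) 3), (8, .pull true 1), (9, .pull true 1), (10,
      .pull true 1), (11, .pull true 1), (12, .pull true 1), (13, .pull true 1), (14,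
      .rule (.basic (.slide_cap false)) 1), (15, .pull true 1), (14,
      .rule (.basic (.slide_cap true)) 0), (1, .pull true 4), (2, .pull true 2)]
    (by decide +kernel) rfl

/-- This is reversibility: a flype moves the crossing of the two ends to the last two strands, where
it is a curl at the minimum. -/
theorem uEq_plat89_cross :
    UEq 2 0 (fill [.cap 0 ()] (.cross 0 true :: plat89)) (fill [.cap 0 ()] plat89) :=
  uEq_of_platScripts _ _ [(0, .pull true 1), (1, .flype), (0, .rule (.curl_cup true) 2)] []
    (by decide +kernel) rfl

theorem uEq_plat1042_cross :
    UEq 2 0 (fill [.cap 0 ()] (.cross 0 true :: plat1042)) (fill [.cap 0 ()] plat1042) :=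
  uEq_of_platScripts _ _ [(0, .pull true 1), (1, .flype), (0, .rule (.curl_cup true) 2)] []
    (by decide +kernel) rfl

theorem uEq_plat1042'_cross :
    UEq 2 0 (fill [.cap 0 ()] (.cross 0 true :: plat1042')) (fill [.cap 0 ()] plat1042') :=
  uEq_of_platScripts _ _ [(0, .pull true 1), (1, .flype), (0, .rule (.curl_cup true) 2)] []
    (by decide +kernel) rfl

end SymUnion

namespace SymUnion

/-! ### Induction over the summands -/

theorem stack_succ {α : Type} (k : ℕ) (M : List α) : stack (k + 1) M = M ++ stack k M := by
  simp [stack, List.replicate_succ]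

theorem strands_stack {α : Type} {n : ℕ} {M : List (Letter α)} (h : strands M n = some n) (k : ℕ) :
    strands (stack k M) n = some n := by
  induction k with
  | zero => rfl
  | succ k ih => rw [stack_succ, strands_append, h, Option.bind_some, ih]

theorem UEq.fill_congr {X X' : List (Letter Unit)} (h : UEq 2 0 X X') {i j : ℕ} (hi : i ≤ 2)
    (hj : j ≤ 2) :
    UEq 2 2 (fill X [.cup i false, .cap j true]) (fill X' [.cup i false, .cap j true]) := by
  have h1 := (h.raise j).add (2 - j)
  rw [show 2 + j + (2 - j) = 4 by omega, show 0 + j + (2 - j) = 2 by omega] at h1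
  have h2 := h1.left (u := [.cup i ()]) (k := 2)
    (by simp [strands, Letter.strands, Letter.pos, Letter.ins, Letter.outs, hi])
  simpa [fill, Letter.fill, Letter.map] using h2

/-- Two tangles `B` and `B'` have equivalent sums, which are also equivalent to their reverses, if a
knot which is tied into one end of their strand can be moved to the other end, and if their closures
are equivalent and equivalent to the reverses. -/
theorem uEq_stack {B B' : List (Letter Unit)} {i j : ℕ} {z : List (Letter Bool)} (hi : i ≤ 2)
    (hj : j ≤ 2) (hB : strands B 2 = some 2) (hB' : strands B' 2 = some 2)
    (hy : ∀ X, strands X 2 = some 0 →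
      UEq 2 0 (B ++ X) (fill X [.cup i false, .cap j true] ++ (B ++ [.cap 0 ()])))
    (hy' : ∀ X, strands X 2 = some 0 →
      UEq 2 0 (B' ++ X) (fill X [.cup i false, .cap j true] ++ (B' ++ [.cap 0 ()])))
    (hz : ∀ X, strands X 2 = some 0 → UEq 2 0 (B ++ X) (fill X z ++ (B ++ [.cap 0 ()])))
    (hyz : ∀ X, strands X 2 = some 0 →
      UEq 2 2 (fill (.cross 0 true :: X) [.cup i false, .cap j true] ++ [.cross 0 true])
        (.cross 0 true :: fill X z))
    (hBB' : UEq 2 0 (B ++ [.cap 0 ()]) (B' ++ [.cap 0 ()]))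
    (hrev : UEq 2 0 (.cross 0 true :: (B ++ [.cap 0 ()])) (B ++ [.cap 0 ()])) (k : ℕ) :
    UEq 2 0 (stack k B ++ [.cap 0 ()]) (stack k B' ++ [.cap 0 ()]) ∧
      UEq 2 0 (.cross 0 true :: (stack k B ++ [.cap 0 ()])) (stack k B ++ [.cap 0 ()]) := by
  have hs : ∀ k, strands (stack k B ++ [.cap 0 ()]) 2 = some 0 := fun k => by
    rw [strands_append, strands_stack hB]; rfl
  have hs' : ∀ k, strands (stack k B' ++ [.cap 0 ()]) 2 = some 0 := fun k => by
    rw [strands_append, strands_stack hB']; rfl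
  have hc : strands (B ++ [.cap 0 ()]) 2 = some 0 := by
    rw [strands_append, hB]; rfl
  have hf : ∀ X, strands X 2 = some 0 →
      strands (fill X [.cup i false, .cap j true]) 2 = some 2 := fun X hX =>
    strands_fill hX (by
      have : j + 2 ≤ 4 := by omega
      simp [strands, Letter.strands, Letter.pos, Letter.ins, Letter.outs, hi, this])
  induction k with
  | zero =>
    exact ⟨.refl _, uEq_of_scripts (R := CurlRule) [.cross 0 true, .cap 0 false] [.cap 0 false]
      [(0, .rule (.curl_cap true) 0)] [] (by decide +kernel) rfl⟩
  | succ k ih =>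
    obtain ⟨ih, ihr⟩ := ih
    rw [stack_succ, stack_succ, List.append_assoc, List.append_assoc]
    -- The upper `k` summands form the knot: they slide below the lowest summand, whose closure is
    -- then unaffected by them.
    have h1 := hy _ (hs k)
    refine ⟨?_, ?_⟩
    -- With the knot at the bottom, replace the closed summand, then the knot by the induction
    -- hypothesis, and slide the new knot back up through `B'`.
    · have h2 := hy' _ (hs' k)
      have h3 := hBB'.left (hf _ (hs k))
      have h4 := (ih.fill_congr hi hj).right (v := B' ++ [.cap 0 ()]) (l := 0)
        (by rw [strands_append, hB']; rfl)
      exact h1.trans (h3.trans (h4.trans h2.symm))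
    -- The knot is brought down along the second arc and pushed through the crossing of the ends,
    -- which reverses it by `hyz`. Then `hrev` absorbs the crossing into the closed summand, the
    -- induction hypothesis absorbs the one inside the knot, and the knot returns along the first
    -- arc.
    · have h2 := (hz _ (hs k)).left (u := [.cross 0 true]) (k := 2) rfl
      have h3 := (hyz _ (hs k)).right hc
      have hcr : strands (.cross 0 true :: (stack k B ++ [.cap 0 ()])) 2 = some 0 := by
        rw [strands_cross (by omega), hs]
      have h4 := hrev.left (hf _ hcr)
      have h5 := (ihr.fill_congr hi hj).right hc
      simp only [List.append_assoc, List.cons_append, List.nil_append] at h1 h2 h3 h4 h5 ⊢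
      exact h2.trans (h3.symm.trans (h4.trans (h5.trans h1.symm)))

/-- A word without blobs as an unoriented word. -/
abbrev bare (w : List (Letter Bool)) : List (Letter Unit) := fill [.cap 0 ()] w

/-- Putting a curl at the maximum on the left side turns it into a knot which can be slid through
the crossing and closed up. -/
theorem uEq_turn {S : List (Letter Unit)} (hS : strands S 2 = some 0) :
    UEq 2 0 (.cup 2 () :: (S.map (Letter.raise 1) ++ [.cap 0 ()])) (.cross 0 true :: S) := by
  have := uEq_of_confluent (RuleOp.realized (R := KnotRule)) hS (n := 2) (m := 0)
    (a := [.cup 2 false, .cap 1 true, .cap 0 false]) (b := [.cross 0 true, .cap 0 true])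
    (s := [(2, .unrule (.curl (.curl_cap true)) 0)])
    (t := [(1, .unrule .cap_left 0), (0, .unrule (.right_down true) 0)]) (by decide +kernel) rfl
  have h0 : (Letter.raise 0 : Letter Unit → Letter Unit) = id := by funext x; cases x <;> rfl
  simpa [fill, Letter.fill, Letter.map, h0] using this

theorem uEq_closure_block89 :
    UEq 2 0 (bare (block89 false) ++ [.cap 0 ()]) (bare (block89 true) ++ [.cap 0 ()]) :=
  uEq_block89_plat.trans (uEq_plat89.trans uEq_block89_plat'.symm)

theorem uEq_reverse_block89 :
    UEq 2 0 (.cross 0 true :: (bare (block89 false) ++ [.cap 0 ()]))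
      (bare (block89 false) ++ [.cap 0 ()]) :=
  (uEq_block89_plat.left (u := [.cross 0 true]) rfl).trans
    (uEq_plat89_cross.trans uEq_block89_plat.symm)

/-- The exchange of ends left over by `uEq_plat1042_turn` is harmless since the second plat is
reversible. -/
theorem uEq_plat1042_plat1042' : UEq 2 0 (bare plat1042) (bare plat1042') :=
  uEq_plat1042_turn.trans ((uEq_turn (S := bare plat1042') rfl).trans uEq_plat1042'_cross)

theorem uEq_closure_block1042 :
    UEq 2 0 (bare block1042 ++ [.cap 0 ()]) (bare block1042' ++ [.cap 0 ()]) :=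
  uEq_block1042_plat''.trans (uEq_plat1042''_plat1042.trans (uEq_plat1042_plat1042'.trans
    (uEq_plat1042'''_plat1042'.symm.trans uEq_block1042'_plat'''.symm)))

theorem uEq_reverse_block1042 :
    UEq 2 0 (.cross 0 true :: (bare block1042 ++ [.cap 0 ()])) (bare block1042 ++ [.cap 0 ()]) := by
  have h := uEq_block1042_plat''.trans uEq_plat1042''_plat1042
  exact (h.left (u := [.cross 0 true]) rfl).trans (uEq_plat1042_cross.trans h.symm)

theorem map_raise_zero (X : List (Letter Unit)) : X.map (Letter.raise 0) = X := by
  have h0 : (Letter.raise 0 : Letter Unit → Letter Unit) = id := by funext x; cases x <;> rfl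
  rw [h0, List.map_id]

theorem fill_append_blob (X : List (Letter Unit)) (w : List (Letter Bool)) :
    fill X (w ++ [.cap 0 true]) = fill X w ++ X := by
  simp [fill, Letter.fill, map_raise_zero]

theorem uEq_stack_block89 (k : ℕ) :
    UEq 2 0 (stack k (bare (block89 false)) ++ [.cap 0 ()])
        (stack k (bare (block89 true)) ++ [.cap 0 ()]) ∧
      UEq 2 0 (.cross 0 true :: (stack k (bare (block89 false)) ++ [.cap 0 ()]))
        (stack k (bare (block89 false)) ++ [.cap 0 ()]) := by
  have hy : ∀ o X, strands X 2 = some 0 → UEq 2 0 (bare (block89 o) ++ X)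
      (fill X [.cup 2 false, .cap 1 true] ++ (bare (block89 o) ++ [.cap 0 ()])) := fun o X hX => by
    have := uEq_knot_block89 o hX
    rw [fill_append_blob, List.append_assoc, fill_append] at this
    exact this
  refine uEq_stack (z := [.cup 0 false, .cap 1 true]) le_rfl (by omega) rfl rfl (hy _) (hy _)
    (fun X hX => ?_) (fun X hX => ?_) uEq_closure_block89 uEq_reverse_block89 k
  · have := uEq_knot_block89_left hX
    rw [fill_append_blob, List.append_assoc, fill_append] at this
    exact this
  · have := uEq_of_confluent (RuleOp.realized (R := KnotRule)) hX (n := 2) (m := 2)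
      (a := [.cup 2 false, .cross 1 true, .cap 1 true, .cross 0 true])
      (b := [.cross 0 true, .cup 0 false, .cap 1 true])
      (s := [(0, .unrule (.curl (.basic (.slide_cup false))) 1),
        (0, .unrule (.curl (.curl_cup false)) 1), (1, .rule (.curl (.basic (.blob false))) 1),
        (0, .rule (.left_down true) 0), (0, .pull true 1)])
      (t := [(0, .pull true 1)]) (by decide +kernel) rfl
    simpa [fill, Letter.fill, Letter.map, Letter.raise] using this

theorem uEq_stack_block1042 (k : ℕ) :
    UEq 2 0 (stack k (bare block1042) ++ [.cap 0 ()]) (stack k (bare block1042') ++ [.cap 0 ()]) ∧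
      UEq 2 0 (.cross 0 true :: (stack k (bare block1042) ++ [.cap 0 ()]))
        (stack k (bare block1042) ++ [.cap 0 ()]) := by
  refine uEq_stack (i := 1) (j := 0) (z := [.cup 1 false, .cap 2 true]) (by omega) (by omega) rfl rfl
    (fun X hX => ?_) (fun X hX => ?_) (fun X hX => ?_) (fun X hX => ?_)
    uEq_closure_block1042 uEq_reverse_block1042 k
  · have := uEq_knot_block1042 hX
    rw [fill_append_blob, List.append_assoc, fill_append] at this
    exact this
  · have := uEq_knot_block1042' hX
    rw [fill_append_blob, List.append_assoc, fill_append] at this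
    exact this
  · have := uEq_knot_block1042_left hX
    rw [fill_append_blob, List.append_assoc, fill_append] at this
    exact this
  · have := uEq_of_confluent (RuleOp.realized (R := KnotRule)) hX (n := 2) (m := 2)
      (a := [.cup 1 false, .cross 0 true, .cap 0 true, .cross 0 true])
      (b := [.cross 0 true, .cup 1 false, .cap 2 true])
      (s := [(0, .unrule (.curl (.basic (.slide_cup false))) 0),
        (0, .unrule (.curl (.curl_cup false)) 0)])
      (t := [(0, .unrule (.left_up true) 0), (1, .unrule (.curl (.basic (.blob false))) 0)])
      (by decide +kernel) rfl
    simpa [fill, Letter.fill, Letter.map, Letter.raise] using this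

end SymUnion

namespace SymUnion

/-! ### Lifting moves to oriented words -/

/-- One move between oriented words. -/
def OStep (s t : List Bool) (w w' : List (Letter Bool)) : Prop :=
  run w s = some t ∧ run w' s = some t ∧
    ∃ u v a b, (Isotopy a b ∨ Reidemeister a b) ∧ w = u ++ a ++ v ∧ w' = u ++ b ++ v

/-- Equivalence of oriented words between strands of given directions. -/
def OEq (s t : List Bool) : List (Letter Bool) → List (Letter Bool) → Prop :=
  Relation.EqvGen (OStep s t)

theorem OEq.run_iff {s t : List Bool} {w w' : List (Letter Bool)} (h : OEq s t w w') :
    run w s = some t ↔ run w' s = some t := by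
  induction h with
  | rel _ _ h => exact ⟨fun _ => h.2.1, fun _ => h.1⟩
  | refl => rfl
  | symm _ _ _ ih => exact ih.symm
  | trans _ _ _ _ _ ih ih' => exact ih.trans ih'

theorem OEq.context {s t s' t' : List Bool} {w w' u v : List (Letter Bool)} (h : OEq s t w w')
    (hu : run u s' = some s) (hv : run v t = some t') : OEq s' t' (u ++ w ++ v) (u ++ w' ++ v) := by
  induction h with
  | rel w w' h =>
    obtain ⟨h1, h2, u', v', a, b, h, rfl, rfl⟩ := h
    refine .rel _ _ ⟨?_, ?_, u ++ u', v' ++ v, a, b, h, by simp, by simp⟩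
    · rw [run_append, run_append, hu, Option.bind_some, h1, Option.bind_some, hv]
    · rw [run_append, run_append, hu, Option.bind_some, h2, Option.bind_some, hv]
  | refl => exact .refl _
  | symm _ _ _ ih => exact .symm _ _ ih
  | trans _ _ _ _ _ ih ih' => exact .trans _ _ _ ih ih'

theorem OEq.reidemeisterEquivalent {w w' : List (Letter Bool)} (h : OEq [] [] w w')
    (hw : run w [] = some []) (hw' : run w' [] = some []) :
    ReidemeisterEquivalent ⟨w, hw⟩ ⟨w', hw'⟩ := by
  induction h with
  | rel w w' h =>
    obtain ⟨_, _, u, v, a, b, h, rfl, rfl⟩ := h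
    exact .rel _ _ (.mk _ _ u v a b h rfl rfl)
  | refl => exact .refl _
  | symm _ _ _ ih => exact .symm _ _ (ih _ _)
  | trans w₁ w₂ w₃ h _ ih ih' =>
    have h2 := (OEq.run_iff h).1 hw
    exact .trans _ _ _ (ih hw h2) (ih' h2 hw')

theorem Isotopy.raise {a b : List (Letter Bool)} (h : Isotopy a b) (n : ℕ) :
    Isotopy (a.map (Letter.raise n)) (b.map (Letter.raise n)) := by
  cases h with
  | zigzag_right i b =>
    have := Isotopy.zigzag_right (i + n) b
    rwa [add_right_comm] at this
  | zigzag_left i b =>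
    have := Isotopy.zigzag_left (i + n) b
    rwa [add_right_comm] at this
  | slide_cup i b o =>
    have := Isotopy.slide_cup (i + n) b o
    rwa [add_right_comm] at this
  | slide_cap i b o =>
    have := Isotopy.slide_cap (i + n) b o
    rwa [add_right_comm] at this
  | exchange l m =>
    have := Isotopy.exchange (l.raise n) m
    simp only [Letter.pos_raise, Letter.outs_raise, Letter.ins_raise] at this
    simp only [List.map_cons, List.map_nil, Letter.raise_raise]
    rwa [add_right_comm l.pos n, add_right_comm l.pos n] at this

theorem Reidemeister.raise {a b : List (Letter Bool)} (h : Reidemeister a b) (n : ℕ) :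
    Reidemeister (a.map (Letter.raise n)) (b.map (Letter.raise n)) := by
  cases h with
  | r1_right i b o =>
    have := Reidemeister.r1_right (i + n) b o
    rwa [add_right_comm] at this
  | r1_left i b o =>
    have := Reidemeister.r1_left (i + n) b o
    rwa [add_right_comm] at this
  | r2 i o => exact Reidemeister.r2 (i + n) o
  | r3 i o₁ o₂ o₃ h =>
    have := Reidemeister.r3 (i + n) o₁ o₂ o₃ h
    rwa [add_right_comm] at this

/-- An oriented move. -/
def OMove (a b : List (Letter Bool)) : Prop := Isotopy a b ∨ Reidemeister a b

theorem OMove.raise {a b : List (Letter Bool)} (h : OMove a b) (n : ℕ) :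
    OMove (a.map (Letter.raise n)) (b.map (Letter.raise n)) :=
  h.imp (·.raise n) (·.raise n)

theorem Letter.step_append (l : Letter Bool) (p s : List Bool) (hp : p.length = l.pos + l.ins) :
    l.step (p ++ s) = (l.step p).map (· ++ s) := by
  cases l with
  | cup i b =>
    obtain rfl : i = p.length := by simpa [Letter.pos, Letter.ins] using hp.symm
    simp [Letter.step]
  | cap i b =>
    obtain ⟨q, x, y, rfl, rfl⟩ : ∃ q x y, p = q ++ [x, y] ∧ i = q.length := by
      simp only [Letter.pos, Letter.ins] at hp
      have h1 : (p.drop i).length = 2 := by simp; omega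
      match hd : p.drop i, h1 with
      | [x, y], _ => exact ⟨p.take i, x, y, by rw [← hd, List.take_append_drop], by simp; omega⟩
    simp [Letter.step]
  | cross i o =>
    obtain ⟨q, x, y, rfl, rfl⟩ : ∃ q x y, p = q ++ [x, y] ∧ i = q.length := by
      simp only [Letter.pos, Letter.ins] at hp
      have h1 : (p.drop i).length = 2 := by simp; omega
      match hd : p.drop i, h1 with
      | [x, y], _ => exact ⟨p.take i, x, y, by rw [← hd, List.take_append_drop], by simp; omega⟩
    simp [Letter.step]

theorem Letter.step_raise (l : Letter Bool) (p s : List Bool) :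
    (l.raise p.length).step (p ++ s) = (l.step s).map (p ++ ·) := by
  have hd : ∀ i, (p ++ s).drop (i + p.length) = s.drop i := fun i => by
    rw [add_comm, ← List.drop_drop, List.drop_left]
  have ht : ∀ i, (p ++ s).take (i + p.length) = p ++ s.take i := fun i => by
    rw [add_comm, List.take_length_add_append]
  cases l with
  | cup i b =>
    simp only [Letter.raise, Letter.step, hd, ht, List.length_append]
    by_cases hi : i ≤ s.length
    · rw [if_pos hi, if_pos (by omega)]; simp
    · rw [if_neg hi, if_neg (by omega)]; rfl
  | cap i b =>
    simp only [Letter.raise, Letter.step, hd, ht]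
    split <;> simp
  | cross i o =>
    simp only [Letter.raise, Letter.step, hd, ht]
    split <;> simp

theorem run_raise (w : List (Letter Bool)) (p s : List Bool) :
    run (w.map (Letter.raise p.length)) (p ++ s) = (run w s).map (p ++ ·) := by
  induction w generalizing s with
  | nil => rfl
  | cons l w ih =>
    simp only [List.map_cons, run, Letter.step_raise]
    cases l.step s with
    | none => rfl
    | some t => exact ih t

theorem run_exchange (l m : Letter Bool) (s : List Bool) (h : l.pos + l.ins ≤ s.length) :
    run [l, m.raise (l.pos + l.outs)] s = run [m.raise (l.pos + l.ins), l] s := by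
  obtain ⟨p, r, rfl, hp⟩ : ∃ p r, s = p ++ r ∧ p.length = l.pos + l.ins :=
    ⟨s.take (l.pos + l.ins), s.drop (l.pos + l.ins), by simp, by simp [h]⟩
  simp only [run]
  rw [l.step_append p r hp, ← hp, Letter.step_raise]
  cases hq : l.step p with
  | none =>
    cases hm : m.step r with
    | none => rfl
    | some t => simp [l.step_append p t hp, hq]
  | some q =>
    have hql : q.length = l.pos + l.outs := by
      have := Letter.length_of_step hq
      simp only [Letter.strands, hp, le_refl, if_true, Option.some.injEq] at this
      omega
    simp only [Option.map_some, Option.bind_some]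
    rw [← hql, Letter.step_raise]
    cases hm : m.step r with
    | none => rfl
    | some t => simp [l.step_append p t hp, hq]

theorem Letter.exists_of_map_eq_raise {l : Letter Bool} {x : Letter Unit} {n : ℕ}
    (h : (l.map fun _ => ()) = x.raise n) :
    ∃ l' : Letter Bool, l = l'.raise n ∧ (l'.map fun _ => ()) = x := by
  rcases l with ⟨i, b⟩ | ⟨i, b⟩ | ⟨i, o⟩ <;> rcases x with ⟨j, c⟩ | ⟨j, c⟩ | ⟨j, q⟩ <;>
    simp [Letter.map, Letter.raise] at h
  · exact ⟨.cup j b, by simp [Letter.raise, h], rfl⟩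
  · exact ⟨.cap j b, by simp [Letter.raise, h], rfl⟩
  · exact ⟨.cross j o, by simp [Letter.raise, h], by simp [Letter.map, h]⟩

theorem exists_of_plain_eq_raise {w : List (Letter Bool)} {x : List (Letter Unit)} {n : ℕ}
    (h : plain w = x.map (Letter.raise n)) :
    ∃ w' : List (Letter Bool), w = w'.map (Letter.raise n) ∧ plain w' = x := by
  induction x generalizing w with
  | nil => exact ⟨[], by simpa using h, rfl⟩
  | cons a x ih =>
    cases w with
    | nil => simp at h
    | cons l w =>
      simp only [List.map_cons, List.cons.injEq] at h
      obtain ⟨l', rfl, hl⟩ := Letter.exists_of_map_eq_raise h.1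
      obtain ⟨w', rfl, hw⟩ := ih h.2
      exact ⟨l' :: w', rfl, by simp [hl, hw]⟩

@[simp] theorem Letter.map_eq_cup {l : Letter Bool} {i : ℕ} {c : Unit} :
    (l.map fun _ => ()) = .cup i c ↔ ∃ b, l = .cup i b := by
  cases l <;> simp [Letter.map]

@[simp] theorem Letter.map_eq_cap {l : Letter Bool} {i : ℕ} {c : Unit} :
    (l.map fun _ => ()) = .cap i c ↔ ∃ b, l = .cap i b := by
  cases l <;> simp [Letter.map]

@[simp] theorem Letter.map_eq_cross {l : Letter Bool} {i : ℕ} {o : Bool} :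
    (l.map fun _ => ()) = .cross i o ↔ l = .cross i o := by
  cases l <;> simp [Letter.map]

/-- The word `b` carries orientations which correspond to those of `a` under a move. -/
def Lifts (a b : List (Letter Unit)) : Prop :=
  ∀ (A : List (Letter Bool)) (s t : List Bool), plain A = a → run A s = some t →
    (strands b s.length).isSome →
    ∃ B, plain B = b ∧ run B s = some t ∧ (OMove A B ∨ OMove B A)

end SymUnion

namespace SymUnion

-- Directions are constant along strands, so those inside a move are determined by the ones outside,
-- except for a minimum present on both sides, whose direction is copied. When a move creates
-- extrema, their directions are read off from the neighboring strand, which exists because the new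
-- word fits.
set_option linter.unusedSimpArgs false in
theorem BaseMove.lifts {a b : List (Letter Unit)} (h : BaseMove a b) : Lifts a b ∧ Lifts b a := by
  cases h with
  | zigzag_right =>
    constructor
    · intro A s t hA hr hb
      simp only [List.map_eq_cons_iff, List.map_eq_nil_iff, Letter.map_eq_cup, Letter.map_eq_cap,
        Letter.map_eq_cross] at hA
      obtain ⟨_, _, rfl, ⟨b, rfl⟩, _, _, rfl, ⟨c, rfl⟩, rfl⟩ := hA
      match s, hr with
      | x :: s, hr =>
        simp [run, Letter.step] at hr
        obtain ⟨⟨rfl, rfl⟩, rfl⟩ := hr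
        exact ⟨[], rfl, by simp [run], .inl (.inl (by simpa using Isotopy.zigzag_right 0 (!c)))⟩
    · intro A s t hA hr hb
      simp at hA
      subst hA
      match s, hb with
      | x :: s, hb =>
        exact ⟨[.cup 0 x, .cap 1 (!x)], rfl, by simpa [run, Letter.step] using hr,
          .inr (.inl (.zigzag_right 0 x))⟩
  | zigzag_left =>
    constructor
    · intro A s t hA hr hb
      simp only [List.map_eq_cons_iff, List.map_eq_nil_iff, Letter.map_eq_cup, Letter.map_eq_cap,
        Letter.map_eq_cross] at hA
      obtain ⟨_, _, rfl, ⟨b, rfl⟩, _, _, rfl, ⟨c, rfl⟩, rfl⟩ := hA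
      match s, hr with
      | x :: s, hr =>
        simp [run, Letter.step] at hr
        obtain ⟨⟨rfl, rfl⟩, rfl⟩ := hr
        exact ⟨[], rfl, by simp [run], .inl (.inl (by simpa using Isotopy.zigzag_left 0 (!x)))⟩
    · intro A s t hA hr hb
      simp at hA
      subst hA
      match s, hb with
      | x :: s, hb =>
        exact ⟨[.cup 1 (!x), .cap 0 x], rfl, by simpa [run, Letter.step] using hr,
          .inr (.inl (by simpa using Isotopy.zigzag_left 0 (!x)))⟩
  | slide_cup o =>
    constructor
    · intro A s t hA hr hb
      simp only [List.map_eq_cons_iff, List.map_eq_nil_iff, Letter.map_eq_cup, Letter.map_eq_cap,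
        Letter.map_eq_cross] at hA
      obtain ⟨_, _, rfl, ⟨b, rfl⟩, _, _, rfl, rfl, rfl⟩ := hA
      match s, hr with
      | x :: s, hr =>
        exact ⟨[.cup 1 b, .cross 0 (!o)], rfl, by simpa [run, Letter.step] using hr,
          .inl (.inl (.slide_cup 0 b o))⟩
    · intro A s t hA hr hb
      simp only [List.map_eq_cons_iff, List.map_eq_nil_iff, Letter.map_eq_cup, Letter.map_eq_cap,
        Letter.map_eq_cross] at hA
      obtain ⟨_, _, rfl, ⟨b, rfl⟩, _, _, rfl, rfl, rfl⟩ := hA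
      match s, hr with
      | x :: s, hr =>
        exact ⟨[.cup 0 b, .cross 1 o], rfl, by simpa [run, Letter.step] using hr,
          .inr (.inl (.slide_cup 0 b o))⟩
  | slide_cap o =>
    constructor
    · intro A s t hA hr hb
      simp only [List.map_eq_cons_iff, List.map_eq_nil_iff, Letter.map_eq_cup, Letter.map_eq_cap,
        Letter.map_eq_cross] at hA
      obtain ⟨_, _, rfl, rfl, _, _, rfl, ⟨b, rfl⟩, rfl⟩ := hA
      match s, hr with
      | x :: y :: z :: s, hr =>
        exact ⟨[.cross 0 (!o), .cap 1 b], rfl, by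
          simpa [run, Letter.step] using hr,
          .inl (.inl (.slide_cap 0 b o))⟩
    · intro A s t hA hr hb
      simp only [List.map_eq_cons_iff, List.map_eq_nil_iff, Letter.map_eq_cup, Letter.map_eq_cap,
        Letter.map_eq_cross] at hA
      obtain ⟨_, _, rfl, rfl, _, _, rfl, ⟨b, rfl⟩, rfl⟩ := hA
      match s, hr with
      | x :: y :: z :: s, hr =>
        exact ⟨[.cross 1 o, .cap 0 b], rfl, by
          simpa [run, Letter.step] using hr,
          .inr (.inl (.slide_cap 0 b o))⟩
  | r1_right o =>
    constructor
    · intro A s t hA hr hb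
      simp only [List.map_eq_cons_iff, List.map_eq_nil_iff, Letter.map_eq_cup, Letter.map_eq_cap,
        Letter.map_eq_cross] at hA
      obtain ⟨_, _, rfl, ⟨b, rfl⟩, _, _, rfl, rfl, _, _, rfl, ⟨c, rfl⟩, rfl⟩ := hA
      match s, hr with
      | x :: s, hr =>
        simp [run, Letter.step] at hr
        obtain ⟨⟨rfl, rfl⟩, rfl⟩ := hr
        exact ⟨[], rfl, by simp [run], .inl (.inr (.r1_right 0 _ o))⟩
    · intro A s t hA hr hb
      simp at hA
      subst hA
      match s, hb with
      | x :: s, hb =>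
        exact ⟨[.cup 1 x, .cross 0 o, .cap 1 x], rfl, by simpa [run, Letter.step] using hr,
          .inr (.inr (.r1_right 0 x o))⟩
  | r1_left o =>
    constructor
    · intro A s t hA hr hb
      simp only [List.map_eq_cons_iff, List.map_eq_nil_iff, Letter.map_eq_cup, Letter.map_eq_cap,
        Letter.map_eq_cross] at hA
      obtain ⟨_, _, rfl, ⟨b, rfl⟩, _, _, rfl, rfl, _, _, rfl, ⟨c, rfl⟩, rfl⟩ := hA
      match s, hr with
      | x :: s, hr =>
        simp [run, Letter.step] at hr
        obtain ⟨⟨rfl, rfl⟩, rfl⟩ := hr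
        exact ⟨[], rfl, by simp [run], .inl (.inr (.r1_left 0 _ o))⟩
    · intro A s t hA hr hb
      simp at hA
      subst hA
      match s, hb with
      | x :: s, hb =>
        exact ⟨[.cup 0 (!x), .cross 1 o, .cap 0 (!x)], rfl, by simpa [run, Letter.step] using hr,
          .inr (.inr (.r1_left 0 (!x) o))⟩
  | r2 o =>
    constructor
    · intro A s t hA hr hb
      simp [List.map_eq_cons_iff] at hA
      subst hA
      match s, hr with
      | x :: y :: s, hr => exact ⟨[], rfl, by simpa [run, Letter.step] using hr, .inl (.inr (.r2 0 o))⟩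
    · intro A s t hA hr hb
      simp at hA
      subst hA
      match s, hb with
      | x :: y :: s, hb =>
        exact ⟨[.cross 0 o, .cross 0 (!o)], rfl, by simpa [run, Letter.step] using hr,
          .inr (.inr (.r2 0 o))⟩
  | r3 o₁ o₂ o₃ h =>
    constructor
    · intro A s t hA hr hb
      simp [List.map_eq_cons_iff] at hA
      subst hA
      match s, hr with
      | x :: y :: z :: s, hr =>
        exact ⟨[.cross 1 o₃, .cross 0 o₂, .cross 1 o₁], rfl, by simpa [run, Letter.step] using hr,
          .inl (.inr (.r3 0 o₁ o₂ o₃ h))⟩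
    · intro A s t hA hr hb
      simp [List.map_eq_cons_iff] at hA
      subst hA
      match s, hr with
      | x :: y :: z :: s, hr =>
        exact ⟨[.cross 0 o₁, .cross 1 o₂, .cross 0 o₃], rfl, by simpa [run, Letter.step] using hr,
          .inr (.inr (.r3 0 o₁ o₂ o₃ h))⟩

theorem Lifts.raise {a b : List (Letter Unit)} (h : Lifts a b) (i : ℕ)
    (hab : a ≠ [] ∨ b ≠ []) : Lifts (a.map (Letter.raise i)) (b.map (Letter.raise i)) := by
  intro A s t hA hr hb
  obtain ⟨A', rfl, hA'⟩ := exists_of_plain_eq_raise hA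
  have hi : i ≤ s.length := by
    rcases hab with ha | hb'
    · have h1 := length_of_run hr
      refine le_of_strands_raise (w := A') ?_ h1
      rintro rfl
      exact ha hA'.symm
    · obtain ⟨m, hm⟩ := Option.isSome_iff_exists.1 hb
      exact le_of_strands_raise hb' hm
  obtain ⟨p, r, rfl, rfl⟩ : ∃ p r, s = p ++ r ∧ i = p.length :=
    ⟨s.take i, s.drop i, by simp, by simp [hi]⟩
  rw [run_raise, Option.map_eq_some_iff] at hr
  obtain ⟨t, hr, rfl⟩ := hr
  rw [List.length_append, add_comm, strands_raise] at hb
  obtain ⟨B, hB, hr', hm⟩ := h A' r t hA' hr (by simpa using hb)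
  refine ⟨B.map (Letter.raise p.length), ?_, by rw [run_raise, hr']; rfl,
    hm.imp (·.raise _) (·.raise _)⟩
  rw [← hB]
  simp [plain, Letter.map_raise]

theorem PlainMove.lifts {a b : List (Letter Unit)} (h : PlainMove a b) : Lifts a b ∧ Lifts b a := by
  cases h with
  | base i a b h =>
    have hab : a ≠ [] := by cases h <;> simp
    exact ⟨h.lifts.1.raise i (.inl hab), h.lifts.2.raise i (.inr hab)⟩
  | exchange l m =>
    -- Either order fits exactly if the other does, so `l` fits at the bottom in both cases.
    have fits : ∀ (l m : Letter Bool) (s t : List Bool),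
        run [l, m.raise (l.pos + l.outs)] s = some t ∨ run [m.raise (l.pos + l.ins), l] s = some t →
        l.pos + l.ins ≤ s.length := by
      intro l m s t h
      have h1 : strands [l, m.raise (l.pos + l.outs)] s.length = some t.length := by
        rcases h with h | h
        · exact length_of_run h
        · rw [Letter.strands_exchange]; exact length_of_run h
      by_contra hl
      simp [strands, Letter.strands, hl] at h1
    constructor
    · intro A s t hA hr _
      simp only [List.map_eq_cons_iff, List.map_eq_nil_iff] at hA
      obtain ⟨l', _, rfl, rfl, m', _, rfl, hm, rfl⟩ := hA
      obtain ⟨m', rfl, rfl⟩ := Letter.exists_of_map_eq_raise hm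
      simp only [Letter.pos_map, Letter.ins_map, Letter.outs_map] at hr ⊢
      refine ⟨[m'.raise (l'.pos + l'.ins), l'], by simp [Letter.map_raise], ?_,
        .inl (.inl (.exchange l' m'))⟩
      rw [← run_exchange _ _ _ (fits _ _ _ _ (.inl hr)), hr]
    · intro A s t hA hr _
      simp only [List.map_eq_cons_iff, List.map_eq_nil_iff] at hA
      obtain ⟨m', _, rfl, hm, l', _, rfl, rfl, rfl⟩ := hA
      obtain ⟨m', rfl, rfl⟩ := Letter.exists_of_map_eq_raise hm
      simp only [Letter.pos_map, Letter.ins_map, Letter.outs_map] at hr ⊢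
      refine ⟨[l', m'.raise (l'.pos + l'.outs)], by simp [Letter.map_raise], ?_,
        .inr (.inl (.exchange l' m'))⟩
      rw [run_exchange _ _ _ (fits _ _ _ _ (.inr hr)), hr]

theorem Lifts.context {a b u v w w' : List (Letter Unit)} (h : Lifts a b) {n m : ℕ}
    (hw : w = u ++ a ++ v) (hw' : w' = u ++ b ++ v) (hs : strands w' n = some m)
    {W : List (Letter Bool)} {s t : List Bool} (hs' : s.length = n) (hW : plain W = w)
    (hr : run W s = some t) : ∃ W', plain W' = w' ∧ run W' s = some t ∧ OEq s t W W' := by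
  subst hw hw' hs'
  simp only [plain, List.map_eq_append_iff] at hW
  obtain ⟨_, V, rfl, ⟨U, A, rfl, rfl, hA⟩, rfl⟩ := hW
  have hr0 := hr
  rw [List.append_assoc, run_append, Option.bind_eq_some_iff] at hr
  obtain ⟨s₁, h1, hr⟩ := hr
  rw [run_append, Option.bind_eq_some_iff] at hr
  obtain ⟨s₂, h2, h3⟩ := hr
  obtain ⟨B, hB, h4, hm⟩ := h A s₁ s₂ hA h2 (by
    rw [List.append_assoc, strands_append, strands_map, length_of_run h1, Option.bind_some,
      strands_append, Option.bind_eq_some_iff] at hs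
    obtain ⟨k, hk, _⟩ := hs
    simp [hk])
  have h5 : run (U ++ B ++ V) s = some t := by
    rw [List.append_assoc, run_append, h1, Option.bind_some, run_append, h4, Option.bind_some, h3]
  refine ⟨U ++ B ++ V, by simp [plain, ← hB], h5, ?_⟩
  rcases hm with hm | hm
  · exact .rel _ _ ⟨hr0, h5, U, V, A, B, hm, rfl, rfl⟩
  · exact .symm _ _ (.rel _ _ ⟨h5, hr0, U, V, B, A, hm, rfl, rfl⟩)

/-- Both directions are proved together, as the induction over the generated equivalence passes
through its symmetry. -/
theorem UEq.exists_lift {n m : ℕ} {w w' : List (Letter Unit)} (h : UEq n m w w')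
    {s t : List Bool} (hs : s.length = n) :
    (∀ W, plain W = w → run W s = some t → ∃ W', plain W' = w' ∧ run W' s = some t ∧ OEq s t W W') ∧
    (∀ W, plain W = w' → run W s = some t → ∃ W', plain W' = w ∧ run W' s = some t ∧ OEq s t W W') := by
  induction h with
  | rel w w' h =>
    obtain ⟨h1, h2, u, v, a, b, hm, hw, hw'⟩ := h
    exact ⟨fun W => hm.lifts.1.context hw hw' h2 hs, fun W => hm.lifts.2.context hw' hw h1 hs⟩
  | refl w => exact ⟨fun W hW hr => ⟨W, hW, hr, .refl _⟩, fun W hW hr => ⟨W, hW, hr, .refl _⟩⟩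
  | symm _ _ _ ih => exact ⟨ih.2, ih.1⟩
  | trans _ _ _ _ _ ih ih' =>
    constructor
    · intro W hW hr
      obtain ⟨W₁, h1, h2, h3⟩ := ih.1 W hW hr
      obtain ⟨W₂, h4, h5, h6⟩ := ih'.1 W₁ h1 h2
      exact ⟨W₂, h4, h5, .trans _ _ _ h3 h6⟩
    · intro W hW hr
      obtain ⟨W₁, h1, h2, h3⟩ := ih'.2 W hW hr
      obtain ⟨W₂, h4, h5, h6⟩ := ih.2 W₁ h1 h2
      exact ⟨W₂, h4, h5, .trans _ _ _ h3 h6⟩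

end SymUnion

namespace SymUnion

/-! ### Orientations of unoriented words -/

/-- The letters with a given underlying unoriented letter. -/
def Letter.orientations : Letter Unit → List (Letter Bool)
  | .cup i _ => [.cup i true, .cup i false]
  | .cap i _ => [.cap i true, .cap i false]
  | .cross i o => [.cross i o]

/-- The coherent orientations of an unoriented word, starting with strands of given directions. -/
def orientations : List (Letter Unit) → List Bool → List (List (Letter Bool))
  | [], _ => [[]]
  | l :: w, s => l.orientations.flatMap fun l' =>
      match l'.step s with
      | some t => (orientations w t).map (l' :: ·)
      | none => []

theorem mem_orientations {V : List (Letter Bool)} {s t : List Bool} (h : run V s = some t) :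
    V ∈ orientations (plain V) s := by
  induction V generalizing s with
  | nil => simp [orientations]
  | cons l V ih =>
    simp only [run, Option.bind_eq_some_iff] at h
    obtain ⟨r, hr, h⟩ := h
    simp only [plain, List.map_cons, orientations, List.mem_flatMap]
    refine ⟨l, ?_, by simpa [hr] using ih h⟩
    rcases l with ⟨i, _ | _⟩ | ⟨i, _ | _⟩ | ⟨i, o⟩ <;> simp [Letter.map, Letter.orientations]

theorem SymLetter.plain_unfold_congr {l l' : SymLetter Bool}
    (h : (l.map fun _ => ()) = l'.map fun _ => ()) (n : ℕ) :
    plain (l.unfold n) = plain (l'.unfold n) ∧ l.count n = l'.count n := by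
  rcases l with b | b | o | ⟨i, b⟩ | ⟨i, b⟩ | ⟨i, o⟩ <;>
    rcases l' with c | c | q | ⟨j, c⟩ | ⟨j, c⟩ | ⟨j, q⟩ <;>
    simp_all [SymLetter.map, Letter.map, SymLetter.unfold, SymLetter.count]

theorem plain_unfoldWord_congr {w w' : List (SymLetter Bool)}
    (h : w.map (SymLetter.map fun _ => ()) = w'.map (SymLetter.map fun _ => ())) (n : ℕ) :
    plain (unfoldWord n w) = plain (unfoldWord n w') := by
  induction w generalizing w' n with
  | nil =>
    obtain rfl : w' = [] := by simpa using h.symm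
    rfl
  | cons l w ih =>
    cases w' with
    | nil => simp at h
    | cons l' w' =>
      simp only [List.map_cons, List.cons.injEq] at h
      obtain ⟨h1, h2⟩ := SymLetter.plain_unfold_congr h.1 n
      simp only [unfoldWord, plain, List.map_append] at h1 ⊢
      rw [h1, h2]
      exact congrArg _ (ih h.2 _)

theorem symRun_append (u v : List (SymLetter Bool)) (s : List Bool) :
    symRun (u ++ v) s = (symRun u s).bind (symRun v) := by
  induction u generalizing s with
  | nil => simp [symRun]
  | cons l u ih =>
    simp only [List.cons_append, symRun]
    cases l.step s with
    | none => rfl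
    | some t => exact ih t

theorem unfoldWord_append {u v : List (SymLetter Bool)} {s t : List Bool}
    (h : symRun u s = some t) :
    unfoldWord s.length (u ++ v) = unfoldWord s.length u ++ unfoldWord t.length v := by
  induction u generalizing s with
  | nil =>
    simp only [symRun, Option.some.injEq] at h
    simp [unfoldWord, h]
  | cons l u ih =>
    simp only [symRun, Option.bind_eq_some_iff] at h
    obtain ⟨r, hr, h⟩ := h
    have h2 := (l.run_unfold s r hr).2
    simp only [List.cons_append, unfoldWord, List.append_assoc]
    rw [← h2, ih h]

/-! ### Connected sums of arcs -/

/-- `O x` is the only way to orient the tangle `M` if its lowest strand has direction `x` on the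
right of the axis; the highest strand then has direction `f x`. The full diagram of `M` is `B`. -/
structure IsArc (M : List (SymLetter Unit)) (B : List (Letter Unit))
    (O : Bool → List (SymLetter Bool)) (f : Bool → Bool) : Prop where
  map_eq : ∀ x, (O x).map (SymLetter.map fun _ => ()) = M
  plain_eq : ∀ x, plain (unfoldWord 1 (O x)) = B
  symRun_eq : ∀ x, symRun (O x) [x] = some [f x]
  orientations_eq : ∀ x, orientations B [!x, x] = [unfoldWord 1 (O x)]

/-- The orientation of the sum of `k` copies of an arc. -/
def orientedStack (O : Bool → List (SymLetter Bool)) (f : Bool → Bool) :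
    ℕ → Bool → List (SymLetter Bool)
  | 0, _ => []
  | k + 1, x => O x ++ orientedStack O f k (f x)

/-- The full diagram of a sum of `k` copies of an arc without the minimum at the bottom. -/
def orientedTail (O : Bool → List (SymLetter Bool)) (f : Bool → Bool) (k : ℕ) (x : Bool) :
    List (Letter Bool) :=
  unfoldWord 1 (orientedStack O f k x) ++ [.cap 0 (!f^[k] x)]

namespace IsArc

variable {M : List (SymLetter Unit)} {B : List (Letter Unit)} {O : Bool → List (SymLetter Bool)}
  {f : Bool → Bool}

theorem symRun_stack (h : IsArc M B O f) (k : ℕ) (x : Bool) :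
    symRun (orientedStack O f k x) [x] = some [f^[k] x] := by
  induction k generalizing x with
  | zero => rfl
  | succ k ih => rw [orientedStack, symRun_append, h.symRun_eq, Option.bind_some, ih]; rfl

theorem run_stack (h : IsArc M B O f) (k : ℕ) (x : Bool) :
    run (unfoldWord 1 (orientedStack O f k x)) [!x, x] = some [!f^[k] x, f^[k] x] :=
  run_unfoldWord _ _ _ (h.symRun_stack k x)

theorem unfoldWord_stack_succ (h : IsArc M B O f) (k : ℕ) (x : Bool) :
    unfoldWord 1 (orientedStack O f (k + 1) x) =
      unfoldWord 1 (O x) ++ unfoldWord 1 (orientedStack O f k (f x)) :=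
  unfoldWord_append (h.symRun_eq x)

theorem map_stack (h : IsArc M B O f) (k : ℕ) (x : Bool) :
    (orientedStack O f k x).map (SymLetter.map fun _ => ()) = stack k M := by
  induction k generalizing x with
  | zero => rfl
  | succ k ih => rw [orientedStack, List.map_append, h.map_eq, ih, stack_succ]

theorem plain_stack (h : IsArc M B O f) (k : ℕ) (x : Bool) :
    plain (unfoldWord 1 (orientedStack O f k x)) = stack k B := by
  induction k generalizing x with
  | zero => rfl
  | succ k ih =>
    rw [h.unfoldWord_stack_succ, plain, List.map_append, stack_succ]
    exact congrArg₂ _ (h.plain_eq x) (ih _)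

/-- The direction at the bottom of a summand determines its orientation and hence the direction at
the bottom of the next summand. -/
theorem stack_unique (h : IsArc M B O f) {k : ℕ} {x : Bool} {V : List (Letter Bool)}
    {t : List Bool} (hV : plain V = stack k B) (hr : run V [!x, x] = some t) :
    V = unfoldWord 1 (orientedStack O f k x) := by
  induction k generalizing x V with
  | zero => simpa [stack, orientedStack, unfoldWord] using hV
  | succ k ih =>
    rw [stack_succ] at hV
    obtain ⟨V₁, V₂, rfl, h1, h2⟩ := List.map_eq_append_iff.1 hV
    rw [run_append, Option.bind_eq_some_iff] at hr
    obtain ⟨s, hs, hr⟩ := hr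
    have h3 := mem_orientations hs
    rw [plain, h1, h.orientations_eq, List.mem_singleton] at h3
    subst h3
    have h4 : s = [!f x, f x] := by
      have := run_unfoldWord _ _ _ (h.symRun_eq x)
      exact Option.some.inj (hs.symm.trans this)
    subst h4
    rw [h.unfoldWord_stack_succ, ih h2 hr]

theorem run_tail (h : IsArc M B O f) (k : ℕ) (x : Bool) :
    run (orientedTail O f k x) [!x, x] = some [] := by
  rw [orientedTail, run_append, h.run_stack]
  simp [run, Letter.step]

theorem plain_tail (h : IsArc M B O f) (k : ℕ) (x : Bool) :
    plain (orientedTail O f k x) = stack k B ++ [.cap 0 ()] := by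
  rw [orientedTail, plain, List.map_append]
  exact congrArg (· ++ _) (h.plain_stack k x)

theorem tail_unique (h : IsArc M B O f) {k : ℕ} {x : Bool} {W : List (Letter Bool)}
    (hW : plain W = stack k B ++ [.cap 0 ()]) (hr : run W [!x, x] = some []) :
    W = orientedTail O f k x := by
  obtain ⟨V, C, rfl, h1, h2⟩ := List.map_eq_append_iff.1 hW
  rw [run_append, Option.bind_eq_some_iff] at hr
  obtain ⟨s, hs, hr⟩ := hr
  obtain rfl := h.stack_unique h1 hs
  rw [h.run_stack, Option.some.injEq] at hs
  subst hs
  simp only [List.map_eq_cons_iff, List.map_eq_nil_iff, Letter.map_eq_cap] at h2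
  obtain ⟨_, _, rfl, ⟨c, rfl⟩, rfl⟩ := h2
  obtain rfl : c = !f^[k] x :=
    Bool.eq_not_iff.2 (Ne.symm (by simpa [run, Letter.step] using hr))
  rfl

/-- The sum of `k` copies of an arc, closed up. -/
def closure (h : IsArc M B O f) (k : ℕ) (x : Bool) : SymDiagram :=
  ⟨.axisCup x :: orientedStack O f k x ++ [.axisCap (f^[k] x)], by
    simp [symRun, SymLetter.step, symRun_append, h.symRun_stack]⟩

theorem forget_closure (h : IsArc M B O f) (k : ℕ) (x : Bool) :
    (h.closure k x).forget = connectedSumPow (.axisCup () :: M ++ [.axisCap ()]) k := by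
  rw [connectedSumPow_eq, ← h.map_stack k x]
  simp [SymDiagram.forget, closure, SymLetter.map]

theorem unfold_closure (h : IsArc M B O f) (k : ℕ) (x : Bool) :
    (h.closure k x).unfold.1 = .cup 0 (!x) :: orientedTail O f k x := by
  have := unfoldWord_append (v := [.axisCap (f^[k] x)]) (h.symRun_stack k x)
  simp only [List.length_singleton] at this
  simp [SymDiagram.unfold, closure, unfoldWord, SymLetter.unfold, SymLetter.count, this,
    orientedTail]

theorem eq_unfold_closure (h : IsArc M B O f) {k : ℕ} {E : LinkDiagram} {D : SymDiagram}
    (hD : D.forget = connectedSumPow (.axisCup () :: M ++ [.axisCap ()]) k)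
    (hE : E.forget = D.unfold.forget) : ∃ x, E = (h.closure k x).unfold := by
  rw [← h.forget_closure k true] at hD
  have h1 : E.forget = .cup 0 () :: (stack k B ++ [.cap 0 ()]) :=
    hE.trans <| (plain_unfoldWord_congr hD 0).trans <|
      (congrArg plain (h.unfold_closure k true)).trans <|
        congrArg (List.cons _) (h.plain_tail k true)
  obtain ⟨w, hw⟩ := E
  simp only [LinkDiagram.forget, List.map_eq_cons_iff, Letter.map_eq_cup] at h1
  obtain ⟨_, W, rfl, ⟨b, rfl⟩, hW⟩ := h1
  -- The minimum at the bottom is decorated by the direction of its left leg, while `O` takes that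
  -- of the right leg.
  refine ⟨!b, Subtype.ext ?_⟩
  have hr : run W [!!b, !b] = some [] := by simpa [run, Letter.step] using hw
  rw [h.unfold_closure, ← h.tail_unique hW hr, Bool.not_not]

/-- The two possible orientations both come from symmetric diagrams. -/
theorem isSymmetricUnion (h : IsArc M B O f) (k : ℕ) :
    IsSymmetricUnion (connectedSumPow (.axisCup () :: M ++ [.axisCap ()]) k) := by
  refine ⟨⟨h.closure k true, h.forget_closure k true⟩, fun D hD E hE => ?_⟩
  obtain ⟨x, rfl⟩ := h.eq_unfold_closure hD hE
  exact ⟨h.closure k x, h.forget_closure k x, rfl⟩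

theorem oEq_reverse (h : IsArc M B O f) {k : ℕ} (hrev : UEq 2 0
    (.cross 0 true :: (stack k B ++ [.cap 0 ()])) (stack k B ++ [.cap 0 ()])) (x : Bool) :
    OEq [] [] (.cup 0 (!x) :: orientedTail O f k x) (.cup 0 x :: orientedTail O f k !x) := by
  -- Create a crossing of the two ends above the minimum. The word above this crossing now starts
  -- with exchanged directions, so by uniqueness it carries the reversed orientation.
  obtain ⟨W, hW, hr, hO⟩ := (hrev.exists_lift (s := [!x, x]) (t := []) rfl).2 _
    (h.plain_tail k x) (h.run_tail k x)
  simp only [List.map_eq_cons_iff, Letter.map_eq_cross] at hW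
  obtain ⟨_, W, rfl, rfl, hW⟩ := hW
  have hr' : run W [!!x, !x] = some [] := by simpa [run, Letter.step] using hr
  obtain rfl := h.tail_unique hW hr'
  -- Seen from below, the new crossing is a curl at the minimum and can be removed.
  have hcurl : UEq 0 2 [.cup 0 (), .cross 0 true] [.cup 0 ()] :=
    CurlRule.localEq (.curl_cup true) [.cap 0 ()] rfl 0 2 rfl rfl
  obtain ⟨C, hC, hr'', hO'⟩ := (hcurl.exists_lift (s := []) (t := [x, !x]) rfl).1
    [.cup 0 (!x), .cross 0 true] rfl (by simp [run, Letter.step])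
  simp only [List.map_eq_cons_iff, List.map_eq_nil_iff, Letter.map_eq_cup] at hC
  obtain ⟨_, _, rfl, ⟨c, rfl⟩, rfl⟩ := hC
  obtain rfl : c = x := by simpa [run, Letter.step] using hr''
  have h1 := hO.context (u := [.cup 0 (!c)]) (s' := []) (v := []) (t' := [])
    (by simp [run, Letter.step]) rfl
  have h2 := hO'.context (u := []) (s' := []) (v := orientedTail O f k !c) (t' := []) rfl
    (by simpa using h.run_tail k !c)
  simp only [List.cons_append, List.nil_append, List.append_nil] at h1 h2
  exact h1.trans _ _ _ h2

/-- The lifted equivalence joins the orientations with the same bottom direction; if the given ones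
differ there, the first diagram is reversed beforehand. -/
theorem reidemeisterEquivalent {M' : List (SymLetter Unit)} {B' : List (Letter Unit)}
    {O' : Bool → List (SymLetter Bool)} {f' : Bool → Bool} (h : IsArc M B O f)
    (h' : IsArc M' B' O' f') {k : ℕ}
    (hUEq : UEq 2 0 (stack k B ++ [.cap 0 ()]) (stack k B' ++ [.cap 0 ()]))
    (hrev : UEq 2 0 (.cross 0 true :: (stack k B ++ [.cap 0 ()])) (stack k B ++ [.cap 0 ()]))
    {D D' : SymDiagram} (hD : D.forget = connectedSumPow (.axisCup () :: M ++ [.axisCap ()]) k)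
    (hD' : D'.forget = connectedSumPow (.axisCup () :: M' ++ [.axisCap ()]) k) :
    ReidemeisterEquivalent D.unfold D'.unfold := by
  obtain ⟨x, hx⟩ := h.eq_unfold_closure hD rfl
  obtain ⟨x', hx'⟩ := h'.eq_unfold_closure hD' rfl
  have h1 : ∀ y, OEq [] [] (.cup 0 (!y) :: orientedTail O f k y)
      (.cup 0 (!y) :: orientedTail O' f' k y) := fun y => by
    obtain ⟨W, hW, hr, hO⟩ := (hUEq.exists_lift (s := [!y, y]) (t := []) rfl).1 _
      (h.plain_tail k y) (h.run_tail k y)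
    obtain rfl := h'.tail_unique hW hr
    simpa using hO.context (u := [.cup 0 (!y)]) (s' := []) (v := []) (t' := [])
      (by simp [run, Letter.step]) rfl
  have h2 : OEq [] [] D.unfold.1 D'.unfold.1 := by
    rw [hx, hx', h.unfold_closure, h'.unfold_closure]
    by_cases hxx : x' = x
    · subst hxx; exact h1 x'
    · obtain rfl : x' = !x := Bool.eq_not_iff.2 hxx
      refine (h.oEq_reverse hrev x).trans _ _ _ ?_
      have := h1 !x
      rwa [Bool.not_not] at this ⊢
  exact h2.reidemeisterEquivalent D.unfold.2 D'.unfold.2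

end IsArc

/-! ### Orientations of the four arcs and conclusion -/

open SymLetter Letter in
/-- The orientations of `mid89`. -/
def orientedMid89 (o x : Bool) : List (SymLetter Bool) :=
  [off (cup 1 (!x)),
    off (cross 0 true), axisCross o, off (cross 0 true), off (cross 0 true), axisCross (!o),
    off (cross 0 true), axisCross o, off (cross 0 true),
    off (cap 1 (!x))]

open SymLetter Letter in
/-- The orientations of `mid1042`. -/
def orientedMid1042 (x : Bool) : List (SymLetter Bool) :=
  [off (cup 1 (!x)),
    off (cross 0 false), axisCross false, off (cross 0 false), axisCross true,
    off (cross 0 false), axisCross false, off (cross 0 false), axisCross true,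
    off (cross 1 true), off (cross 0 false),
    off (cap 1 x)]

open SymLetter Letter in
/-- The orientations of `mid1042'`. -/
def orientedMid1042' (x : Bool) : List (SymLetter Bool) :=
  [off (cup 1 (!x)),
    off (cross 0 false), off (cross 0 false), axisCross true, off (cross 0 false),
    axisCross false, off (cross 0 false), off (cross 1 true), off (cross 0 false),
    off (cap 1 (!x))]

/-- Three crossings on the axis, an odd number, reverse the direction from bottom to top; for
`10_42` their number is even and the direction is kept. -/
theorem isArc_mid89 (o : Bool) : IsArc (mid89 o) (bare (block89 o)) (orientedMid89 o) (!·) where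
  map_eq _ := rfl
  plain_eq _ := rfl
  symRun_eq x := by revert o x; decide +kernel
  orientations_eq x := by revert o x; decide +kernel

theorem isArc_mid1042 : IsArc mid1042 (bare block1042) orientedMid1042 id where
  map_eq _ := rfl
  plain_eq _ := rfl
  symRun_eq := by decide +kernel
  orientations_eq := by decide +kernel

theorem isArc_mid1042' : IsArc mid1042' (bare block1042') orientedMid1042' id where
  map_eq _ := rfl
  plain_eq _ := rfl
  symRun_eq := by decide +kernel
  orientations_eq := by decide +kernel

end SymUnion

theorem corollary4p3 (k : ℕ) (hk : 1 ≤ k) :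
    (IsSymmetricUnion (connectedSumPow D1042 k) ∧ IsSymmetricUnion (connectedSumPow D1042' k) ∧
      ∀ D D' : SymDiagram,
        D.forget = connectedSumPow D1042 k → D'.forget = connectedSumPow D1042' k →
          ReidemeisterEquivalent D.unfold D'.unfold ∧ ¬ SymmetricallyEquivalent D D') ∧
    (IsSymmetricUnion (connectedSumPow D89 k) ∧ IsSymmetricUnion (connectedSumPow D89' k) ∧
      ∀ D D' : SymDiagram,
        D.forget = connectedSumPow D89 k → D'.forget = connectedSumPow D89' k →
          ReidemeisterEquivalent D.unfold D'.unfold ∧ ¬ WeaklySymmetricallyEquivalent D D') := by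
  refine ⟨⟨isArc_mid1042.isSymmetricUnion k, isArc_mid1042'.isSymmetricUnion k,
    fun D D' hD hD' => ⟨?_, not_symmetricallyEquivalent_1042 k hk D D' hD hD'⟩⟩,
    (isArc_mid89 false).isSymmetricUnion k, (isArc_mid89 true).isSymmetricUnion k,
    fun D D' hD hD' => ⟨?_, not_weaklySymmetricallyEquivalent_89 k hk D D' hD hD'⟩⟩
  · exact isArc_mid1042.reidemeisterEquivalent isArc_mid1042' (uEq_stack_block1042 k).1
      (uEq_stack_block1042 k).2 hD hD'
  · exact (isArc_mid89 false).reidemeisterEquivalent (isArc_mid89 true) (uEq_stack_block89 k).1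
      (uEq_stack_block89 k).2 hD hD'
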